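/- Let $G=(V,E)$ be a connected simple graph with $V=\{1,\dots,n\}$, $m=|E|$, and let $w:E\to\mathbb R_{\ge 0}$. For $S\subseteq V$ let $\delta(S)$ be the set of edges with exactly one end in $S$ and $w(\delta(S))=\sum_{e\in\delta(S)}w(e)$. The Weighted Connected Maximum Cut problem asks for a nonempty $S$ with $G[S]$ connected that maximizes $w(\delta(S))$. **Algorithm for $\{0,1\}$ weights.** The input is a connected graph $H$ with edge weights in $\{0,1\}$; let $W_H(v)$ be the number of weight-1 edges (1-edges) at $v$. (a) While some vertex $v$ has $W_H(v)=0$, delete $v$ and join its neighbours pairwise by edges of weight 0 where they are not adjacent. A solution $S'$ of the new graph is turned into $S'$ if $S'$ is nonempty and connected in the old graph, and into $S'\cup\{v\}$ otherwise. (b) Then, while there is a path $v_0v_1v_2v_3$ with four distinct vertices such that $v_1,v_2,v_3$ have degree two, replace it by a path $v_0vv_3$ with a new vertex $v$: both new edges get weight 1 if the old path has at least two 1-edges, only $vv_3$ gets weight 1 if it has exactly one, and neither if it has none. A solution $S'$ of the new graph is turned into the best connected set among $(S'\setminus\{v\})\cup X$, $X\subseteq\{v_1,v_2\}$. (c) In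 the reduced graph $H$, with $N$ vertices and $\eta$ 1-edges, construct subtrees $T_1,T_2,\dots$ with leaf sets $L_1,L_2,\dots$ (vertices of degree at most one in the tree): $T_i$ is a spanning tree of the current graph, obtained from an arbitrary spanning tree by exchanging one tree edge for one non-tree edge as long as this can decrease the number of degree-two vertices of the tree; then $L_i$ is deleted from the current graph, paths as in (b) are contracted, and this is repeated until no vertex is left; every tree is lifted to a subtree of $H$ with the same leaves by re-expanding the contracted paths. If $\eta\le 4N\lfloor\log_2N\rfloor$ put $T=T_1$; otherwise let $T$ be a tree $T_i$ maximizing $\sum_{v\in L_i}W_H(v)$. Split the leaf set of $T$ greedily into $L',L''$, placing each leaf in turn on the side to which it has fewer 1-edges, and take the better of the connected sets among $V(T)\setminus L'$ and $V(T)\setminus L''$. Undo the reductions (b) and (a). **Algorithm for weights $w$.** Let $\varepsilon>0$ be a parameter, $w_{\max}=\max_e w(e)$, $w_0=\varepsilon w_{\max}/m$ and $w_i=w_0(1+\varepsilon)^i$. For each integer $0\le i\le\log_{1+\varepsilon}(m/\varepsilon)$ let $w_i'(e)=1$ if $w_i\le w(e)<w_{i+1}$ and $w_i'(e)=0$ otherwise,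 and let $S_i$ be the result of the $\{0,1\}$ algorithm for $(G,w_i')$. Return a set $S_{best}$ among the $S_i$ with the largest $w(\delta(S_i))$. **Theorem.** For every $\varepsilon\in(0,1]$ there are a constant $c>0$ and a polynomial $p$, depending only on $\varepsilon$, such that for every $n$, every connected graph $G$ on $n$ vertices and every $w:E\to\mathbb R_{\ge0}$ the algorithm returns a nonempty set $S_{best}$ with $G[S_{best}]$ connected, it takes at most $p(n)$ elementary steps (with unit-cost operations on real numbers), and, if $n\ge2$, $$w(\delta(S_{best}))\ \ge\ \frac{c}{\log^2 n}\;w(\delta(T))$$ for every $T\subseteq V$ with $G[T]$ connected; that is, the algorithm is an $\Omega(1/\log^2 n)$-approximation algorithm for Weighted Connected Maximum Cut. -/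

import Mathlib

namespace CMC

/-! ### Step-counted computations

Unit-cost (real RAM) model.  A value of type `Timed α` is a result together with the number of
elementary steps spent on it.  One elementary step (`op`) evaluates an expression built from a
bounded number of array reads, comparisons, Boolean operations and arithmetic operations on
natural or real numbers.  Every traversal of `Fin n` or of a list costs, for each index, the cost
of the body plus one step.  Arrays are represented by functions on `Fin n`; a new array is only
ever produced by `table`, which pays for every entry. -/

structure Timed (α : Type) where
  val : α
  time : ℕ

namespace Timed

instance : Monad Timed where
  pure a := ⟨a, 0⟩
  bind x f := ⟨(f x.val).val, x.time + (f x.val).time⟩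

/-- One elementary step. -/
def op {α : Type} (a : α) : Timed α := ⟨a, 1⟩

/-- The steps of a full traversal of `Fin n`. -/
def loopTime {n : ℕ} {α : Type} (f : Fin n → Timed α) : ℕ := ∑ i, ((f i).time + 1)

/-- Fill an array of length `n`. -/
def table {n : ℕ} {α : Type} (f : Fin n → Timed α) : Timed (Fin n → α) :=
  ⟨fun i => (f i).val, loopTime f⟩

/-- Fill an `n × n` matrix. -/
def table₂ {n : ℕ} {α : Type} (f : Fin n → Fin n → Timed α) : Timed (Fin n → Fin n → α) :=
  table fun i => table fun j => f i j

def anyT {n : ℕ} (f : Fin n → Timed Bool) : Timed Bool :=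
  ⟨decide (∃ i, (f i).val = true), loopTime f⟩

def allT {n : ℕ} (f : Fin n → Timed Bool) : Timed Bool :=
  ⟨decide (∀ i, (f i).val = true), loopTime f⟩

def sumT {n : ℕ} {α : Type} [AddCommMonoid α] (f : Fin n → Timed α) : Timed α :=
  ⟨∑ i, (f i).val, loopTime f⟩

/-- The maximum of `0` and the computed values. -/
noncomputable def maxT {n : ℕ} (f : Fin n → Timed ℝ) : Timed ℝ :=
  ⟨(List.finRange n).foldr (fun i a => max (f i).val a) 0, loopTime f⟩

/-- The result at the first index where there is one. -/
def firstT {n : ℕ} {α : Type} (f : Fin n → Timed (Option α)) : Timed (Option α) :=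
  ⟨(List.finRange n).findSome? fun i => (f i).val, loopTime f⟩

def foldT {α β : Type} (f : β → α → Timed β) : β → List α → Timed β
  | b, [] => pure b
  | b, a :: l => do
    let b' ← f b a
    let r ← foldT f b' l
    op r

def mapT {α β : Type} (f : α → Timed β) : List α → Timed (List β)
  | [] => pure []
  | a :: l => do
    let b ← f a
    let bs ← mapT f l
    op (b :: bs)

/-- Apply `f` successively `k` times. -/
def repeatT {α : Type} (f : α → Timed α) : ℕ → α → Timed α
  | 0, a => pure a
  | k + 1, a => do
    let a' ← f a
    let r ← repeatT f k a'
    op r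

end Timed

open Timed

/-! ### Graphs, as the algorithms store them -/

/-- A set of vertices. -/
abbrev VSet (n : ℕ) := Fin n → Bool

/-- An adjacency matrix. -/
abbrev Mat (n : ℕ) := Fin n → Fin n → Bool

/-- A `{0,1}`-weighted graph: its vertices, its edges, and its edges of weight `1`. -/
structure BGraph (n : ℕ) where
  vert : VSet n
  adj : Mat n
  one : Mat n

/-- A subtree of a graph: its vertices and its edges. -/
structure Tree (n : ℕ) where
  vert : VSet n
  adj : Mat n

section Basic

variable {n : ℕ}

def emptySet : Timed (VSet n) := table fun _ => op false

/-- The vertices of `X` reachable from `r` inside `X`. -/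
def reach (adj : Mat n) (X : VSet n) (r : Fin n) : Timed (VSet n) := do
  let R₀ ← table fun v => op (decide (v = r))
  repeatT (fun R => table fun v => do
    let b ← anyT fun u => op (R u && adj u v)
    op (R v || (X v && b))) n R₀

/-- Is `X` nonempty and connected with respect to `adj`? -/
def isConn (adj : Mat n) (X : VSet n) : Timed Bool := do
  let o ← firstT fun v => op (if X v then some v else none)
  match o with
  | none => op false
  | some r => do
    let R ← reach adj X r
    allT fun v => op (!X v || R v)

/-- The number of entries of row `v`; for `adj` the degree, for `one` the number `W(v)` of
`1`-edges at `v`. -/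
def degree (M : Mat n) (v : Fin n) : Timed ℕ :=
  sumT fun u => op (if M v u then 1 else 0)

/-- The number of `1`-edges with exactly one end in `X`. -/
def cutOnes (g : BGraph n) (X : VSet n) : Timed ℕ :=
  sumT fun u => sumT fun v => op (if X u && !X v && g.one u v then 1 else 0)

/-- Among the members of a list that are connected in `g`, one with the most `1`-edges in its
cut. -/
def chooseBest (g : BGraph n) (Xs : List (VSet n)) : Timed (VSet n) := do
  let start ← emptySet
  foldT (fun B X => do
    let cX ← isConn g.adj X
    let cB ← isConn g.adj B
    let kX ← cutOnes g X
    let kB ← cutOnes g B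
    op (if cX && (!cB || decide (kB < kX)) then X else B)) start Xs

/-! ### Removing vertices without `1`-edges -/

def findZeroVertex (g : BGraph n) : Timed (Option (Fin n)) :=
  firstT fun v => do
    let d ← degree g.one v
    op (if g.vert v && decide (d = 0) then some v else none)

/-- Delete `z` and join its neighbours pairwise by `0`-edges. -/
def eliminate (g : BGraph n) (z : Fin n) : Timed (BGraph n) := do
  let vert ← table fun v => op (g.vert v && decide (v ≠ z))
  let adj ← table₂ fun u v =>
    op (decide (u ≠ z) && decide (v ≠ z) && decide (u ≠ v) &&
      (g.adj u v || (g.adj u z && g.adj z v)))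
  let one ← table₂ fun u v => op (g.one u v && decide (u ≠ z) && decide (v ≠ z))
  op ⟨vert, adj, one⟩

/-! ### Shrinking thin paths -/

/-- Four distinct vertices `v₀ v₁ v₂ v₃` of a path. -/
structure Quad (n : ℕ) where
  v₀ : Fin n
  v₁ : Fin n
  v₂ : Fin n
  v₃ : Fin n

/-- A path `v₀ v₁ v₂ v₃` whose vertices `v₁, v₂, v₃` have degree two. -/
def findThinPath (g : BGraph n) : Timed (Option (Quad n)) := do
  let d ← table fun v => degree g.adj v
  firstT fun a => firstT fun b => firstT fun c => firstT fun e =>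
    op (if g.adj a b && g.adj b c && g.adj c e &&
        decide (a ≠ c) && decide (b ≠ e) && decide (a ≠ e) &&
        decide (d b = 2) && decide (d c = 2) && decide (d e = 2)
      then some ⟨a, b, c, e⟩ else none)

/-- Is `{u, v} = {a, b}`? -/
def samePair (u v a b : Fin n) : Bool :=
  (decide (u = a) && decide (v = b)) || (decide (u = b) && decide (v = a))

/-- Replace the path `v₀ v₁ v₂ v₃` by a path `v₀ v v₃`, where `v₁` is reused as the new vertex
`v`.  If the old path has at least two `1`-edges, then both new edges are `1`-edges; if it has
one, then only `v v₃` is; if it has none, then neither is. -/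
def shrink (g : BGraph n) (p : Quad n) : Timed (BGraph n) := do
  let k ← op ((if g.one p.v₀ p.v₁ then 1 else 0) + (if g.one p.v₁ p.v₂ then 1 else 0) +
    (if g.one p.v₂ p.v₃ then 1 else 0) : ℕ)
  let vert ← table fun v => op (g.vert v && decide (v ≠ p.v₂))
  let adj ← table₂ fun u v =>
    op ((g.adj u v && decide (u ≠ p.v₂) && decide (v ≠ p.v₂)) || samePair u v p.v₁ p.v₃)
  let one ← table₂ fun u v =>
    op (if samePair u v p.v₀ p.v₁ then decide (2 ≤ k)
      else if samePair u v p.v₁ p.v₃ then decide (1 ≤ k)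
      else g.one u v && decide (u ≠ p.v₂) && decide (v ≠ p.v₂))
  op ⟨vert, adj, one⟩

/-- Turn a solution `S` of the shrunk graph into one of `g`: outside of the two inner vertices
`v₁, v₂` keep `S`, and take the best of the four possibilities for these two. -/
def recover (g : BGraph n) (p : Quad n) (S : VSet n) : Timed (VSet n) := do
  let X₀ ← table fun v => op (S v && decide (v ≠ p.v₁) && decide (v ≠ p.v₂))
  let X₁ ← table fun v => op (X₀ v || decide (v = p.v₁))
  let X₂ ← table fun v => op (X₀ v || decide (v = p.v₂))
  let X₃ ← table fun v => op (X₁ v || decide (v = p.v₂))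
  chooseBest g [X₀, X₁, X₂, X₃]

/-- Turn a subtree of the shrunk graph into one of `g`: the edge `v₁ v₃`, if used, becomes the
path `v₁ v₂ v₃`. -/
def liftTree (p : Quad n) (T : Tree n) : Timed (Tree n) := do
  let vert ← table fun v => op (T.vert v || (T.adj p.v₁ p.v₃ && decide (v = p.v₂)))
  let adj ← table₂ fun u v =>
    op (if T.adj p.v₁ p.v₃ then
        (T.adj u v && !samePair u v p.v₁ p.v₃) || samePair u v p.v₁ p.v₂ ||
          samePair u v p.v₂ p.v₃
      else T.adj u v)
  op ⟨vert, adj⟩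

/-! ### Spanning trees with many leaves -/

/-- A spanning tree: go through all pairs and delete each edge whose deletion keeps the graph
connected. -/
def spanningTree (g : BGraph n) : Timed (Tree n) := do
  let M₀ ← table₂ fun u v => op (g.adj u v)
  let M ← foldT (fun M a => foldT (fun M b =>
    if M a b then do
      let M' ← table₂ fun u v => op (M u v && !samePair u v a b)
      let c ← isConn M' g.vert
      op (if c then M' else M)
    else op M) M (List.finRange n)) M₀ (List.finRange n)
  op ⟨g.vert, M⟩

/-- The number of vertices of degree two. -/
def countDeg2 (M : Mat n) : Timed ℕ :=
  sumT fun v => do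
    let d ← degree M v
    op (if d = 2 then 1 else 0)

/-- Exchange a tree edge `ab` for an edge `xy` of `g` outside of the tree, so that the result is
again a spanning tree and has fewer vertices of degree two, if this is possible. -/
def improve (g : BGraph n) (T : Tree n) : Timed (Tree n) := do
  let k ← countDeg2 T.adj
  let o ← firstT fun a => firstT fun b => firstT fun x => firstT fun y =>
    if T.adj a b && g.adj x y && !T.adj x y then do
      let M ← table₂ fun u v => op ((T.adj u v && !samePair u v a b) || samePair u v x y)
      let c ← isConn M g.vert
      let k' ← countDeg2 M
      op (if c && decide (k' < k) then some M else none)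
    else op none
  match o with
  | none => op T
  | some M => op ⟨T.vert, M⟩

/-- A spanning tree with many leaves, by local search. -/
def leafyTree (g : BGraph n) : Timed (Tree n) := do
  let T ← spanningTree g
  repeatT (improve g) n T

/-- The leaves of a tree; the vertex of a one-vertex tree counts as a leaf. -/
def leaves (T : Tree n) : Timed (VSet n) :=
  table fun v => do
    let d ← degree T.adj v
    op (T.vert v && decide (d ≤ 1))

def deleteSet (g : BGraph n) (L : VSet n) : Timed (BGraph n) := do
  let vert ← table fun v => op (g.vert v && !L v)
  let adj ← table₂ fun u v => op (g.adj u v && !L u && !L v)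
  let one ← table₂ fun u v => op (g.one u v && !L u && !L v)
  op ⟨vert, adj, one⟩

/-- The trees `T₁, T₂, …`, as subtrees of `g`: shrink thin paths, take a spanning tree with many
leaves, delete its leaves, and repeat until no vertex is left.  The first argument bounds the
number of rounds; each round removes a vertex. -/
def peel : ℕ → BGraph n → Timed (List (Tree n))
  | 0, _ => pure []
  | k + 1, g => do
    let ne ← anyT fun v => op (g.vert v)
    if ne then do
      let o ← findThinPath g
      match o with
      | some p => do
        let g' ← shrink g p
        let Ts ← peel k g'
        mapT (liftTree p) Ts
      | none => do
        let T ← leafyTree g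
        let L ← leaves T
        let g' ← deleteSet g L
        let Ts ← peel k g'
        op (T :: Ts)
    else op []

/-! ### From a thick tree to a connected cut -/

/-- Split `L` into two parts: go through `L` and put each vertex on the side where it has fewer
`1`-edges. -/
def splitLeaves (g : BGraph n) (L : VSet n) : Timed (VSet n × VSet n) := do
  let A₀ ← emptySet
  let B₀ ← emptySet
  foldT (fun P v =>
    if L v then do
      let a ← sumT fun u => op (if P.1 u && g.one u v then 1 else 0 : ℕ)
      let b ← sumT fun u => op (if P.2 u && g.one u v then 1 else 0 : ℕ)
      if a ≤ b then do
        let A ← table fun u => op (P.1 u || decide (u = v))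
        op (A, P.2)
      else do
        let B ← table fun u => op (P.2 u || decide (u = v))
        op (P.1, B)
    else op P) (A₀, B₀) (List.finRange n)

/-- The better of `T ∖ L₁` and `T ∖ L₂`, where `L₁, L₂` split the leaves of `T`. -/
def treeCut (g : BGraph n) (T : Tree n) : Timed (VSet n) := do
  let L ← leaves T
  let P ← splitLeaves g L
  let X₁ ← table fun v => op (T.vert v && !P.1 v)
  let X₂ ← table fun v => op (T.vert v && !P.2 v)
  chooseBest g [X₁, X₂]

/-- The number of `1`-edges at the leaves of `T`, counted at each leaf: `∑ W(v)` over the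
leaves `v`. -/
def thickness (g : BGraph n) (T : Tree n) : Timed ℕ := do
  let L ← leaves T
  sumT fun v => do
    let d ← degree g.one v
    op (if L v then d else 0)

/-- `⌊log₂ k⌋`, by repeated doubling. -/
def logT (k : ℕ) : Timed ℕ := ⟨Nat.log 2 k, Nat.log 2 k + 1⟩

/-- The algorithm for reduced graphs, in which every vertex has a `1`-edge and no thin path is
left: with `η` the number of `1`-edges and `N` the number of vertices, use the first tree if
`η ≤ 4 N log N`, and otherwise the thickest of all the trees. -/
def thickSolve (g : BGraph n) : Timed (VSet n) := do
  let N ← sumT fun v => op (if g.vert v then 1 else 0 : ℕ)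
  let η ← sumT fun u => sumT fun v => op (if decide (u < v) && g.one u v then 1 else 0 : ℕ)
  let ℓ ← logT N
  let T₁ ← leafyTree g
  if η ≤ 4 * N * ℓ then treeCut g T₁
  else do
    let Ts ← peel n g
    let T ← foldT (fun B T => do
      let b ← thickness g B
      let t ← thickness g T
      op (if b < t then T else B)) T₁ Ts
    treeCut g T

/-! ### The algorithm for `{0,1}`-weights -/

/-- The `{0,1}`-connected maximum cut algorithm: remove the vertices without `1`-edges one by
one, then shrink the thin paths one by one, then use `thickSolve`, and undo the reductions.  The
first argument bounds the number of reductions; each of them removes a vertex. -/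
def bcmc : ℕ → BGraph n → Timed (VSet n)
  | 0, _ => emptySet
  | k + 1, g => do
    let z ← findZeroVertex g
    match z with
    | some v => do
      let g' ← eliminate g v
      let S ← bcmc k g'
      let c ← isConn g.adj S
      if c then op S else table fun u => op (S u || decide (u = v))
    | none => do
      let o ← findThinPath g
      match o with
      | some p => do
        let g' ← shrink g p
        let S ← bcmc k g'
        recover g p S
      | none => thickSolve g

end Basic

/-! ### The algorithm for real weights -/

section Weighted

variable {n : ℕ}

/-- `x ^ i`, by repeated multiplication. -/
noncomputable def powT (x : ℝ) (i : ℕ) : Timed ℝ := ⟨x ^ i, i + 1⟩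

/-- `⌊log_b x⌋` for `b > 1` and `x ≥ 1`, by repeated multiplication with `b`. -/
noncomputable def floorLogT (b x : ℝ) : Timed ℕ := ⟨⌊Real.logb b x⌋₊, ⌊Real.logb b x⌋₊ + 1⟩

/-- The total weight of the edges with exactly one end in `X`. -/
noncomputable def cutSum (adj : Mat n) (wt : Fin n → Fin n → ℝ) (X : VSet n) : Timed ℝ :=
  sumT fun u => sumT fun v => op (if X u && !X v && adj u v then wt u v else 0)

open Classical in
/-- The solution `S_i` for the weight class `w_i ≤ w < w_{i+1}`, where
`w_i = w_0 (1 + ε) ^ i`. -/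
noncomputable def classSolve (ε : ℝ) (adj : Mat n) (wt : Fin n → Fin n → ℝ) (w₀ : ℝ) (i : ℕ) :
    Timed (VSet n) := do
  let q ← powT (1 + ε) i
  let lo ← op (w₀ * q)
  let hi ← op (lo * (1 + ε))
  let vert ← table fun _ : Fin n => op true
  let one ← table₂ fun u v => op (adj u v && decide (lo ≤ wt u v) && decide (wt u v < hi))
  bcmc n ⟨vert, adj, one⟩

open Classical in
/-- The weighted connected maximum cut algorithm, on an adjacency matrix and a matrix of
weights. -/
noncomputable def wcmc (ε : ℝ) (adj : Mat n) (wt : Fin n → Fin n → ℝ) : Timed (VSet n) := do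
  let m ← sumT fun u => sumT fun v => op (if decide (u < v) && adj u v then 1 else 0 : ℕ)
  let wmax ← maxT fun u => maxT fun v => op (if adj u v then wt u v else 0)
  let w₀ ← op (ε * wmax / m)
  let K ← floorLogT (1 + ε) (m / ε)
  let S₀ ← classSolve ε adj wt w₀ 0
  let Ss ← mapT (fun j => classSolve ε adj wt w₀ (j + 1)) (List.range K)
  foldT (fun B S => do
    let b ← cutSum adj wt B
    let s ← cutSum adj wt S
    op (if b < s then S else B)) S₀ Ss

open Classical in
/-- The weighted connected maximum cut algorithm run on a graph `G` with edge weights `w`. -/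
noncomputable def runWCMC (ε : ℝ) (G : SimpleGraph (Fin n)) (w : Sym2 (Fin n) → ℝ) :
    Timed (VSet n) :=
  wcmc ε (fun u v => decide (G.Adj u v)) (fun u v => w s(u, v))

/-! ### The problem -/

/-- `δ(S)`: the edges of `G` with exactly one end in `S`. -/
def cut (G : SimpleGraph (Fin n)) (S : Set (Fin n)) : Set (Sym2 (Fin n)) :=
  {e | e ∈ G.edgeSet ∧ ∃ u ∈ S, ∃ v ∉ S, e = s(u, v)}

open Classical in
/-- The weight of the cut `δ(S)`. -/
noncomputable def cutWeight (G : SimpleGraph (Fin n)) (w : Sym2 (Fin n) → ℝ)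
    (S : Set (Fin n)) : ℝ :=
  ∑ e ∈ (cut G S).toFinset, w e

/-- The set that the algorithm returns. -/
def output (r : Timed (VSet n)) : Set (Fin n) := {v | r.val v = true}

end Weighted

end CMC

namespace CMC

open Timed

/-! ### Values of the step-counted combinators -/

namespace Timed

variable {α β : Type} {n : ℕ}

/-! Unit weights carry the argument: a connected cut is found that catches an Ω(1/log n) share of
what any connected set can cut. Both reductions are lossless. A vertex `z` without `1`-edges never
affects a cut, and joining its neighbours pairwise stands in for every passage through `z`
(`conn_elim`, `conn_of_conn_elim`). On a thin path with `k` `1`-edges, a connected set cuts at most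
`min(2,k)` of them if it contains both ends, `min(1,k)` if it contains one end, and `min(2,k)` if it
contains neither end. The replacement path attains the same values (`exists_pat_of_shrunk`,
`exists_shrunk_of_pat`).

In a reduced graph on `N` vertices with `η` `1`-edges, `η` itself bounds every cut. Any set of
leaves of a subtree can be deleted without disconnecting it, and the greedy split makes one of the
two remainders cut at least a quarter of the thickness, the number of `1`-edges counted at leaves
(`treeCut_spec`). A locally optimal spanning tree has at least `N/52` leaves (`card_le_leafSet`):
where it runs through a long path of degree-two vertices, an extra edge of the graph would allow an
improving exchange, so those vertices have degree two in the graph as well and form a thin path.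
Each leaf has a `1`-edge, so the first tree cuts Ω(`N`) edges, which suffices when `η` is O(`N log
N`).

When `η` is larger, the peeled trees are used. Every unshrinkable round deletes at least a 52nd of
the vertices, so there are O(log `N`) trees (`length_peel_le`). A vertex that is never a leaf was
removed by a shrinking while it had degree two, so at most `2N` edges avoid all the leaf sets
(`numOnes_le`). Hence the thicknesses add up to at least `η/2`, and the thickest tree has Ω(`η`/log
`N`) (`thickSolve_spec`, `bcmc_spec`).

For real weights, the edges lighter than `ε w_max / m` weigh at most `ε w_max` together, and the
others fall into O(log n) classes of nearly equal weight. The output is within O(log n) of the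
optimum on each class, and `w_max` itself is bounded through the class of a heaviest edge. Summing
over the classes loses the second logarithm (`GoodWeighted.wcmc_spec`). Polynomial running time
follows by composing bounds along the program (`wcmc_time`). -/

@[simp] lemma pure_val (a : α) : (pure a : Timed α).val = a := rfl

@[simp] lemma bind_val (x : Timed α) (f : α → Timed β) : (x >>= f).val = (f x.val).val := rfl

@[simp] lemma op_val (a : α) : (op a).val = a := rfl

@[simp] lemma table_val (f : Fin n → Timed α) : (table f).val = fun i => (f i).val := rfl

@[simp] lemma table₂_val (f : Fin n → Fin n → Timed α) :
    (table₂ f).val = fun i j => (f i j).val := rfl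

@[simp] lemma anyT_val (f : Fin n → Timed Bool) :
    (anyT f).val = decide (∃ i, (f i).val = true) := rfl

@[simp] lemma allT_val (f : Fin n → Timed Bool) :
    (allT f).val = decide (∀ i, (f i).val = true) := rfl

@[simp] lemma sumT_val [AddCommMonoid α] (f : Fin n → Timed α) :
    (sumT f).val = ∑ i, (f i).val := rfl

@[simp] lemma foldT_val (f : β → α → Timed β) (b : β) (l : List α) :
    (foldT f b l).val = l.foldl (fun b a => (f b a).val) b := by
  induction l generalizing b with
  | nil => rfl
  | cons a l ih => simpa [foldT] using ih _

@[simp] lemma mapT_val (f : α → Timed β) (l : List α) :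
    (mapT f l).val = l.map fun a => (f a).val := by
  induction l with
  | nil => rfl
  | cons a l ih => simpa [mapT] using ih

@[simp] lemma repeatT_val (f : α → Timed α) (k : ℕ) (a : α) :
    (repeatT f k a).val = (fun x => (f x).val)^[k] a := by
  induction k generalizing a with
  | zero => rfl
  | succ k ih => simpa [repeatT] using ih _

lemma firstT_val_eq_none {f : Fin n → Timed (Option α)} :
    (firstT f).val = none ↔ ∀ i, (f i).val = none := by
  simp [firstT]

lemma exists_of_firstT_val_eq_some {f : Fin n → Timed (Option α)} {a : α}
    (h : (firstT f).val = some a) : ∃ i, (f i).val = some a := by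
  obtain ⟨i, -, hi⟩ := List.exists_of_findSome?_eq_some h
  exact ⟨i, hi⟩

end Timed

/-- An iteration along which a natural number strictly decreases becomes stationary. -/
lemma iterate_stationary {α : Type*} (F : α → α) (μ : α → ℕ)
    (h : ∀ a, F a ≠ a → μ (F a) < μ a) (k : ℕ) (a : α) (hk : μ a ≤ k) :
    F (F^[k] a) = F^[k] a := by
  induction k generalizing a with
  | zero =>
    by_contra hne
    have := h a hne
    omega
  | succ k ih =>
    by_cases hfix : F a = a
    · rw [Function.iterate_fixed hfix, hfix]
    · rw [Function.iterate_succ_apply]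
      exact ih _ (by have := h a hfix; omega)

section Basic

variable {n : ℕ}

/-! ### Connected sets -/

/-- `X` is nonempty and connected with respect to `M`: a subset of `X` that is closed under
adjacency and nonempty is all of `X`. -/
def Conn (M : Mat n) (X : VSet n) : Prop :=
  (∃ v, X v = true) ∧ ∀ P : Fin n → Prop, (∃ r, X r = true ∧ P r) →
    (∀ u v, X u = true → X v = true → P u → M u v = true → P v) → ∀ v, X v = true → P v

/-- The matrix `M` is symmetric. -/
def Symm (M : Mat n) : Prop := ∀ u v, M u v = M v u

lemma Conn.mono {M M' : Mat n} {X : VSet n} (h : Conn M X)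
    (hM : ∀ u v, X u = true → X v = true → M u v = true → M' u v = true) : Conn M' X :=
  ⟨h.1, fun P hr hP => h.2 P hr fun u v hu hv hPu huv => hP u v hu hv hPu (hM u v hu hv huv)⟩

/-- By symmetry the complement of a closed predicate is closed too. If `P` failed at `r`, the
hypothesis applied to `¬ P` would make `P` fail everywhere. So testing closed predicates from a
single root is enough. -/
lemma conn_of_root {M : Mat n} (hM : Symm M) {X : VSet n} {r : Fin n} (hr : X r = true)
    (h : ∀ P : Fin n → Prop, P r →
      (∀ u v, X u = true → X v = true → P u → M u v = true → P v) → ∀ v, X v = true → P v) :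
    Conn M X := by
  refine ⟨⟨r, hr⟩, fun P ⟨s, hs, hPs⟩ hP => ?_⟩
  have hPr : P r := by
    by_contra hPr
    exact h (fun v => ¬ P v) hPr
      (fun u v hu hv hPu huv hPv => hPu (hP v u hv hu hPv (by rw [hM]; exact huv))) s hs hPs
  exact h P hPr hP

lemma conn_singleton {M : Mat n} {X : VSet n} {r : Fin n} (hX : ∀ v, X v = true ↔ v = r) :
    Conn M X := by
  refine ⟨⟨r, (hX r).2 rfl⟩, fun P ⟨s, hs, hPs⟩ _ v hv => ?_⟩
  rw [hX] at hs hv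
  rwa [hv, ← hs]

/-- One round of breadth-first search inside `X`. -/
def grow (M : Mat n) (X R : VSet n) : VSet n :=
  fun v => R v || (X v && decide (∃ u, (R u && M u v) = true))

lemma reach_val (M : Mat n) (X : VSet n) (r : Fin n) :
    (reach M X r).val = (grow M X)^[n] fun v => decide (v = r) := by
  simp only [reach, bind_val, table_val, op_val, repeatT_val]
  rfl

/-- Every round that is not stationary adds a vertex, so the number of unreached vertices, at most
`n`, strictly drops. This is why `n` rounds of search suffice. -/
lemma grow_reach (M : Mat n) (X : VSet n) (r : Fin n) :
    grow M X (reach M X r).val = (reach M X r).val := by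
  rw [reach_val]
  refine iterate_stationary (grow M X)
    (fun R => (Finset.univ.filter fun v => R v = false).card) (fun R hR => ?_) n _ ?_
  · have hle : ∀ v, R v = true → grow M X R v = true := fun v hv => by simp [grow, hv]
    obtain ⟨v, hv⟩ := Function.ne_iff.1 hR
    refine Finset.card_lt_card (Finset.ssubset_iff_of_subset ?_ |>.2 ⟨v, ?_, ?_⟩)
    · intro u
      simp only [Finset.mem_filter, Finset.mem_univ, true_and]
      intro hu
      by_contra hu'
      rw [Bool.not_eq_false] at hu'
      rw [hle u hu'] at hu
      simp at hu
    · simp only [Finset.mem_filter, Finset.mem_univ, true_and]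
      by_contra hu'
      rw [Bool.not_eq_false] at hu'
      exact hv (by rw [hle v hu', hu'])
    · simp only [Finset.mem_filter, Finset.mem_univ, true_and]
      intro hf
      by_cases hRv : R v = true
      · rw [hle v hRv] at hf; simp at hf
      · exact hv (by rw [hf]; simpa using hRv)
  · exact (Finset.card_le_univ _).trans (by simp)

lemma reach_root (M : Mat n) (X : VSet n) (r : Fin n) : (reach M X r).val r = true := by
  rw [reach_val]
  have : ∀ k (R : VSet n), R r = true → ((grow M X)^[k] R) r = true := by
    intro k
    induction k with
    | zero => exact fun R h => h
    | succ k ih =>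
      intro R h
      rw [Function.iterate_succ_apply]
      exact ih _ (by simp [grow, h])
  exact this n _ (by simp)

lemma reach_step {M : Mat n} {X : VSet n} {r u v : Fin n} (hu : (reach M X r).val u = true)
    (hv : X v = true) (huv : M u v = true) : (reach M X r).val v = true := by
  rw [← grow_reach]
  simp only [grow, hv, Bool.true_and, Bool.or_eq_true, decide_eq_true_eq]
  exact Or.inr ⟨u, by simp [hu, huv]⟩

lemma reach_induction {M : Mat n} {X : VSet n} {r : Fin n} {P : Fin n → Prop} (hr : P r)
    (hP : ∀ u v, P u → X v = true → M u v = true → P v) (v : Fin n)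
    (hv : (reach M X r).val v = true) : P v := by
  rw [reach_val] at hv
  have : ∀ k (R : VSet n), (∀ v, R v = true → P v) → ∀ v, ((grow M X)^[k] R) v = true → P v := by
    intro k
    induction k with
    | zero => exact fun R h => h
    | succ k ih =>
      intro R h
      rw [Function.iterate_succ_apply]
      refine ih _ fun v hv => ?_
      simp only [grow, Bool.or_eq_true, Bool.and_eq_true, decide_eq_true_eq] at hv
      rcases hv with hv | ⟨hXv, u, hu, huv⟩
      · exact h v hv
      · exact hP u v (h u hu) hXv huv
  exact this n _ (by simpa using hr) v hv

lemma isConn_val {M : Mat n} (hM : Symm M) (X : VSet n) :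
    (isConn M X).val = true ↔ Conn M X := by
  simp only [isConn, bind_val]
  rcases ho : (firstT fun v => op (if X v then some v else none)).val with _ | r
  · rw [firstT_val_eq_none] at ho
    simp only [op_val, ite_eq_right_iff, reduceCtorEq, imp_false] at ho
    simp only [op_val, Bool.false_eq_true, false_iff]
    rintro ⟨⟨v, hv⟩, -⟩
    exact ho v hv
  · obtain ⟨i, hi⟩ := exists_of_firstT_val_eq_some ho
    have hr : X r = true := by
      simp only [op_val, Option.ite_none_right_eq_some, Option.some.injEq] at hi
      rw [← hi.2]; exact hi.1
    simp only [bind_val, allT_val, op_val, decide_eq_true_eq, Bool.or_eq_true, Bool.not_eq_true']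
    constructor
    · intro h
      refine conn_of_root hM hr fun P hPr hP v hv => ?_
      refine (reach_induction (P := fun v => X v = true ∧ P v) ⟨hr, hPr⟩
        (fun u v hu hv huv => ⟨hv, hP u v hu.1 hv hu.2 huv⟩) v ?_).2
      rcases h v with h | h
      · rw [h] at hv; simp at hv
      · exact h
    · intro h v
      by_cases hv : X v = true
      · exact Or.inr (h.2 (fun v => (reach M X r).val v = true) ⟨r, hr, reach_root M X r⟩
          (fun u v _ hv hu huv => reach_step hu hv huv) v hv)
      · exact Or.inl (by simpa using hv)

/-! ### Degrees and cuts -/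

/-- The number of entries of row `v`. -/
def deg (M : Mat n) (v : Fin n) : ℕ := (Finset.univ.filter fun u => M v u = true).card

/-- The number of entries of `O` from `X` to its complement. -/
def cutN (O : Mat n) (X : VSet n) : ℕ :=
  ∑ u, ∑ v, if (X u && !X v && O u v) = true then 1 else 0

@[simp] lemma degree_val (M : Mat n) (v : Fin n) : (degree M v).val = deg M v := by
  simp [degree, deg]

@[simp] lemma cutOnes_val (g : BGraph n) (X : VSet n) : (cutOnes g X).val = cutN g.one X := by
  simp [cutOnes, cutN]

@[simp] lemma emptySet_val : (emptySet : Timed (VSet n)).val = fun _ => false := rfl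

lemma not_conn_empty (M : Mat n) : ¬ Conn M fun _ => false := by
  rintro ⟨⟨v, hv⟩, -⟩
  simp at hv

/-- The fold starts from the empty set, which is never connected, so the first connected candidate
replaces it; from then on the stored set stays connected and its cut never shrinks. -/
lemma chooseBest_spec {g : BGraph n} (hg : Symm g.adj) {Xs : List (VSet n)}
    (hXs : ∃ X ∈ Xs, Conn g.adj X) :
    (chooseBest g Xs).val ∈ Xs ∧ Conn g.adj (chooseBest g Xs).val ∧
      ∀ X ∈ Xs, Conn g.adj X → cutN g.one X ≤ cutN g.one (chooseBest g Xs).val := by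
  let f : VSet n → VSet n → VSet n := fun B X =>
    if (isConn g.adj X).val && (!(isConn g.adj B).val || decide (cutN g.one B < cutN g.one X))
    then X else B
  have hval : (chooseBest g Xs).val = Xs.foldl f fun _ => false := by
    simp only [chooseBest, bind_val, foldT_val, op_val, cutOnes_val, emptySet_val]
    rfl
  rw [hval]
  have hf : ∀ B X, (Conn g.adj X ∧ (¬ Conn g.adj B ∨ cutN g.one B < cutN g.one X) ∧ f B X = X) ∨
      ((¬ Conn g.adj X ∨ (Conn g.adj B ∧ cutN g.one X ≤ cutN g.one B)) ∧ f B X = B) := by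
    intro B X
    have hX := isConn_val hg X
    have hB := isConn_val hg B
    by_cases h : ((isConn g.adj X).val &&
        (!(isConn g.adj B).val || decide (cutN g.one B < cutN g.one X))) = true
    · left
      refine ⟨?_, ?_, if_pos h⟩ <;> grind
    · right
      refine ⟨?_, if_neg h⟩
      grind
  have key : ∀ (l : List (VSet n)) (B : VSet n),
      (l.foldl f B = B ∨ l.foldl f B ∈ l) ∧
      ((Conn g.adj B ∨ ∃ X ∈ l, Conn g.adj X) → Conn g.adj (l.foldl f B)) ∧
      (Conn g.adj B → cutN g.one B ≤ cutN g.one (l.foldl f B)) ∧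
      ∀ X ∈ l, Conn g.adj X → cutN g.one X ≤ cutN g.one (l.foldl f B) := by
    intro l
    induction l with
    | nil => intro B; simp
    | cons X l ih =>
      intro B
      obtain ⟨h1, h2, h3, h4⟩ := ih (f B X)
      rw [List.foldl_cons]
      rcases hf B X with ⟨hX, hBX, he⟩ | ⟨hX, he⟩ <;> rw [he] at h1 h2 h3 h4 ⊢ <;>
        refine ⟨?_, ?_, ?_, ?_⟩ <;> grind
  obtain ⟨h1, h2, h3, h4⟩ := key Xs fun _ => false
  refine ⟨?_, h2 (Or.inr hXs), h4⟩
  rcases h1 with h1 | h1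
  · have := h2 (Or.inr hXs)
    rw [h1] at this
    exact absurd this (not_conn_empty _)
  · exact h1

end Basic

end CMC

namespace CMC

open Timed

/-! ### Representation invariants and the two reductions -/

section Basic

variable {n : ℕ}

/-- The representation invariants of a nonempty connected `{0,1}`-weighted graph. -/
structure Good (g : BGraph n) : Prop where
  symm : Symm g.adj
  irrefl : ∀ v, g.adj v v = false
  mem : ∀ u v, g.adj u v = true → g.vert u = true
  one_adj : ∀ u v, g.one u v = true → g.adj u v = true
  one_symm : Symm g.one
  conn : Conn g.adj g.vert

/-- The number of elements of `X`. -/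
def card (X : VSet n) : ℕ := (Finset.univ.filter fun v => X v = true).card

lemma card_remove {X Y : VSet n} {z : Fin n} (hz : X z = true)
    (hY : ∀ v, Y v = (X v && decide (v ≠ z))) : card X = card Y + 1 := by
  have : (Finset.univ.filter fun v => X v = true) =
      insert z (Finset.univ.filter fun v => Y v = true) := by
    ext v
    simp only [Finset.mem_filter, Finset.mem_univ, true_and, Finset.mem_insert, hY]
    grind
  unfold card
  rw [this, Finset.card_insert_of_notMem]
  simp [hY]

lemma card_pos_iff {X : VSet n} : 0 < card X ↔ ∃ v, X v = true := by
  simp [card, Finset.card_pos, Finset.Nonempty]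

/-! ### Pendant and isolated vertices -/

lemma conn_insert_pendant {M : Mat n} (hM : Symm M) {X X' : VSet n} {a b : Fin n}
    (hX : ∀ v, v ≠ b → X' v = X v) (hb : X b = false) (ha : X a = true)
    (hab : M a b = true) (h : Conn M X) : Conn M X' := by
  have hne : a ≠ b := by rintro rfl; simp [hb] at ha
  have ha' : X' a = true := by rw [hX a hne]; exact ha
  refine conn_of_root hM ha' fun P hPa hP v hv => ?_
  by_cases hvb : v = b
  · subst hvb; exact hP a v ha' hv hPa hab
  · refine h.2 P ⟨a, ha, hPa⟩ (fun u w hu hw hPu huw => ?_) v (by rw [← hX v hvb]; exact hv)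
    exact hP u w (by rw [hX u (by rintro rfl; simp [hb] at hu)]; exact hu)
      (by rw [hX w (by rintro rfl; simp [hb] at hw)]; exact hw) hPu huw

/-- A walk through `b` enters and leaves by its only neighbour `a`, so the predicate "`v = b` or `P
v`" is closed whenever `P` is closed on `X`. -/
lemma conn_remove_pendant {M : Mat n} (hM : Symm M) {X X' : VSet n} {a b : Fin n}
    (hX : ∀ v, v ≠ b → X' v = X v) (hb : X b = false) (ha : X a = true)
    (hb' : ∀ u, X u = true → M u b = true → u = a) (h : Conn M X') : Conn M X := by
  refine conn_of_root hM ha fun P hPa hP v hv => ?_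
  have hne : ∀ {u}, X u = true → u ≠ b := by rintro u hu rfl; simp [hb] at hu
  have := h.2 (fun v => v = b ∨ P v) ⟨a, by rw [hX a (hne ha)]; exact ha, Or.inr hPa⟩
    (fun u w hu hw hPu huw => by
      by_cases hwb : w = b
      · exact Or.inl hwb
      · right
        rw [hX w hwb] at hw
        rcases hPu with rfl | hPu
        · rw [hb' w hw (by rw [hM]; exact huw)]; exact hPa
        · by_cases hub : u = b
          · subst hub
            rw [hb' w hw (by rw [hM]; exact huw)]; exact hPa
          · rw [hX u hub] at hu
            exact hP u w hu hw hPu huw) v (by rw [hX v (hne hv)]; exact hv)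
  exact this.resolve_left (hne hv)

lemma conn_pendant_iff {M : Mat n} (hM : Symm M) {X X' : VSet n} {a b : Fin n}
    (hX : ∀ v, v ≠ b → X' v = X v) (hb : X b = false) (ha : X a = true)
    (hab : M a b = true) (hb' : ∀ u, X u = true → M u b = true → u = a) :
    Conn M X ↔ Conn M X' :=
  ⟨conn_insert_pendant hM hX hb ha hab, conn_remove_pendant hM hX hb ha hb'⟩

lemma not_conn_of_isolated {M : Mat n} {X : VSet n} {a b : Fin n} (ha : X a = true)
    (hb : X b = true) (hab : a ≠ b) (h : ∀ u, X u = true → M b u = false) : ¬ Conn M X := by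
  intro hc
  exact hab (hc.2 (fun v => v = b) ⟨b, hb, rfl⟩
    (fun u v _ hv hu huv => by subst hu; rw [h v hv] at huv; simp at huv) a ha)

/-! ### Removing vertices without `1`-edges -/

/-- The graph computed by `eliminate`. -/
def elim (g : BGraph n) (z : Fin n) : BGraph n where
  vert := fun v => g.vert v && decide (v ≠ z)
  adj := fun u v => decide (u ≠ z) && decide (v ≠ z) && decide (u ≠ v) &&
    (g.adj u v || (g.adj u z && g.adj z v))
  one := fun u v => g.one u v && decide (u ≠ z) && decide (v ≠ z)

lemma cutN_congr {O : Mat n} {X Y : VSet n}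
    (h : ∀ u v, O u v = true → X u = Y u ∧ X v = Y v) : cutN O X = cutN O Y := by
  refine Finset.sum_congr rfl fun u _ => Finset.sum_congr rfl fun v _ => ?_
  by_cases huv : O u v = true
  · rw [(h u v huv).1, (h u v huv).2]
  · simp [huv]

/-- A walk `u, z, w` in `S` is short-cut by the new edge `uw`. The induction predicate remembers, on
arrival at `z`, a neighbour already satisfying `P` from which to continue. -/
lemma conn_elim {g : BGraph n} (hg : Good g) {z : Fin n} {S S' : VSet n}
    (hS' : ∀ v, S' v = (S v && decide (v ≠ z))) (hne : ∃ v, S' v = true) (h : Conn g.adj S) :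
    Conn (elim g z).adj S' := by
  refine ⟨hne, fun P ⟨r, hr, hPr⟩ hP v hv => ?_⟩
  have key := h.2 (fun v => (v ≠ z → P v) ∧
    (v = z → ∃ u, S' u = true ∧ P u ∧ g.adj u z = true)) ⟨r, by grind, by grind⟩ ?_ v (by grind)
  · exact key.1 (by grind)
  · intro u w hu hw hPu huw
    have hsym := hg.symm
    unfold Symm at hsym
    have hirr := hg.irrefl
    refine ⟨fun hwz => ?_, fun hwz => ?_⟩
    · by_cases huz : u = z
      · obtain ⟨y, hy, hPy, hyz⟩ := hPu.2 huz
        by_cases hyw : y = w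
        · exact hyw ▸ hPy
        · refine hP y w hy (by grind) hPy ?_
          simp only [elim]
          grind
      · refine hP u w (by grind) (by grind) (hPu.1 huz) ?_
        simp only [elim]
        grind
    · subst hwz
      have huz : u ≠ w := by rintro rfl; simp [hirr] at huw
      exact ⟨u, by grind, hPu.1 huz, huw⟩

/-- If `S` contains a neighbour of `z`, every added edge inside `S` can be replaced by a detour
through `z`. If it contains none, no added edge lies inside `S`, so `S` was already connected. -/
lemma conn_of_conn_elim {g : BGraph n} (hg : Good g) {z : Fin n} {S : VSet n}
    (h : Conn (elim g z).adj S) (hS : ¬ Conn g.adj S) :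
    Conn g.adj fun u => S u || decide (u = z) := by
  by_cases hex : ∃ u, S u = true ∧ g.adj u z = true
  · obtain ⟨a, ha, haz⟩ := hex
    refine conn_of_root hg.symm (r := z) (by simp) fun P hPz hP => ?_
    have hPa : P a := hP z a (by simp) (by simp [ha]) hPz (by rw [hg.symm]; exact haz)
    have key := h.2 P ⟨a, ha, hPa⟩ fun u w hu hw hPu huw => by
      simp only [elim, Bool.and_eq_true, decide_eq_true_eq, Bool.or_eq_true] at huw
      rcases huw.2 with huw | ⟨-, hzw⟩
      · exact hP u w (by simp [hu]) (by simp [hw]) hPu huw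
      · exact hP z w (by simp) (by simp [hw]) hPz hzw
    intro v hv
    by_cases hvz : v = z
    · exact hvz ▸ hPz
    · exact key v (by simpa [hvz] using hv)
  · refine absurd (h.mono fun u v hu hv huv => ?_) hS
    simp only [elim, Bool.and_eq_true, decide_eq_true_eq, Bool.or_eq_true] at huv
    rcases huv.2 with huv | ⟨huz, -⟩
    · exact huv
    · exact absurd ⟨u, hu, huz⟩ hex

lemma Good.elim {g : BGraph n} (hg : Good g) {z : Fin n}
    (hne : ∃ v, (elim g z).vert v = true) : Good (elim g z) := by
  have hsym := hg.symm
  have hosym := hg.one_symm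
  have hone := hg.one_adj
  have hirr := hg.irrefl
  have hmem := hg.mem
  unfold Symm at hsym hosym
  refine ⟨?_, ?_, ?_, ?_, ?_, conn_elim hg (fun _ => rfl) hne hg.conn⟩
  · intro u v
    simp only [CMC.elim]
    rw [Bool.eq_iff_iff]
    simp only [Bool.and_eq_true, decide_eq_true_eq, Bool.or_eq_true]
    grind
  · intro v; simp [CMC.elim]
  · intro u v
    simp only [CMC.elim, Bool.and_eq_true, decide_eq_true_eq, Bool.or_eq_true]
    grind
  · intro u v
    simp only [CMC.elim, Bool.and_eq_true, decide_eq_true_eq, Bool.or_eq_true]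
    grind
  · intro u v
    simp only [CMC.elim]
    rw [Bool.eq_iff_iff]
    simp only [Bool.and_eq_true, decide_eq_true_eq]
    grind

lemma elim_one {g : BGraph n} (hg : Good g) {z : Fin n} (hz : deg g.one z = 0) :
    (elim g z).one = g.one ∧ (∀ u v, g.one u v = true → u ≠ z ∧ v ≠ z) := by
  have hz' : ∀ u, g.one z u = false := by
    simpa [deg, Finset.filter_eq_empty_iff] using hz
  have h2 : ∀ u v, g.one u v = true → u ≠ z ∧ v ≠ z := by
    intro u v huv
    constructor
    · rintro rfl; simp [hz'] at huv
    · rintro rfl; rw [hg.one_symm] at huv; simp [hz'] at huv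
  refine ⟨?_, h2⟩
  funext u v
  simp only [elim]
  rw [Bool.eq_iff_iff]
  simp only [Bool.and_eq_true, decide_eq_true_eq]
  have := h2 u v
  tauto

/-! ### Shrinking thin paths -/

/-- The path `v₀ v₁ v₂ v₃` has four distinct vertices, and its last three vertices have degree
two. -/
structure Thin (g : BGraph n) (p : Quad n) : Prop where
  adj₀₁ : g.adj p.v₀ p.v₁ = true
  adj₁₂ : g.adj p.v₁ p.v₂ = true
  adj₂₃ : g.adj p.v₂ p.v₃ = true
  ne₀₂ : p.v₀ ≠ p.v₂
  ne₁₃ : p.v₁ ≠ p.v₃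
  ne₀₃ : p.v₀ ≠ p.v₃
  deg₁ : deg g.adj p.v₁ = 2
  deg₂ : deg g.adj p.v₂ = 2
  deg₃ : deg g.adj p.v₃ = 2

lemma findThinPath_eq_none {g : BGraph n} (h : (findThinPath g).val = none) (p : Quad n) :
    ¬ Thin g p := by
  intro hp
  simp only [findThinPath, bind_val, table_val, degree_val, firstT_val_eq_none, op_val] at h
  have := h p.v₀ p.v₁ p.v₂ p.v₃
  simp [hp.adj₀₁, hp.adj₁₂, hp.adj₂₃, hp.ne₀₂, hp.ne₁₃, hp.ne₀₃, hp.deg₁, hp.deg₂, hp.deg₃] at this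

lemma findThinPath_eq_some {g : BGraph n} {p : Quad n} (h : (findThinPath g).val = some p) :
    Thin g p := by
  simp only [findThinPath, bind_val, table_val, degree_val] at h
  obtain ⟨a, h⟩ := exists_of_firstT_val_eq_some h
  obtain ⟨b, h⟩ := exists_of_firstT_val_eq_some h
  obtain ⟨c, h⟩ := exists_of_firstT_val_eq_some h
  obtain ⟨e, h⟩ := exists_of_firstT_val_eq_some h
  simp only [op_val, Option.ite_none_right_eq_some, Bool.and_eq_true, decide_eq_true_eq,
    Option.some.injEq] at h
  obtain ⟨⟨⟨⟨⟨⟨⟨⟨⟨h1, h2⟩, h3⟩, h4⟩, h5⟩, h6⟩, h7⟩, h8⟩, h9⟩, rfl⟩ := h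
  exact ⟨h1, h2, h3, h4, h5, h6, h7, h8, h9⟩

lemma eq_or_eq_of_deg_two {M : Mat n} {v a b : Fin n} (h : deg M v = 2) (ha : M v a = true)
    (hb : M v b = true) (hab : a ≠ b) {u : Fin n} (hu : M v u = true) : u = a ∨ u = b := by
  have hs : ({a, b} : Finset (Fin n)) = Finset.univ.filter fun u => M v u = true := by
    refine Finset.eq_of_subset_of_card_le ?_ ?_
    · intro u; simp only [Finset.mem_insert, Finset.mem_singleton, Finset.mem_filter,
        Finset.mem_univ, true_and]; rintro (rfl | rfl) <;> assumption
    · rw [Finset.card_pair hab]; exact h.le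
  have : u ∈ ({a, b} : Finset (Fin n)) := by rw [hs]; simpa using hu
  simpa using this

/-- The number of `1`-edges of the path `v₀ v₁ v₂ v₃`. -/
def pathOnes (g : BGraph n) (p : Quad n) : ℕ :=
  (if g.one p.v₀ p.v₁ then 1 else 0) + (if g.one p.v₁ p.v₂ then 1 else 0) +
    (if g.one p.v₂ p.v₃ then 1 else 0)

/-- The graph computed by `shrink`. -/
def shrunk (g : BGraph n) (p : Quad n) : BGraph n where
  vert := fun v => g.vert v && decide (v ≠ p.v₂)
  adj := fun u v => (g.adj u v && decide (u ≠ p.v₂) && decide (v ≠ p.v₂)) ||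
    samePair u v p.v₁ p.v₃
  one := fun u v => if samePair u v p.v₀ p.v₁ then decide (2 ≤ pathOnes g p)
    else if samePair u v p.v₁ p.v₃ then decide (1 ≤ pathOnes g p)
    else g.one u v && decide (u ≠ p.v₂) && decide (v ≠ p.v₂)

lemma samePair_iff {u v a b : Fin n} :
    samePair u v a b = true ↔ (u = a ∧ v = b) ∨ (u = b ∧ v = a) := by
  simp [samePair]

lemma samePair_comm (u v a b : Fin n) : samePair u v a b = samePair v u a b := by
  rw [Bool.eq_iff_iff, samePair_iff, samePair_iff]; tauto

/-- The set that agrees with `Y` outside of `{v₁, v₂}`, and has the prescribed values there. -/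
def pat (p : Quad n) (Y : VSet n) (x₁ x₂ : Bool) : VSet n :=
  fun v => if v = p.v₁ then x₁ else if v = p.v₂ then x₂ else Y v

/-- The contribution of an edge to a cut. -/
def edgeCut (o x y : Bool) : ℕ := if (o && (x != y)) = true then 1 else 0

/-- Delete the edge `ab`. -/
def eraseEdge (O : Mat n) (a b : Fin n) : Mat n := fun u v => O u v && !samePair u v a b

lemma Symm.eraseEdge {O : Mat n} (hO : Symm O) (a b : Fin n) : Symm (eraseEdge O a b) := by
  intro u v
  simp only [CMC.eraseEdge]
  rw [hO, samePair_comm]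

/-- `cutN` counts ordered pairs leaving `X`, so of the two orientations of a symmetric edge at most
one contributes. Erasing the path edges one at a time isolates their share of the cut. -/
lemma cutN_eraseEdge {O : Mat n} (hO : Symm O) {a b : Fin n} (hab : a ≠ b) (X : VSet n) :
    cutN O X = cutN (eraseEdge O a b) X + edgeCut (O a b) (X a) (X b) := by
  have hsingle : ∀ (c d : Fin n) (t : ℕ),
      (∑ u, ∑ v, if u = c ∧ v = d then t else 0) = t := by
    intro c d t
    rw [Finset.sum_eq_single c, Finset.sum_eq_single d] <;> simp +contextual
  have : edgeCut (O a b) (X a) (X b) =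
      ∑ u, ∑ v, ((if u = a ∧ v = b then (if (X a && !X b && O a b) = true then 1 else 0) else 0) +
        (if u = b ∧ v = a then (if (X b && !X a && O a b) = true then 1 else 0) else 0)) := by
    simp only [Finset.sum_add_distrib]
    rw [hsingle, hsingle]
    unfold edgeCut
    cases X a <;> cases X b <;> cases O a b <;> rfl
  rw [this, cutN, cutN, ← Finset.sum_add_distrib]
  refine Finset.sum_congr rfl fun u _ => ?_
  rw [← Finset.sum_add_distrib]
  refine Finset.sum_congr rfl fun v _ => ?_
  simp only [eraseEdge]
  have h1 := samePair_iff (u := u) (v := v) (a := a) (b := b)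
  have h2 := hO a b
  by_cases h : u = a ∧ v = b
  · obtain ⟨rfl, rfl⟩ := h
    simp [hab, samePair]
  · by_cases h' : u = b ∧ v = a
    · obtain ⟨rfl, rfl⟩ := h'
      simp [hab, hab.symm, samePair, h2]
    · have h3 : samePair u v a b = false := by rw [← Bool.not_eq_true, h1]; tauto
      simp [h, h', h3]

end Basic

end CMC

namespace CMC

open Timed

section Basic

variable {n : ℕ}

/-! ### Cuts and connectedness across a shrunk path -/

section Shrink

variable {g : BGraph n} {p : Quad n}

lemma Thin.ne₀₁ (hg : Good g) (hp : Thin g p) : p.v₀ ≠ p.v₁ := by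
  intro h
  have := hp.adj₀₁
  rw [h, hg.irrefl] at this
  simp at this

lemma Thin.ne₁₂ (hg : Good g) (hp : Thin g p) : p.v₁ ≠ p.v₂ := by
  intro h
  have := hp.adj₁₂
  rw [h, hg.irrefl] at this
  simp at this

lemma Thin.ne₂₃ (hg : Good g) (hp : Thin g p) : p.v₂ ≠ p.v₃ := by
  intro h
  have := hp.adj₂₃
  rw [h, hg.irrefl] at this
  simp at this

lemma Thin.adj₁ (hg : Good g) (hp : Thin g p) {u : Fin n} :
    g.adj p.v₁ u = true ↔ u = p.v₀ ∨ u = p.v₂ := by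
  have h01 : g.adj p.v₁ p.v₀ = true := by rw [hg.symm]; exact hp.adj₀₁
  refine ⟨eq_or_eq_of_deg_two hp.deg₁ h01 hp.adj₁₂ hp.ne₀₂, ?_⟩
  rintro (rfl | rfl)
  · exact h01
  · exact hp.adj₁₂

lemma Thin.adj₂ (hg : Good g) (hp : Thin g p) {u : Fin n} :
    g.adj p.v₂ u = true ↔ u = p.v₁ ∨ u = p.v₃ := by
  have h12 : g.adj p.v₂ p.v₁ = true := by rw [hg.symm]; exact hp.adj₁₂
  refine ⟨eq_or_eq_of_deg_two hp.deg₂ h12 hp.adj₂₃ hp.ne₁₃, ?_⟩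
  rintro (rfl | rfl)
  · exact h12
  · exact hp.adj₂₃

lemma shrunk_adj_iff {u v : Fin n} : (shrunk g p).adj u v = true ↔
    (g.adj u v = true ∧ u ≠ p.v₂ ∧ v ≠ p.v₂) ∨
      (u = p.v₁ ∧ v = p.v₃) ∨ (u = p.v₃ ∧ v = p.v₁) := by
  simp [shrunk, samePair, and_assoc]

lemma shrunk_symm (hg : Good g) : Symm (shrunk g p).adj := by
  intro u v
  rw [Bool.eq_iff_iff, shrunk_adj_iff, shrunk_adj_iff, hg.symm u v]
  tauto

lemma shrunk_one_symm (hg : Good g) : Symm (shrunk g p).one := by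
  intro u v
  simp only [shrunk]
  rw [samePair_comm u v, samePair_comm u v, hg.one_symm u v, Bool.and_right_comm]

/-- The `1`-edges that avoid `v₁` and `v₂`. -/
def offPath (g : BGraph n) (p : Quad n) : Mat n := fun u v =>
  g.one u v && decide (u ≠ p.v₁) && decide (u ≠ p.v₂) && decide (v ≠ p.v₁) && decide (v ≠ p.v₂)

lemma cutN_offPath (Y : VSet n) (x₁ x₂ : Bool) :
    cutN (offPath g p) (pat p Y x₁ x₂) = cutN (offPath g p) Y := by
  refine cutN_congr fun u v h => ?_
  simp only [offPath, Bool.and_eq_true, decide_eq_true_eq] at h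
  simp [pat, h]

lemma cutN_pat (hg : Good g) (hp : Thin g p) (Y : VSet n) (x₁ x₂ : Bool) :
    cutN g.one (pat p Y x₁ x₂) = cutN (offPath g p) Y +
      (edgeCut (g.one p.v₀ p.v₁) (Y p.v₀) x₁ + edgeCut (g.one p.v₁ p.v₂) x₁ x₂ +
        edgeCut (g.one p.v₂ p.v₃) x₂ (Y p.v₃)) := by
  have h01 := hp.ne₀₁ hg
  have h12 := hp.ne₁₂ hg
  have h23 := hp.ne₂₃ hg
  have h02 := hp.ne₀₂
  have h13 := hp.ne₁₃
  have h03 := hp.ne₀₃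
  rw [cutN_eraseEdge hg.one_symm h01, cutN_eraseEdge (hg.one_symm.eraseEdge _ _) h12,
    cutN_eraseEdge ((hg.one_symm.eraseEdge _ _).eraseEdge _ _) h23]
  have hO : eraseEdge (eraseEdge (eraseEdge g.one p.v₀ p.v₁) p.v₁ p.v₂) p.v₂ p.v₃ =
      offPath g p := by
    funext u v
    have h1 : ∀ u, g.one p.v₁ u = true → u = p.v₀ ∨ u = p.v₂ := fun u hu =>
      (hp.adj₁ hg).1 (hg.one_adj _ _ hu)
    have h2 : ∀ u, g.one p.v₂ u = true → u = p.v₁ ∨ u = p.v₃ := fun u hu =>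
      (hp.adj₂ hg).1 (hg.one_adj _ _ hu)
    have hs := hg.one_symm u v
    rw [Bool.eq_iff_iff]
    simp only [eraseEdge, offPath, Bool.and_eq_true, Bool.not_eq_true', ← Bool.not_eq_true,
      samePair_iff, decide_eq_true_eq]
    grind
  have e12 : eraseEdge g.one p.v₀ p.v₁ p.v₁ p.v₂ = g.one p.v₁ p.v₂ := by
    have : samePair p.v₁ p.v₂ p.v₀ p.v₁ = false := by
      rw [← Bool.not_eq_true, samePair_iff]; grind
    simp [eraseEdge, this]
  have e23 : eraseEdge (eraseEdge g.one p.v₀ p.v₁) p.v₁ p.v₂ p.v₂ p.v₃ = g.one p.v₂ p.v₃ := by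
    have h1 : samePair p.v₂ p.v₃ p.v₀ p.v₁ = false := by
      rw [← Bool.not_eq_true, samePair_iff]; grind
    have h2 : samePair p.v₂ p.v₃ p.v₁ p.v₂ = false := by
      rw [← Bool.not_eq_true, samePair_iff]; grind
    simp [eraseEdge, h1, h2]
  rw [hO, e12, e23, cutN_offPath]
  have p0 : pat p Y x₁ x₂ p.v₀ = Y p.v₀ := by simp [pat, h01, h02]
  have p1 : pat p Y x₁ x₂ p.v₁ = x₁ := by simp [pat]
  have p2 : pat p Y x₁ x₂ p.v₂ = x₂ := by simp [pat, h12.symm]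
  have p3 : pat p Y x₁ x₂ p.v₃ = Y p.v₃ := by simp [pat, h13.symm, h23.symm]
  rw [p0, p1, p2, p3]
  ring

lemma cutN_shrunk_pat (hg : Good g) (hp : Thin g p) (Y : VSet n) (y : Bool) :
    cutN (shrunk g p).one (pat p Y y false) = cutN (offPath g p) Y +
      (edgeCut (decide (2 ≤ pathOnes g p)) (Y p.v₀) y +
        edgeCut (decide (1 ≤ pathOnes g p)) y (Y p.v₃)) := by
  have h01 := hp.ne₀₁ hg
  have h12 := hp.ne₁₂ hg
  have h23 := hp.ne₂₃ hg
  have h02 := hp.ne₀₂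
  have h13 := hp.ne₁₃
  have h03 := hp.ne₀₃
  have hsym := shrunk_one_symm (p := p) hg
  rw [cutN_eraseEdge hsym h01, cutN_eraseEdge (hsym.eraseEdge _ _) h13]
  have hO : eraseEdge (eraseEdge (shrunk g p).one p.v₀ p.v₁) p.v₁ p.v₃ = offPath g p := by
    funext u v
    have h1 : ∀ u, g.one p.v₁ u = true → u = p.v₀ ∨ u = p.v₂ := fun u hu =>
      (hp.adj₁ hg).1 (hg.one_adj _ _ hu)
    have h2 : ∀ u, g.one p.v₂ u = true → u = p.v₁ ∨ u = p.v₃ := fun u hu =>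
      (hp.adj₂ hg).1 (hg.one_adj _ _ hu)
    have hs := hg.one_symm u v
    rw [Bool.eq_iff_iff]
    simp only [eraseEdge, offPath, shrunk]
    by_cases ha : samePair u v p.v₀ p.v₁ = true
    · simp only [ha, Bool.not_true, Bool.and_false, Bool.false_and, Bool.false_eq_true, false_iff]
      rw [samePair_iff] at ha
      grind
    · by_cases hb : samePair u v p.v₁ p.v₃ = true
      · simp only [hb, Bool.not_true, Bool.and_false, Bool.false_eq_true, false_iff]
        rw [samePair_iff] at hb
        grind
      · simp only [ha, hb]
        rw [samePair_iff] at ha hb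
        grind
  have e01 : (shrunk g p).one p.v₀ p.v₁ = decide (2 ≤ pathOnes g p) := by
    simp [shrunk, samePair]
  have e13 : eraseEdge (shrunk g p).one p.v₀ p.v₁ p.v₁ p.v₃ = decide (1 ≤ pathOnes g p) := by
    have : samePair p.v₁ p.v₃ p.v₀ p.v₁ = false := by
      rw [← Bool.not_eq_true, samePair_iff]; grind
    simp only [eraseEdge, this, shrunk]
    simp [samePair]
  rw [hO, e01, e13, cutN_offPath]
  have p0 : pat p Y y false p.v₀ = Y p.v₀ := by simp [pat, h01, h02]
  have p1 : pat p Y y false p.v₁ = y := by simp [pat]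
  have p3 : pat p Y y false p.v₃ = Y p.v₃ := by simp [pat, h13.symm, h23.symm]
  rw [p0, p1, p3]
  ring

/-- How connectedness before and after shrinking depends on the values at `v₁` and `v₂`. -/
lemma conn_pat (hg : Good g) (hp : Thin g p) (Y : VSet n) :
    let C := fun x₁ x₂ => Conn g.adj (pat p Y x₁ x₂)
    let C' := fun y => Conn (shrunk g p).adj (pat p Y y false)
    let E := ∀ v, v ≠ p.v₁ → v ≠ p.v₂ → Y v = false
    (C' false ↔ C false false) ∧
    (Y p.v₀ = true → (C false false ↔ C true false)) ∧
    (Y p.v₃ = true → (C false false ↔ C false true)) ∧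
    (Y p.v₃ = false → (C true false ↔ C true true)) ∧
    (Y p.v₀ = false → (C false true ↔ C true true)) ∧
    (Y p.v₀ = true → Y p.v₃ = false → ¬ C false true) ∧
    (Y p.v₀ = false → Y p.v₃ = true → ¬ C true false) ∧
    (Y p.v₀ = true → Y p.v₃ = true → (C' true ↔ C true true)) ∧
    (Y p.v₀ = true → Y p.v₃ = false → (C' false ↔ C' true)) ∧
    (Y p.v₀ = false → Y p.v₃ = true → (C' false ↔ C' true)) ∧
    (Y p.v₀ = false → Y p.v₃ = false → (C' true ↔ E)) ∧
    (Y p.v₀ = false → Y p.v₃ = false → (C true false ↔ E)) := by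
  intro C C' E
  have h01 := hp.ne₀₁ hg
  have h12 := hp.ne₁₂ hg
  have h23 := hp.ne₂₃ hg
  have h02 := hp.ne₀₂
  have h13 := hp.ne₁₃
  have h03 := hp.ne₀₃
  have hsym := hg.symm
  have hsym' := shrunk_symm (p := p) hg
  have hadj₁ := fun u => hp.adj₁ hg (u := u)
  have hadj₂ := fun u => hp.adj₂ hg (u := u)
  have hadj₁' : ∀ u, g.adj u p.v₁ = true ↔ u = p.v₀ ∨ u = p.v₂ := fun u => by
    rw [hsym]; exact hadj₁ u
  have hadj₂' : ∀ u, g.adj u p.v₂ = true ↔ u = p.v₁ ∨ u = p.v₃ := fun u => by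
    rw [hsym]; exact hadj₂ u
  have hs₁ : ∀ u, (shrunk g p).adj p.v₁ u = true ↔ u = p.v₀ ∨ u = p.v₃ := fun u => by
    rw [shrunk_adj_iff]; grind
  have hs₁' : ∀ u, (shrunk g p).adj u p.v₁ = true ↔ u = p.v₀ ∨ u = p.v₃ := fun u => by
    rw [hsym']; exact hs₁ u
  have p0 : ∀ x₁ x₂, pat p Y x₁ x₂ p.v₀ = Y p.v₀ := by simp [pat, h01, h02]
  have p1 : ∀ x₁ x₂, pat p Y x₁ x₂ p.v₁ = x₁ := by simp [pat]
  have p2 : ∀ x₁ x₂, pat p Y x₁ x₂ p.v₂ = x₂ := by simp [pat, h12.symm]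
  have p3 : ∀ x₁ x₂, pat p Y x₁ x₂ p.v₃ = Y p.v₃ := by simp [pat, h13.symm, h23.symm]
  have pne : ∀ x₁ x₂ v, v ≠ p.v₁ → v ≠ p.v₂ → pat p Y x₁ x₂ v = Y v := by
    intro x₁ x₂ v h1 h2; simp [pat, h1, h2]
  have pch₁ : ∀ x₁ x₁' x₂ v, v ≠ p.v₁ → pat p Y x₁ x₂ v = pat p Y x₁' x₂ v := by
    intro x₁ x₁' x₂ v h; simp [pat, h]
  have pch₂ : ∀ x₁ x₂ x₂' v, v ≠ p.v₂ → pat p Y x₁ x₂ v = pat p Y x₁ x₂' v := by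
    intro x₁ x₁' x₂ v h; simp [pat, h]
  -- The first clause compares the graphs where they agree, on a set avoiding `v₁` and `v₂`, and the
  -- eighth is the subdivision of `v₁v₃`. The second to fifth, the ninth and the tenth add a pendant
  -- vertex. The others concern a vertex isolated in its set, which is connected only if nothing
  -- else belongs to the set.
  refine ⟨?_, ?_, ?_, ?_, ?_, ?_, ?_, ?_, ?_, ?_, ?_, ?_⟩
  · refine ⟨fun h => h.mono ?_, fun h => h.mono ?_⟩
    · intro u v hu hv huv
      rw [shrunk_adj_iff] at huv
      have hp1 := p1 false false
      grind
    · intro u v hu hv huv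
      rw [shrunk_adj_iff]
      have hp1 := p2 false false
      grind
  · intro ha
    refine conn_pendant_iff hsym (a := p.v₀) (b := p.v₁) (pch₁ _ _ _) (p1 _ _)
      ((p0 _ _).trans ha) hp.adj₀₁ fun u hu h => ?_
    have hp1 := p2 false false
    grind
  · intro ha
    refine conn_pendant_iff hsym (a := p.v₃) (b := p.v₂) (pch₂ _ _ _) (p2 _ _)
      ((p3 _ _).trans ha) (by rw [hsym]; exact hp.adj₂₃) fun u hu h => ?_
    have hp1 := p1 false false
    grind
  · intro ha
    refine conn_pendant_iff hsym (a := p.v₁) (b := p.v₂) (pch₂ _ _ _) (p2 _ _)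
      (p1 _ _) hp.adj₁₂ fun u hu h => ?_
    have hp1 := p3 true false
    grind
  · intro ha
    refine conn_pendant_iff hsym (a := p.v₂) (b := p.v₁) (pch₁ _ _ _) (p1 _ _)
      (p2 _ _) (by rw [hsym]; exact hp.adj₁₂) fun u hu h => ?_
    have hp1 := p0 false true
    grind
  · intro ha hb
    refine not_conn_of_isolated (a := p.v₀) (b := p.v₂) ((p0 _ _).trans ha) (p2 _ _) h02
      fun u hu => ?_
    have hp1 := p1 false true
    have hp3 := p3 false true
    by_contra hc
    grind
  · intro ha hb
    refine not_conn_of_isolated (a := p.v₃) (b := p.v₁) ((p3 _ _).trans hb) (p1 _ _) h13.symm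
      fun u hu => ?_
    have hp1 := p2 true false
    have hp3 := p0 true false
    by_contra hc
    grind
  · intro ha hb
    constructor
    · intro h
      refine conn_of_root hsym (r := p.v₁) (p1 _ _) fun P hP1 hP v hv => ?_
      have hP2 : P p.v₂ := hP _ _ (p1 _ _) (p2 _ _) hP1 hp.adj₁₂
      have hP3 : P p.v₃ := hP _ _ (p2 _ _) ((p3 _ _).trans hb) hP2 hp.adj₂₃
      by_cases hv2 : v = p.v₂
      · exact hv2 ▸ hP2
      · refine h.2 P ⟨p.v₁, p1 _ _, hP1⟩ (fun u w hu hw hPu huw => ?_) v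
          (by rw [pch₂ _ _ true _ hv2]; exact hv)
        rw [shrunk_adj_iff] at huw
        rcases huw with ⟨huw, hu2, hw2⟩ | ⟨rfl, rfl⟩ | ⟨rfl, rfl⟩
        · exact hP u w (by rw [pch₂ _ _ false _ hu2]; exact hu)
            (by rw [pch₂ _ _ false _ hw2]; exact hw) hPu huw
        · exact hP3
        · exact hP1
    · intro h
      refine conn_of_root hsym' (r := p.v₁) (p1 _ _) fun P hP1 hP v hv => ?_
      have hP3 : P p.v₃ := hP _ _ (p1 _ _) ((p3 _ _).trans hb) hP1 ((hs₁ _).2 (Or.inr rfl))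
      have key := h.2 (fun v => v = p.v₂ ∨ P v) ⟨p.v₁, p1 _ _, Or.inr hP1⟩
        (fun u w hu hw hPu huw => by
          by_cases hw2 : w = p.v₂
          · exact Or.inl hw2
          · right
            by_cases hu2 : u = p.v₂
            · subst hu2
              rcases (hadj₂ w).1 huw with rfl | rfl
              · exact hP1
              · exact hP3
            · exact hP u w (by rw [pch₂ _ _ true _ hu2]; exact hu)
                (by rw [pch₂ _ _ true _ hw2]; exact hw) (hPu.resolve_left hu2)
                (shrunk_adj_iff.2 (Or.inl ⟨huw, hu2, hw2⟩))) v
      have hv2 : v ≠ p.v₂ := by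
        rintro rfl
        rw [p2] at hv; simp at hv
      exact (key (by rw [pch₂ _ _ false _ hv2]; exact hv)).resolve_left hv2
  · intro ha hb
    refine conn_pendant_iff hsym' (a := p.v₀) (b := p.v₁) (pch₁ _ _ _) (p1 _ _)
      ((p0 _ _).trans ha) ((hs₁' _).2 (Or.inl rfl)) fun u hu h => ?_
    have hp1 := p3 false false
    grind
  · intro ha hb
    refine conn_pendant_iff hsym' (a := p.v₃) (b := p.v₁) (pch₁ _ _ _) (p1 _ _)
      ((p3 _ _).trans hb) ((hs₁' _).2 (Or.inr rfl)) fun u hu h => ?_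
    have hp1 := p0 false false
    grind
  · intro ha hb
    constructor
    · intro h v hv1 hv2
      by_contra hv
      refine not_conn_of_isolated (a := v) (b := p.v₁) (X := pat p Y true false)
        (by rw [pne _ _ _ hv1 hv2]; simpa using hv) (p1 _ _) hv1 (fun u hu => ?_) h
      have hp1 := p0 true false
      have hp3 := p3 true false
      by_contra hc
      grind
    · intro h
      refine conn_singleton (r := p.v₁) fun v => ⟨fun hv => ?_, ?_⟩
      · by_contra hv1
        have hp2 := p2 true false
        have := pne true false v hv1
        grind
      · rintro rfl; exact p1 _ _
  · intro ha hb
    constructor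
    · intro h v hv1 hv2
      by_contra hv
      refine not_conn_of_isolated (a := v) (b := p.v₁) (X := pat p Y true false)
        (by rw [pne _ _ _ hv1 hv2]; simpa using hv) (p1 _ _) hv1 (fun u hu => ?_) h
      have hp1 := p0 true false
      have hp3 := p2 true false
      by_contra hc
      grind
    · intro h
      refine conn_singleton (r := p.v₁) fun v => ⟨fun hv => ?_, ?_⟩
      · by_contra hv1
        have hp2 := p2 true false
        have := pne true false v hv1
        grind
      · rintro rfl; exact p1 _ _

/-- The cut edges of the path `v₀ v₁ v₂ v₃` with edge weights `o₁, o₂, o₃`. -/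
def pathCut (o₁ o₂ o₃ a x₁ x₂ b : Bool) : ℕ :=
  edgeCut o₁ a x₁ + edgeCut o₂ x₁ x₂ + edgeCut o₃ x₂ b

/-- The cut edges of the path that replaces `v₀ v₁ v₂ v₃`. -/
def shrunkCut (o₁ o₂ o₃ a y b : Bool) : ℕ :=
  edgeCut (decide (2 ≤ o₁.toNat + o₂.toNat + o₃.toNat)) a y +
    edgeCut (decide (1 ≤ o₁.toNat + o₂.toNat + o₃.toNat)) y b

lemma pathOnes_eq : pathOnes g p =
    (g.one p.v₀ p.v₁).toNat + (g.one p.v₁ p.v₂).toNat + (g.one p.v₂ p.v₃).toNat := by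
  unfold pathOnes
  cases g.one p.v₀ p.v₁ <;> cases g.one p.v₁ p.v₂ <;> cases g.one p.v₂ p.v₃ <;> rfl

/-- A check over Boolean values. For each position of the ends `a`, `b` and of the new vertex, only
those patterns `(x₁, x₂)` are offered whose connectedness `conn_pat` derives from that of the shrunk
set. With one end in the set these are segments starting at that end, each cutting one edge. -/
lemma shrunkCut_le : ∀ o₁ o₂ o₃ : Bool,
    (∀ a b, shrunkCut o₁ o₂ o₃ a false b ≤ pathCut o₁ o₂ o₃ a false false b ∨
      (a = true ∧ shrunkCut o₁ o₂ o₃ a false b ≤ pathCut o₁ o₂ o₃ a true false b) ∨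
      (b = true ∧ shrunkCut o₁ o₂ o₃ a false b ≤ pathCut o₁ o₂ o₃ a false true b) ∨
      (a ≠ b ∧ shrunkCut o₁ o₂ o₃ a false b ≤ pathCut o₁ o₂ o₃ a true true b)) ∧
    shrunkCut o₁ o₂ o₃ true true true ≤ pathCut o₁ o₂ o₃ true true true true ∧
    (∀ b, b = false → shrunkCut o₁ o₂ o₃ true true b ≤ pathCut o₁ o₂ o₃ true false false b ∨
      shrunkCut o₁ o₂ o₃ true true b ≤ pathCut o₁ o₂ o₃ true true false b ∨
      shrunkCut o₁ o₂ o₃ true true b ≤ pathCut o₁ o₂ o₃ true true true b) ∧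
    (∀ a, a = false → shrunkCut o₁ o₂ o₃ a true true ≤ pathCut o₁ o₂ o₃ a false false true ∨
      shrunkCut o₁ o₂ o₃ a true true ≤ pathCut o₁ o₂ o₃ a false true true ∨
      shrunkCut o₁ o₂ o₃ a true true ≤ pathCut o₁ o₂ o₃ a true true true) ∧
    (shrunkCut o₁ o₂ o₃ false true false ≤ pathCut o₁ o₂ o₃ false true false false ∨
      shrunkCut o₁ o₂ o₃ false true false ≤ pathCut o₁ o₂ o₃ false false true false ∨
      shrunkCut o₁ o₂ o₃ false true false ≤ pathCut o₁ o₂ o₃ false true true false) := by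
  decide

/-- The converse check. The implications between `x₁` and `x₂` exclude the disconnected patterns
when exactly one end is in the set. Such a pattern could cut all three edges, which two new edges
cannot match. -/
lemma pathCut_le : ∀ o₁ o₂ o₃ : Bool,
    (∀ x₁ x₂, pathCut o₁ o₂ o₃ true x₁ x₂ true ≤ shrunkCut o₁ o₂ o₃ true false true) ∧
    (∀ x₁ x₂, (x₂ = true → x₁ = true) →
      (pathCut o₁ o₂ o₃ true x₁ x₂ false ≤ shrunkCut o₁ o₂ o₃ true false false ∨
        pathCut o₁ o₂ o₃ true x₁ x₂ false ≤ shrunkCut o₁ o₂ o₃ true true false)) ∧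
    (∀ x₁ x₂, (x₁ = true → x₂ = true) →
      pathCut o₁ o₂ o₃ false x₁ x₂ true ≤ shrunkCut o₁ o₂ o₃ false false true) ∧
    (∀ x₁ x₂, pathCut o₁ o₂ o₃ false x₁ x₂ false ≤ shrunkCut o₁ o₂ o₃ false true false) ∧
    (∀ x₁ x₂, x₁ = false → x₂ = false →
      pathCut o₁ o₂ o₃ false x₁ x₂ false ≤ shrunkCut o₁ o₂ o₃ false false false) ∧
    pathCut o₁ o₂ o₃ true true true true ≤ shrunkCut o₁ o₂ o₃ true true true := by
  decide

/-- Cuts off the path agree on both sides, so the comparison reduces to the contributions of the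
path edges, where `conn_pat` supplies connectedness and `shrunkCut_le` the counts. -/
lemma exists_pat_of_shrunk (hg : Good g) (hp : Thin g p) (Y : VSet n) (y : Bool)
    (h : Conn (shrunk g p).adj (pat p Y y false)) :
    ∃ x₁ x₂, Conn g.adj (pat p Y x₁ x₂) ∧
      cutN (shrunk g p).one (pat p Y y false) ≤ cutN g.one (pat p Y x₁ x₂) := by
  have hc := conn_pat hg hp Y
  simp only [cutN_pat hg hp, cutN_shrunk_pat hg hp, add_le_add_iff_left, pathOnes_eq]
  change ∃ x₁ x₂, _ ∧ shrunkCut _ _ _ _ _ _ ≤ pathCut _ _ _ _ _ _ _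
  simp only at hc
  obtain ⟨c1, c2, c3, c4, c5, c6, c7, c8, c9, c10, c11, c12⟩ := hc
  obtain ⟨d1, d2, d3, d4, d5⟩ := shrunkCut_le (g.one p.v₀ p.v₁) (g.one p.v₁ p.v₂) (g.one p.v₂ p.v₃)
  cases y
  · have := d1 (Y p.v₀) (Y p.v₃)
    clear d1 d2 d3 d4 d5
    cases ha : Y p.v₀ <;> cases hb : Y p.v₃ <;> simp only [ha, hb] at * <;> grind
  · cases ha : Y p.v₀ <;> cases hb : Y p.v₃ <;> simp only [ha, hb] at * <;> grind

lemma exists_shrunk_of_pat (hg : Good g) (hp : Thin g p) (Y : VSet n) (x₁ x₂ : Bool)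
    (h : Conn g.adj (pat p Y x₁ x₂)) :
    ∃ y, Conn (shrunk g p).adj (pat p Y y false) ∧
      cutN g.one (pat p Y x₁ x₂) ≤ cutN (shrunk g p).one (pat p Y y false) := by
  have hc := conn_pat hg hp Y
  simp only [cutN_pat hg hp, cutN_shrunk_pat hg hp, add_le_add_iff_left, pathOnes_eq]
  change ∃ y, _ ∧ pathCut _ _ _ _ _ _ _ ≤ shrunkCut _ _ _ _ _ _
  simp only at hc
  obtain ⟨c1, c2, c3, c4, c5, c6, c7, c8, c9, c10, c11, c12⟩ := hc
  obtain ⟨d1, d2, d3, d4, d5, d6⟩ :=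
    pathCut_le (g.one p.v₀ p.v₁) (g.one p.v₁ p.v₂) (g.one p.v₂ p.v₃)
  cases ha : Y p.v₀ <;> cases hb : Y p.v₃ <;> simp only [ha, hb] at * <;> cases x₁ <;> cases x₂ <;>
    grind

end Shrink

end Basic

end CMC

namespace CMC

open Timed

/-- A loop rule: `I` is the invariant, `R` the progress of the state, and `D b a` says that item `a`
is settled in state `b`. Settled items stay settled under progress. It is used for both nested loops
of the spanning tree construction. -/
lemma foldl_invariant {α β : Type*} (f : β → α → β) (I : β → Prop) (R : β → β → Prop)
    (D : β → α → Prop) (hrefl : ∀ b, R b b) (htrans : ∀ b c d, R b c → R c d → R b d)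
    (hstep : ∀ b a, I b → I (f b a) ∧ R b (f b a) ∧ D (f b a) a)
    (hmono : ∀ b c a, R b c → D b a → D c a) (l : List α) (b : β) (hb : I b) :
    I (l.foldl f b) ∧ R b (l.foldl f b) ∧ ∀ a ∈ l, D (l.foldl f b) a := by
  induction l generalizing b with
  | nil => exact ⟨hb, hrefl b, by simp⟩
  | cons a l ih =>
    obtain ⟨h1, h2, h3⟩ := hstep b a hb
    obtain ⟨k1, k2, k3⟩ := ih _ h1
    refine ⟨k1, htrans _ _ _ h2 k2, ?_⟩
    intro c hc
    rcases List.mem_cons.1 hc with rfl | hc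
    · exact hmono _ _ _ k2 h3
    · exact k3 c hc

section Basic

variable {n : ℕ}

/-! ### Connectedness in terms of `SimpleGraph` -/

lemma conn_iff_induce_connected {G : SimpleGraph (Fin n)} {S : Set (Fin n)} {M : Mat n}
    {X : VSet n} (hM : ∀ u v, M u v = true ↔ G.Adj u v) (hX : ∀ v, X v = true ↔ v ∈ S) :
    Conn M X ↔ (G.induce S).Connected := by
  constructor
  · intro h
    obtain ⟨r, hr⟩ := h.1
    rw [SimpleGraph.connected_iff_exists_forall_reachable]
    refine ⟨⟨r, (hX r).1 hr⟩, fun ⟨v, hv⟩ => ?_⟩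
    have := h.2 (fun v => ∀ hv : v ∈ S, (G.induce S).Reachable ⟨r, (hX r).1 hr⟩ ⟨v, hv⟩)
      ⟨r, hr, fun _ => SimpleGraph.Reachable.refl _⟩
      (fun u v hu hv hPu huv hv' => (hPu ((hX u).1 hu)).trans
        (SimpleGraph.Adj.reachable (by simpa using (hM u v).1 huv)))
    exact this v ((hX v).2 hv) hv
  · intro h
    obtain ⟨⟨r₀, hr₀⟩⟩ := h.nonempty
    refine ⟨⟨r₀, (hX r₀).2 hr₀⟩, fun P ⟨r, hr, hPr⟩ hP v hv => ?_⟩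
    obtain ⟨p⟩ := h.preconnected ⟨r, (hX r).1 hr⟩ ⟨v, (hX v).1 hv⟩
    have : ∀ {a b : S} (q : (G.induce S).Walk a b), P a → P b := by
      intro a b q
      induction q with
      | nil => exact id
      | cons hadj q ih =>
        intro ha
        exact ih (hP _ _ ((hX _).2 (Subtype.coe_prop _)) ((hX _).2 (Subtype.coe_prop _)) ha
          ((hM _ _).2 (by simpa using hadj)))
    exact this p hPr

/-! ### Spanning trees -/

/-- `T` is a spanning tree of `g`. -/
structure SpanTree (g : BGraph n) (T : Tree n) : Prop where
  vert : T.vert = g.vert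
  symm : Symm T.adj
  sub : ∀ u v, T.adj u v = true → g.adj u v = true
  conn : Conn T.adj g.vert
  count : ∑ v, deg T.adj v + 2 ≤ 2 * card g.vert

/-- A connected spanning subgraph none of whose edges can be removed has few edges. -/
lemma sum_deg_le_of_minimal {g : BGraph n} (hg : Good g) {M : Mat n} (hM : Symm M)
    (hsub : ∀ u v, M u v = true → g.adj u v = true) (hconn : Conn M g.vert)
    (hmin : ∀ u v, M u v = true → ¬ Conn (eraseEdge M u v) g.vert) :
    ∑ v, deg M v + 2 ≤ 2 * card g.vert := by
  classical
  let G : SimpleGraph (Fin n) :=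
    { Adj := fun u v => M u v = true
      symm := ⟨fun u v h => by rw [hM]; exact h⟩
      loopless := ⟨fun v h => by have := hsub v v h; rw [hg.irrefl] at this; simp at this⟩ }
  let S : Set (Fin n) := {v | g.vert v = true}
  have hG : (G.induce S).Connected :=
    (conn_iff_induce_connected (fun _ _ => Iff.rfl) (fun _ => Iff.rfl)).1 hconn
  obtain ⟨F, hFG, hF⟩ := hG.exists_isTree_le
  -- All edges of `M` lie in the spanning tree `F`: an edge outside `F` could be erased, since `F`
  -- alone keeps the vertices connected. So the edge count of `F` bounds that of `M`.
  have hMF : ∀ u v (h : M u v = true) (hu : u ∈ S) (hv : v ∈ S), F.Adj ⟨u, hu⟩ ⟨v, hv⟩ := by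
    intro u v huv hu hv
    by_contra hF'
    refine hmin u v huv ?_
    refine ⟨hconn.1, fun P ⟨r, hr, hPr⟩ hP w hw => ?_⟩
    obtain ⟨p⟩ := hF.connected.preconnected ⟨r, hr⟩ ⟨w, hw⟩
    have : ∀ {a b : S} (q : F.Walk a b), P a → P b := by
      intro a b q
      induction q with
      | nil => exact id
      | @cons a b c hadj q ih =>
        intro ha
        refine ih (hP _ _ a.2 b.2 ha ?_)
        have hab : M a b = true := hFG hadj
        have hne : samePair (a : Fin n) b u v = false := by
          rw [← Bool.not_eq_true, samePair_iff]
          rintro (⟨h1, h2⟩ | ⟨h1, h2⟩)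
          · exact hF' (by convert hadj using 1 <;> exact Subtype.ext (by simp [h1, h2]))
          · exact hF' (by convert hadj.symm using 1 <;> exact Subtype.ext (by simp [h1, h2]))
        simp [eraseEdge, hab, hne]
    exact this p hPr
  have hmem : ∀ u v, M u v = true → u ∈ S := fun u v h => hg.mem u v (hsub u v h)
  have hle : ∀ x : S, deg M x ≤ F.degree x := by
    intro x
    rw [← SimpleGraph.card_neighborFinset_eq_degree]
    refine (Finset.card_le_card ?_).trans
      (Finset.card_image_le (s := F.neighborFinset x) (f := Subtype.val))
    intro u
    simp only [Finset.mem_filter, Finset.mem_univ, true_and, Finset.mem_image,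
      SimpleGraph.mem_neighborFinset]
    intro hu
    have huS := hmem u x (by rw [hM]; exact hu)
    exact ⟨⟨u, huS⟩, hMF _ _ hu x.2 huS, rfl⟩
  have hsum : ∑ v, deg M v = ∑ x : S, deg M x := by
    rw [← Finset.sum_subtype (Finset.univ.filter fun v => v ∈ S) (by simp) (fun v => deg M v)]
    symm
    refine Finset.sum_subset (Finset.subset_univ _) fun v _ hv => ?_
    simp only [Finset.mem_filter, Finset.mem_univ, true_and] at hv
    simp only [deg, Finset.card_eq_zero, Finset.filter_eq_empty_iff]
    intro u _ hu
    exact hv (hmem v u hu)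
  have hcard : card g.vert = Fintype.card S := by
    rw [Fintype.card_subtype]; rfl
  have h1 := hF.card_edgeFinset
  have h2 := F.sum_degrees_eq_twice_card_edges
  have h3 : ∑ x : S, deg M x ≤ ∑ x : S, F.degree x := Finset.sum_le_sum fun x _ => hle x
  rw [hsum, hcard]
  omega

/-- Delete the edge `ab` if the graph stays connected. -/
def tryErase (X : VSet n) (M : Mat n) (a b : Fin n) : Mat n :=
  if M a b = true then
    (if (isConn (eraseEdge M a b) X).val = true then eraseEdge M a b else M) else M

lemma spanningTree_val (g : BGraph n) : (spanningTree g).val =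
    ⟨g.vert, (List.finRange n).foldl (fun M a => (List.finRange n).foldl
      (fun M b => tryErase g.vert M a b) M) g.adj⟩ := by
  simp only [spanningTree, bind_val, table₂_val, op_val, foldT_val, Tree.mk.injEq, true_and]
  congr 1
  funext M a
  congr 1
  funext M b
  unfold tryErase
  by_cases h : M a b = true
  · rw [if_pos h, if_pos h]; rfl
  · rw [if_neg h, if_neg h]; rfl

/-- One pass over the pairs suffices: an edge that cannot be erased from `M` cannot be erased from
any smaller graph either. At the end no edge can be erased, and `sum_deg_le_of_minimal` applies. -/
lemma spanTree_spanningTree {g : BGraph n} (hg : Good g) : SpanTree g (spanningTree g).val := by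
  let I : Mat n → Prop := fun M =>
    Symm M ∧ (∀ u v, M u v = true → g.adj u v = true) ∧ Conn M g.vert
  let R : Mat n → Mat n → Prop := fun M M' => ∀ u v, M' u v = true → M u v = true
  let D : Mat n → Fin n → Fin n → Prop := fun M a b =>
    M a b = true → ¬ Conn (eraseEdge M a b) g.vert
  have hmono : ∀ M M' a b, R M M' → D M a b → D M' a b := by
    intro M M' a b hR hD hab hc
    refine hD (hR _ _ hab) (hc.mono fun u v _ _ huv => ?_)
    simp only [eraseEdge, Bool.and_eq_true] at huv ⊢
    exact ⟨hR _ _ huv.1, huv.2⟩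
  have hstep : ∀ a M b, I M → I (tryErase g.vert M a b) ∧ R M (tryErase g.vert M a b) ∧
      D (tryErase g.vert M a b) a b := by
    intro a M b hI
    have hc := isConn_val (hI.1.eraseEdge a b) g.vert
    unfold tryErase
    split_ifs with h1 h2
    · refine ⟨⟨hI.1.eraseEdge a b, fun u v h => ?_, hc.1 h2⟩, fun u v h => ?_, fun h => ?_⟩
      · simp only [eraseEdge, Bool.and_eq_true] at h; exact hI.2.1 _ _ h.1
      · simp only [eraseEdge, Bool.and_eq_true] at h; exact h.1
      · simp [eraseEdge, samePair] at h
    · exact ⟨hI, fun _ _ => id, fun _ h => h2 (hc.2 h)⟩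
    · exact ⟨hI, fun _ _ => id, fun h => absurd h h1⟩
  have hinner : ∀ M a, I M →
      let M' := (List.finRange n).foldl (fun M b => tryErase g.vert M a b) M
      I M' ∧ R M M' ∧ ∀ b, D M' a b := by
    intro M a hI M'
    obtain ⟨h1, h2, h3⟩ := foldl_invariant (fun M b => tryErase g.vert M a b) I R
      (fun M b => D M a b) (fun _ _ _ => id) (fun _ _ _ h k u v hu => h _ _ (k _ _ hu))
      (hstep a) (fun M M' b => hmono M M' a b) (List.finRange n) M hI
    exact ⟨h1, h2, fun b => h3 b (List.mem_finRange b)⟩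
  obtain ⟨⟨h1, h2, h3⟩, -, h4⟩ := foldl_invariant
    (fun M a => (List.finRange n).foldl (fun M b => tryErase g.vert M a b) M) I R
    (fun M a => ∀ b, D M a b) (fun _ _ _ => id) (fun _ _ _ h k u v hu => h _ _ (k _ _ hu))
    hinner (fun M M' a hR h b => hmono M M' a b hR (h b)) (List.finRange n) g.adj
    ⟨hg.symm, fun _ _ => id, hg.conn⟩
  rw [spanningTree_val]
  exact ⟨rfl, h1, h2, h3, sum_deg_le_of_minimal hg h1 h2 h3 fun a b =>
    h4 a (List.mem_finRange a) b⟩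

/-! ### Exchanging edges -/

/-- Exchange the edge `ab` for the edge `xy`. -/
def swap (M : Mat n) (a b x y : Fin n) : Mat n :=
  fun u v => (M u v && !samePair u v a b) || samePair u v x y

/-- The number of vertices of degree two. -/
def d2 (M : Mat n) : ℕ := (Finset.univ.filter fun v => deg M v = 2).card

@[simp] lemma countDeg2_val (M : Mat n) : (countDeg2 M).val = d2 M := by
  simp [countDeg2, d2]

lemma deg_eraseEdge {M : Mat n} (hM : Symm M) {a b : Fin n} (hab : M a b = true) (hne : a ≠ b)
    (v : Fin n) : deg (eraseEdge M a b) v + (if v = a ∨ v = b then 1 else 0) = deg M v := by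
  have key : ∀ c d, M c d = true → c ≠ d → (∀ u v, samePair u v a b = samePair u v c d) →
      deg (eraseEdge M a b) c + 1 = deg M c := by
    intro c d hcd hne' hs
    have : (Finset.univ.filter fun u => M c u = true) =
        insert d (Finset.univ.filter fun u => eraseEdge M a b c u = true) := by
      ext u
      simp only [Finset.mem_filter, Finset.mem_univ, true_and, Finset.mem_insert, eraseEdge, hs,
        Bool.and_eq_true, Bool.not_eq_true', ← Bool.not_eq_true, samePair_iff]
      grind
    unfold deg
    rw [this, Finset.card_insert_of_notMem]
    have : samePair c d c d = true := by simp [samePair]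
    simp [eraseEdge, hs, this]
  by_cases hva : v = a
  · subst hva
    simpa using key v b hab hne fun _ _ => rfl
  by_cases hvb : v = b
  · subst hvb
    simpa using key v a (by rw [hM]; exact hab) hne.symm fun u w => by
      simp [samePair, Bool.or_comm]
  simp only [hva, hvb, or_self, if_false, add_zero]
  unfold deg
  congr 1
  ext u
  simp [eraseEdge, samePair, hva, hvb]

lemma Symm.swap {M : Mat n} (hM : Symm M) (a b x y : Fin n) : Symm (swap M a b x y) := by
  intro u v
  simp only [CMC.swap]
  rw [hM, samePair_comm u v, samePair_comm u v]

/-- Erasing `ab` from the old matrix and `xy` from the new one leaves the same matrix. The additive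
form avoids subtraction and allows the two edges to share an end. -/
lemma deg_swap {M : Mat n} (hM : Symm M) {a b x y : Fin n} (hab : M a b = true) (hne : a ≠ b)
    (hxy : M x y = false) (hne' : x ≠ y) (v : Fin n) :
    deg (swap M a b x y) v + (if v = a ∨ v = b then 1 else 0) =
      deg M v + (if v = x ∨ v = y then 1 else 0) := by
  have h1 := deg_eraseEdge hM hab hne v
  have h2 := deg_eraseEdge (hM.swap a b x y) (a := x) (b := y) (by simp [swap, samePair]) hne' v
  have h3 : eraseEdge (swap M a b x y) x y = eraseEdge M a b := by
    funext u v
    have hyx : M y x = false := by rw [hM]; exact hxy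
    by_cases h : samePair u v x y = true
    · have : M u v = false := by
        rw [samePair_iff] at h
        rcases h with ⟨rfl, rfl⟩ | ⟨rfl, rfl⟩ <;> assumption
      simp [eraseEdge, swap, this]
    · simp [eraseEdge, swap, h]
  rw [h3] at h2
  omega

/-- In `SpanTree`, connectedness with a degree sum of at most `2|V| - 2` stands for being a tree. An
exchange preserves this sum, so only connectedness has to be tested. -/
lemma sum_deg_swap {M : Mat n} (hM : Symm M) {a b x y : Fin n} (hab : M a b = true)
    (hne : a ≠ b) (hxy : M x y = false) (hne' : x ≠ y) :
    ∑ v, deg (swap M a b x y) v = ∑ v, deg M v := by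
  have h2 : ∀ c d : Fin n, c ≠ d → (∑ v, if v = c ∨ v = d then 1 else 0) = 2 := by
    intro c d hcd
    rw [← Finset.card_filter, ← Finset.card_pair hcd]
    congr 1
    ext v; simp
  have := Finset.sum_congr (rfl : (Finset.univ : Finset (Fin n)) = _)
    fun v _ => deg_swap hM hab hne hxy hne' v
  rw [Finset.sum_add_distrib, Finset.sum_add_distrib, h2 _ _ hne, h2 _ _ hne'] at this
  omega

/-- No exchange of edges decreases the number of vertices of degree two. -/
def LocalOpt (g : BGraph n) (T : Tree n) : Prop :=
  ∀ a b x y, T.adj a b = true → g.adj x y = true → T.adj x y = false →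
    Conn (swap T.adj a b x y) g.vert → d2 T.adj ≤ d2 (swap T.adj a b x y)

/-- Either the search fails and the tree is locally optimal, or the number of degree-two vertices
drops. That number serves as the termination measure. -/
lemma improve_cases (g : BGraph n) (T : Tree n) :
    ((improve g T).val = T ∧ (SpanTree g T → LocalOpt g T)) ∨
    (d2 (improve g T).val.adj < d2 T.adj ∧ (Good g → SpanTree g T → SpanTree g (improve g T).val)) := by
  simp only [improve, bind_val, countDeg2_val]
  set F : Fin n → Fin n → Fin n → Fin n → Timed (Option (Mat n)) := fun a b x y =>
    if T.adj a b && g.adj x y && !T.adj x y then do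
      let M ← table₂ fun u v => op ((T.adj u v && !samePair u v a b) || samePair u v x y)
      let c ← isConn M g.vert
      let k' ← countDeg2 M
      op (if c && decide (k' < d2 T.adj) then some M else none)
    else op none with hF
  have hFval : ∀ a b x y, (F a b x y).val =
      if (T.adj a b && g.adj x y && !T.adj x y) = true then
        (if ((isConn (swap T.adj a b x y) g.vert).val &&
          decide (d2 (swap T.adj a b x y) < d2 T.adj)) = true
        then some (swap T.adj a b x y) else none) else none := by
    intro a b x y
    simp only [hF]
    by_cases h : (T.adj a b && g.adj x y && !T.adj x y) = true
    · rw [if_pos h, if_pos h]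
      simp only [bind_val, table₂_val, op_val, countDeg2_val]
      rfl
    · rw [if_neg h, if_neg h]; rfl
  rcases ho : (firstT fun a => firstT fun b => firstT fun x => firstT fun y => F a b x y).val
    with _ | M
  · left
    refine ⟨rfl, fun hT a b x y hab hxy hxy' hc => ?_⟩
    simp only [firstT_val_eq_none] at ho
    have := ho a b x y
    rw [hFval] at this
    simp only [hab, hxy, hxy', Bool.not_false, Bool.and_self, if_true,
      (isConn_val (hT.symm.swap a b x y) g.vert).2 hc, Bool.true_and, ite_eq_right_iff,
      reduceCtorEq, imp_false, decide_eq_true_eq, not_lt] at this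
    exact this
  · right
    obtain ⟨a, ho⟩ := exists_of_firstT_val_eq_some ho
    obtain ⟨b, ho⟩ := exists_of_firstT_val_eq_some ho
    obtain ⟨x, ho⟩ := exists_of_firstT_val_eq_some ho
    obtain ⟨y, ho⟩ := exists_of_firstT_val_eq_some ho
    rw [hFval] at ho
    simp only [Option.ite_none_right_eq_some, Bool.and_eq_true, Bool.not_eq_true',
      decide_eq_true_eq, Option.some.injEq] at ho
    obtain ⟨⟨⟨hab, hxy⟩, hxy'⟩, ⟨hc, hlt⟩, rfl⟩ := ho
    refine ⟨hlt, fun hg hT => ⟨hT.vert, hT.symm.swap a b x y, fun u v huv => ?_,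
      (isConn_val (hT.symm.swap a b x y) g.vert).1 hc, ?_⟩⟩
    · simp only [op_val, swap, Bool.or_eq_true, Bool.and_eq_true, samePair_iff] at huv
      rcases huv with huv | ⟨rfl, rfl⟩ | ⟨rfl, rfl⟩
      · exact hT.sub _ _ huv.1
      · exact hxy
      · rw [hg.symm]; exact hxy
    · have hne : ∀ {u v}, g.adj u v = true → u ≠ v := by
        rintro u v h rfl
        rw [hg.irrefl] at h; simp at h
      have := hT.count
      rw [← sum_deg_swap hT.symm hab (hne (hT.sub _ _ hab)) hxy' (hne hxy)] at this
      exact this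

lemma leafyTree_val (g : BGraph n) :
    (leafyTree g).val = (fun T => (improve g T).val)^[n] (spanningTree g).val := by
  simp [leafyTree]

/-- At most `n` vertices have degree two and each change lowers their number, so `n` rounds reach a
fixed point of `improve`, which must be locally optimal. -/
lemma spanTree_leafyTree {g : BGraph n} (hg : Good g) :
    SpanTree g (leafyTree g).val ∧ LocalOpt g (leafyTree g).val := by
  have h1 : SpanTree g (leafyTree g).val := by
    rw [leafyTree_val]
    have : ∀ k T, SpanTree g T → SpanTree g ((fun T => (improve g T).val)^[k] T) := by
      intro k
      induction k with
      | zero => exact fun T h => h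
      | succ k ih =>
        intro T hT
        rw [Function.iterate_succ_apply]
        refine ih _ ?_
        rcases improve_cases g T with ⟨h, -⟩ | ⟨-, h⟩
        · simp only [h]; exact hT
        · exact h hg hT
    exact this n _ (spanTree_spanningTree hg)
  refine ⟨h1, ?_⟩
  have hfix : (improve g (leafyTree g).val).val = (leafyTree g).val := by
    rw [leafyTree_val]
    refine iterate_stationary (fun T => (improve g T).val) (fun T => d2 T.adj) ?_ n _ ?_
    · intro T hT
      rcases improve_cases g T with ⟨h, -⟩ | ⟨h, -⟩
      · exact absurd h hT
      · exact h
    · exact (Finset.card_le_univ _).trans (by simp)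
  rcases improve_cases g (leafyTree g).val with ⟨-, h⟩ | ⟨h, -⟩
  · exact h h1
  · rw [hfix] at h; omega

end Basic

end CMC

namespace CMC

open Timed

section Basic

variable {n : ℕ}

/-! ### Locally optimal trees have many leaves -/

/-- The leaves of `T`. -/
def leafSet (T : Tree n) : VSet n := fun v => T.vert v && decide (deg T.adj v ≤ 1)

@[simp] lemma leaves_val (T : Tree n) : (leaves T).val = leafSet T := by
  simp only [leaves, table_val, bind_val, degree_val, op_val]
  rfl

lemma exists_ne_of_deg_two {M : Mat n} {v a : Fin n} (h : deg M v = 2) :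
    ∃ b, M v b = true ∧ b ≠ a := by
  obtain ⟨b, hb, hba⟩ := Finset.exists_mem_ne (s := Finset.univ.filter fun u => M v u = true)
    (by unfold deg at h; omega) a
  exact ⟨b, by simpa using hb, hba⟩

/-- In a connected graph, if `w` has degree two along with its neighbours and `wx` is not an
edge, then some edge `bc` with `b` adjacent to `w` can be exchanged for `wx`. -/
lemma exists_swap {M : Mat n} (hM : Symm M) {X : VSet n} (hconn : Conn M X)
    (hX : ∀ u v, M u v = true → X u = true) {w x : Fin n} (hw : X w = true) (hx : X x = true)
    (hwx : M w x = false) (hne : w ≠ x) (hdeg : ∀ b, M w b = true → deg M b = 2) :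
    ∃ b c, M w b = true ∧ M b c = true ∧ c ≠ w ∧ Conn (swap M b c w x) X := by
  -- The vertices reachable from `x` without entering `w`. The last step of a walk from `x` to `w`
  -- starts at a neighbour `b` of `w` in this set, and `c` is the other neighbour of `b`.
  let A : Fin n → Prop := Relation.ReflTransGen (fun u v => M u v = true ∧ v ≠ w) x
  have hA : ∀ v, A v → v ≠ w := by
    intro v hv
    rcases Relation.ReflTransGen.cases_tail hv with rfl | ⟨u, -, hu⟩
    · exact hne.symm
    · exact hu.2
  obtain ⟨b, hwb, hAb⟩ : ∃ b, M w b = true ∧ A b := by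
    by_contra hcon
    push Not at hcon
    refine hA w (hconn.2 A ⟨x, hx, Relation.ReflTransGen.refl⟩ (fun u v _ _ hu huv => ?_) w hw) rfl
    refine hu.tail ⟨huv, ?_⟩
    rintro rfl
    exact hcon u (by rw [hM]; exact huv) hu
  have hbx : b ≠ x := by rintro rfl; simp [hwx] at hwb
  have hdb := hdeg b hwb
  have hbw : M b w = true := by rw [hM]; exact hwb
  obtain ⟨c, hbc, hcw⟩ := exists_ne_of_deg_two (a := w) hdb
  let A' : Fin n → Prop :=
    Relation.ReflTransGen (fun u v => M u v = true ∧ v ≠ w ∧ v ≠ b) x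
  have hA' : ∀ v, A' v → v ≠ w ∧ v ≠ b := by
    intro v hv
    rcases Relation.ReflTransGen.cases_tail hv with rfl | ⟨u, -, hu⟩
    · exact ⟨hne.symm, hbx.symm⟩
    · exact hu.2
  -- The neighbours of `b` are `w` and `c`, so a walk from `x` that avoids `w` first reaches `b`
  -- through `c`. Thus `x` reaches `c` without using `bc`. After the exchange `b` hangs on `w`
  -- directly, and `c` hangs on `w` through `x`.
  have hA'c : A' c := by
    have key : ∀ v, A v → A' v ∨ A' c := by
      intro v hv
      induction hv with
      | refl => exact Or.inl Relation.ReflTransGen.refl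
      | @tail u v hu huv ih =>
        rcases ih with ih | ih
        · by_cases hvb : v = b
          · subst hvb
            rcases eq_or_eq_of_deg_two hdb hbw hbc hcw.symm
              (show M v u = true by rw [hM]; exact huv.1) with rfl | rfl
            · exact absurd rfl (hA' _ ih).1
            · exact Or.inr ih
          · exact Or.inl (ih.tail ⟨huv.1, huv.2, hvb⟩)
        · exact Or.inr ih
    exact (key b hAb).resolve_left fun h => (hA' b h).2 rfl
  have hb : X b = true := hX _ _ hbw
  refine ⟨b, c, hwb, hbc, hcw, ?_⟩
  refine conn_of_root (hM.swap b c w x) hw fun P hPw hP => ?_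
  have hold : ∀ u v, M u v = true → ¬ ((u = b ∧ v = c) ∨ (u = c ∧ v = b)) →
      swap M b c w x u v = true := by
    intro u v huv hne
    rw [← samePair_iff] at hne
    simp [swap, huv, hne]
  have hwb' : w ≠ b := by
    rintro rfl
    exact (hA _ hAb) rfl
  have hPb : P b := hP w b hw hb hPw (hold _ _ hwb (by grind))
  have hPx : P x := hP w x hw hx hPw (by simp [swap, samePair])
  have hPA : ∀ v, A' v → P v ∧ X v = true := by
    intro v hv
    induction hv with
    | refl => exact ⟨hPx, hx⟩
    | @tail u v hu huv ih =>
      have hv : X v = true := hX v u (by rw [hM]; exact huv.1)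
      have hub := (hA' u hu).2
      exact ⟨hP u v ih.2 hv ih.1 (hold _ _ huv.1 (by grind)), hv⟩
  have hPc : P c := (hPA c hA'c).1
  refine hconn.2 P ⟨w, hw, hPw⟩ fun u v hu hv hPu huv => ?_
  by_cases h : (u = b ∧ v = c) ∨ (u = c ∧ v = b)
  · rcases h with ⟨rfl, rfl⟩ | ⟨rfl, rfl⟩ <;> assumption
  · exact hP u v hu hv hPu (hold u v huv h)

lemma Good.ne {g : BGraph n} (hg : Good g) {u v : Fin n} (h : g.adj u v = true) : u ≠ v := by
  rintro rfl
  rw [hg.irrefl] at h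
  simp at h

/-- In a locally optimal tree, a vertex around which the tree is a path has no further edges. -/
lemma deg_eq_two_of_localOpt {g : BGraph n} (hg : Good g) {T : Tree n} (hT : SpanTree g T)
    (hopt : LocalOpt g T) {w : Fin n} (hw : deg T.adj w = 2)
    (h1 : ∀ b, T.adj w b = true → deg T.adj b = 2)
    (h2 : ∀ b c, T.adj w b = true → T.adj b c = true → deg T.adj c = 2) :
    deg g.adj w = 2 := by
  by_contra hdeg
  have hlt : deg T.adj w < deg g.adj w := by
    have : deg T.adj w ≤ deg g.adj w := Finset.card_le_card fun u => by
      simp only [Finset.mem_filter, Finset.mem_univ, true_and]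
      exact hT.sub w u
    omega
  obtain ⟨x, hx, hx'⟩ := Finset.exists_mem_notMem_of_card_lt_card hlt
  simp only [Finset.mem_filter, Finset.mem_univ, true_and, Bool.not_eq_true] at hx hx'
  have hwx : w ≠ x := hg.ne hx
  have hgx : g.adj x w = true := by rw [hg.symm]; exact hx
  obtain ⟨b, c, hwb, hbc, hcw, hconn⟩ := exists_swap hT.symm hT.conn
    (fun u v h => hg.mem u v (hT.sub u v h)) (hg.mem _ _ hx) (hg.mem _ _ hgx) hx' hwx h1
  have hle := hopt b c w x hbc hx hx' hconn
  have hbc' : b ≠ c := hg.ne (hT.sub _ _ hbc)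
  have hwb' : w ≠ b := hg.ne (hT.sub _ _ hwb)
  have hbx : b ≠ x := by rintro rfl; simp [hx'] at hwb
  have hdeg := deg_swap hT.symm hbc hbc' hx' hwx
  have hb2 := h1 b hwb
  have hc2 := h2 b c hwb hbc
  -- The exchange raises `w` to degree three and lowers `b` to degree one; `c` drops to degree one
  -- as well unless `c = x`. Only `x` can newly reach degree two, so the count falls by at least
  -- one, against local optimality.
  have hsub : (Finset.univ.filter fun v => deg (swap T.adj b c w x) v = 2) ⊆
      insert x (((Finset.univ.filter fun v => deg T.adj v = 2).erase w).erase b) := by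
    intro v
    simp only [Finset.mem_filter, Finset.mem_univ, true_and, Finset.mem_insert, Finset.mem_erase]
    intro hv
    have := hdeg v
    rw [hv] at this
    by_cases hvx : v = x
    · exact Or.inl hvx
    · right
      by_cases hvw : v = w
      · subst hvw; simp [hwb', hcw.symm, hw] at this
      · by_cases hvb : v = b
        · subst hvb; simp [hbx, hwb'.symm, hb2] at this
        · by_cases hvc : v = c
          · subst hvc; simp [hvx, hvw, hc2] at this
          · simp [hvx, hvw, hvb, hvc] at this
            exact ⟨hvb, hvw, this.symm⟩
  have hcard := (Finset.card_le_card hsub).trans (Finset.card_insert_le _ _)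
  rw [Finset.card_erase_of_mem (by simp [hb2, hwb'.symm]), Finset.card_erase_of_mem (by simp [hw])]
    at hcard
  have hpos : 2 ≤ d2 T.adj := by
    refine le_trans (Finset.card_pair hwb').ge (Finset.card_le_card ?_)
    intro v; simp only [Finset.mem_insert, Finset.mem_singleton, Finset.mem_filter,
      Finset.mem_univ, true_and]
    rintro (rfl | rfl) <;> assumption
  unfold d2 at hle hpos
  omega

/-- The neighbours of a set of vertices. -/
def nbrs (M : Mat n) (A : Finset (Fin n)) : Finset (Fin n) :=
  A.biUnion fun u => Finset.univ.filter fun v => M u v = true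

lemma mem_nbrs {M : Mat n} {A : Finset (Fin n)} {v : Fin n} :
    v ∈ nbrs M A ↔ ∃ u ∈ A, M u v = true := by
  simp [nbrs]

lemma card_nbrs_le (M : Mat n) (A : Finset (Fin n)) : (nbrs M A).card ≤ ∑ u ∈ A, deg M u :=
  Finset.card_biUnion_le

/-- Three mutually adjacent vertices of degree two would be closed under adjacency, hence the whole
tree, and their degree sum six would exceed the permitted `2 · 3 - 2`. -/
lemma SpanTree.no_triangle {g : BGraph n} (hg : Good g) {T : Tree n} (hT : SpanTree g T)
    {a b c : Fin n} (hab : T.adj a b = true) (hbc : T.adj b c = true) (hca : T.adj c a = true)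
    (ha : deg T.adj a = 2) (hb : deg T.adj b = 2) (hc : deg T.adj c = 2) : False := by
  have hab' := hg.ne (hT.sub _ _ hab)
  have hbc' := hg.ne (hT.sub _ _ hbc)
  have hca' := hg.ne (hT.sub _ _ hca)
  have hsymm := hT.symm
  unfold Symm at hsymm
  have hall : ∀ v, g.vert v = true → v ∈ ({a, b, c} : Finset (Fin n)) := by
    refine hT.conn.2 _ ⟨a, hg.mem _ _ (hT.sub _ _ hab), by simp⟩ fun u v _ _ hu huv => ?_
    simp only [Finset.mem_insert, Finset.mem_singleton] at hu ⊢
    rcases hu with rfl | rfl | rfl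
    · rcases eq_or_eq_of_deg_two ha hab (by rw [hsymm]; exact hca) hbc' huv with rfl | rfl <;> simp
    · rcases eq_or_eq_of_deg_two hb hbc (by rw [hsymm]; exact hab) hca' huv with rfl | rfl <;> simp
    · rcases eq_or_eq_of_deg_two hc hca (by rw [hsymm]; exact hbc) hab' huv with rfl | rfl <;> simp
  have hcard : card g.vert ≤ 3 := by
    refine (Finset.card_le_card fun v hv => hall v ?_).trans Finset.card_le_three
    simpa using hv
  have hsum : ∑ v ∈ ({a, b, c} : Finset (Fin n)), deg T.adj v ≤ ∑ v, deg T.adj v :=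
    Finset.sum_le_sum_of_subset (Finset.subset_univ _)
  rw [Finset.sum_insert (by simp [hab', hca'.symm]), Finset.sum_insert (by simp [hbc']),
    Finset.sum_singleton, ha, hb, hc] at hsum
  have := hT.count
  omega

/-- The degree sum bounds the branching vertices `B` by the leaves `L`. Degree-two vertices at tree
distance more than three from `L ∪ B` would yield a thin path, and those within distance three are
few because paths through `D` do not branch. -/
lemma card_le_leafSet {g : BGraph n} (hg : Good g) (hthin : ∀ p, ¬ Thin g p) {T : Tree n}
    (hT : SpanTree g T) (hopt : LocalOpt g T) : card g.vert ≤ 52 * card (leafSet T) := by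
  have hsymm := hT.symm
  have hmem : ∀ u v, T.adj u v = true → g.vert u = true := fun u v h => hg.mem u v (hT.sub u v h)
  set V := Finset.univ.filter fun v => g.vert v = true with hV
  set L := V.filter fun v => deg T.adj v ≤ 1 with hL
  set D := V.filter fun v => deg T.adj v = 2 with hD
  set B := V.filter fun v => 3 ≤ deg T.adj v with hB
  have hLcard : card (leafSet T) = L.card := by
    unfold card
    congr 1
    ext v
    simp [hL, hV, leafSet, hT.vert]
  have hVcard : card g.vert = V.card := rfl
  have hunion : ∀ f : Fin n → ℕ, ∑ v ∈ V, f v = ∑ v ∈ L, f v + ∑ v ∈ D, f v + ∑ v ∈ B, f v := by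
    intro f
    clear_value V
    rw [hL, hD, hB, Finset.sum_filter, Finset.sum_filter, Finset.sum_filter,
      ← Finset.sum_add_distrib, ← Finset.sum_add_distrib]
    refine Finset.sum_congr rfl fun v _ => ?_
    split_ifs <;> omega
  have hcards : V.card = L.card + D.card + B.card := by
    simpa using hunion fun _ => 1
  have hsum : ∑ v ∈ V, deg T.adj v + 2 ≤ 2 * V.card :=
    (Nat.add_le_add_right (Finset.sum_le_sum_of_subset (Finset.subset_univ V)) 2).trans hT.count
  have hDsum : ∑ v ∈ D, deg T.adj v = D.card * 2 :=
    Finset.sum_const_nat fun v hv => (Finset.mem_filter.1 hv).2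
  have hLsum : ∑ v ∈ L, deg T.adj v ≤ L.card * 1 :=
    Finset.sum_le_card_nsmul _ _ _ fun v hv => (Finset.mem_filter.1 hv).2
  have hBsum : B.card * 3 ≤ ∑ v ∈ B, deg T.adj v :=
    Finset.card_nsmul_le_sum B (deg T.adj) 3 fun v hv => (Finset.mem_filter.1 hv).2
  rw [hunion] at hsum
  -- `X₁`, `X₂`, `X₃` collect the degree-two vertices reached from `L ∪ B` by one, two or three tree
  -- edges through `D`. Each layer is at most twice the preceding one.
  set X₁ := nbrs T.adj (L ∪ B) ∩ D with hX₁
  set X₂ := nbrs T.adj X₁ ∩ D with hX₂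
  set X₃ := nbrs T.adj X₂ ∩ D with hX₃
  have hX₁card : X₁.card ≤ ∑ v ∈ L, deg T.adj v + ∑ v ∈ B, deg T.adj v := by
    refine (Finset.card_le_card Finset.inter_subset_left).trans ((card_nbrs_le _ _).trans ?_)
    rw [← Finset.sum_union_inter]
    omega
  have hstep : ∀ A ⊆ D, (nbrs T.adj A ∩ D).card ≤ A.card * 2 := by
    intro A hA
    refine (Finset.card_le_card Finset.inter_subset_left).trans ((card_nbrs_le _ _).trans ?_)
    exact (Finset.sum_const_nat fun v hv => (Finset.mem_filter.1 (hA hv)).2).le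
  have hX₂card : X₂.card ≤ X₁.card * 2 := hstep X₁ Finset.inter_subset_right
  have hX₃card : X₃.card ≤ X₂.card * 2 := hstep X₂ Finset.inter_subset_right
  have hcover : D ⊆ X₁ ∪ X₂ ∪ X₃ := by
    intro c hcD
    by_contra hc
    simp only [Finset.mem_union, not_or] at hc
    obtain ⟨⟨hc1, hc2⟩, hc3⟩ := hc
    have hdeg : ∀ {v}, v ∈ D → deg T.adj v = 2 := fun hv => (Finset.mem_filter.1 hv).2
    have hflip : ∀ {u v}, T.adj u v = true → T.adj v u = true := fun h => by
      rw [hsymm]; exact h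
    have s1 : ∀ {v u}, v ∈ D → v ∉ X₁ → T.adj v u = true → u ∈ D := by
      intro v u hv hv1 hvu
      have huV : u ∈ V := by simpa [hV] using hmem u v (hflip hvu)
      by_contra hu
      refine hv1 (Finset.mem_inter.2 ⟨mem_nbrs.2 ⟨u, ?_, hflip hvu⟩, hv⟩)
      simp only [hL, hB, hD, Finset.mem_union, Finset.mem_filter, huV, true_and] at hu ⊢
      omega
    have s2 : ∀ {v u}, v ∈ D → v ∉ X₂ → T.adj v u = true → u ∉ X₁ := fun hv hv2 hvu hu =>
      hv2 (Finset.mem_inter.2 ⟨mem_nbrs.2 ⟨_, hu, hflip hvu⟩, hv⟩)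
    have s3 : ∀ {v u}, v ∈ D → v ∉ X₃ → T.adj v u = true → u ∉ X₂ := fun hv hv3 hvu hu =>
      hv3 (Finset.mem_inter.2 ⟨mem_nbrs.2 ⟨_, hu, hflip hvu⟩, hv⟩)
    have hgdeg : ∀ {v}, v ∈ D → v ∉ X₁ → v ∉ X₂ → deg g.adj v = 2 := fun hv hv1 hv2 =>
      deg_eq_two_of_localOpt hg hT hopt (hdeg hv) (fun b hb => hdeg (s1 hv hv1 hb))
        fun b d hb hd => hdeg (s1 (s1 hv hv1 hb) (s2 hv hv2 hb) hd)
    -- Outside the three layers, `c` and both its neighbours `b`, `e` satisfy the hypotheses of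
    -- `deg_eq_two_of_localOpt`. With `a`, the other neighbour of `b`, they form a thin path, where
    -- `a ≠ e` because the tree has no triangle.
    obtain ⟨b, hcb, -⟩ := exists_ne_of_deg_two (a := c) (hdeg hcD)
    obtain ⟨e, hce, heb⟩ := exists_ne_of_deg_two (a := b) (hdeg hcD)
    have hbD := s1 hcD hc1 hcb
    have heD := s1 hcD hc1 hce
    obtain ⟨a, hba, hac⟩ := exists_ne_of_deg_two (a := c) (hdeg hbD)
    refine hthin ⟨a, b, c, e⟩ ⟨hT.sub _ _ (hflip hba), hT.sub _ _ (hflip hcb), hT.sub _ _ hce,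
      hac, heb.symm, ?_, hgdeg hbD (s2 hcD hc2 hcb) (s3 hcD hc3 hcb), hgdeg hcD hc1 hc2,
      hgdeg heD (s2 hcD hc2 hce) (s3 hcD hc3 hce)⟩
    change a ≠ e
    rintro rfl
    exact hT.no_triangle hg hba (hflip hce) hcb (hdeg hbD) (hdeg heD) (hdeg hcD)
  -- Now `|D| ≤ 7|X₁|` with `|X₁| < 2(|L| + |B|)` and `|B| < 2|L|`. This gives `|V| < 45|L|`,
  -- comfortably within the constant 52.
  have hDcard : D.card ≤ X₁.card + X₂.card + X₃.card :=
    (Finset.card_le_card hcover).trans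
      ((Finset.card_union_le _ _).trans (Nat.add_le_add_right (Finset.card_union_le _ _) _))
  rw [hLcard, hVcard]
  omega

end Basic

end CMC

namespace CMC

open Timed

section Basic

variable {n : ℕ}

/-! ### Weighted sums over the entries of a matrix -/

/-- The sum of `f` over the entries of `O`. -/
def entrySum (O : Mat n) (f : Fin n → Fin n → ℕ) : ℕ := ∑ u, ∑ v, if O u v = true then f u v else 0

lemma entrySum_add (O : Mat n) (f h : Fin n → Fin n → ℕ) :
    entrySum O (fun u v => f u v + h u v) = entrySum O f + entrySum O h := by
  simp only [entrySum, ← Finset.sum_add_distrib]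
  refine Finset.sum_congr rfl fun u _ => Finset.sum_congr rfl fun v _ => ?_
  split_ifs <;> rfl

lemma entrySum_mono {O : Mat n} {f h : Fin n → Fin n → ℕ}
    (hle : ∀ u v, O u v = true → f u v ≤ h u v) : entrySum O f ≤ entrySum O h := by
  refine Finset.sum_le_sum fun u _ => Finset.sum_le_sum fun v _ => ?_
  split_ifs with huv
  · exact hle u v huv
  · exact le_rfl

lemma entrySum_mono_mat {O O' : Mat n} {f : Fin n → Fin n → ℕ}
    (hle : ∀ u v, f u v ≠ 0 → O u v = true → O' u v = true) : entrySum O f ≤ entrySum O' f := by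
  refine Finset.sum_le_sum fun u _ => Finset.sum_le_sum fun v _ => ?_
  by_cases hf : f u v = 0
  · simp [hf]
  · split_ifs with h h'
    · exact le_rfl
    · exact absurd (hle u v hf h) h'
    · exact Nat.zero_le _
    · exact le_rfl

lemma entrySum_swap {O : Mat n} (hO : Symm O) (f : Fin n → Fin n → ℕ) :
    entrySum O (fun u v => f v u) = entrySum O f := by
  unfold entrySum
  rw [Finset.sum_comm]
  refine Finset.sum_congr rfl fun u _ => Finset.sum_congr rfl fun v _ => ?_
  rw [hO]

lemma entrySum_row (O : Mat n) (f : Fin n → ℕ) :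
    entrySum O (fun u _ => f u) = ∑ u, f u * deg O u := by
  refine Finset.sum_congr rfl fun u _ => ?_
  rw [← Finset.sum_filter, Finset.sum_const, smul_eq_mul, mul_comm]
  rfl

lemma cutN_eq_entrySum (O : Mat n) (X : VSet n) :
    cutN O X = entrySum O fun u v => (X u && !X v).toNat := by
  refine Finset.sum_congr rfl fun u _ => Finset.sum_congr rfl fun v _ => ?_
  beta_reduce
  cases X u <;> cases X v <;> cases O u v <;> rfl

lemma two_mul_cutN {O : Mat n} (hO : Symm O) (X : VSet n) :
    2 * cutN O X = entrySum O fun u v => (X u != X v).toNat := by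
  rw [cutN_eq_entrySum, two_mul]
  nth_rewrite 2 [← entrySum_swap hO]
  rw [← entrySum_add]
  congr 1
  funext u v
  cases X u <;> cases X v <;> rfl

/-! ### Splitting the leaves -/

/-- One step of the greedy partition. -/
def splitStep (O : Mat n) (L : VSet n) (P : VSet n × VSet n) (v : Fin n) : VSet n × VSet n :=
  if L v = true then
    (if (∑ u, if (P.1 u && O u v) = true then 1 else 0) ≤
        (∑ u, if (P.2 u && O u v) = true then 1 else 0)
      then (fun u => P.1 u || decide (u = v), P.2) else (P.1, fun u => P.2 u || decide (u = v)))
  else P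

lemma splitLeaves_val (g : BGraph n) (L : VSet n) : (splitLeaves g L).val =
    (List.finRange n).foldl (splitStep g.one L) (fun _ => false, fun _ => false) := by
  simp only [splitLeaves, bind_val, foldT_val, emptySet_val]
  congr 1
  funext P v
  unfold splitStep
  by_cases h : L v = true
  · rw [if_pos h, if_pos h]
    simp only [bind_val]
    rw [apply_ite Timed.val]
    rfl
  · rw [if_neg h, if_neg h]; rfl

/-- The number of entries of `O` from `A` to `B`. -/
def between (O : Mat n) (A B : VSet n) : ℕ := entrySum O fun u v => (A u && B v).toNat

lemma between_comm {O : Mat n} (hO : Symm O) (A B : VSet n) : between O A B = between O B A := by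
  unfold between
  rw [← entrySum_swap hO]
  simp only [Bool.and_comm]

lemma between_insert {O : Mat n} (hO : Symm O) {A B : VSet n} {v : Fin n} (hv : A v = false) :
    between O (fun u => A u || decide (u = v)) B =
      between O A B + ∑ u, if (B u && O u v) = true then 1 else 0 := by
  have : (∑ u, if (B u && O u v) = true then (1 : ℕ) else 0) =
      entrySum O fun u w => (decide (u = v) && B w).toNat := by
    symm
    rw [entrySum, Finset.sum_eq_single v]
    · refine Finset.sum_congr rfl fun u _ => ?_
      rw [hO]
      cases B u <;> cases O u v <;> simp
    · intro u _ hu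
      simp [hu]
    · simp
  rw [this, between, between, ← entrySum_add]
  congr 1
  funext u w
  by_cases hu : u = v
  · subst hu; simp [hv]
  · simp [hu]

/-- Placing `v` on a side where it has `a` `1`-edges, while it has `b ≥ a` on the other, adds `2a`
to the ordered count inside the parts and `b` to the count across. Hence the inequality survives
each step. -/
lemma splitLeaves_spec {g : BGraph n} (hg : Good g) (L : VSet n) :
    let P := (splitLeaves g L).val
    (∀ v, ¬ (P.1 v = true ∧ P.2 v = true)) ∧ (∀ v, (P.1 v || P.2 v) = L v) ∧
      between g.one P.1 P.1 + between g.one P.2 P.2 ≤ 2 * between g.one P.1 P.2 := by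
  have hO := hg.one_symm
  have hirr : ∀ v, g.one v v = false := fun v => by
    by_contra h
    have := hg.one_adj v v (by simpa using h)
    rw [hg.irrefl] at this
    simp at this
  have hself : ∀ (A : VSet n) v, A v = false →
      between g.one (fun u => A u || decide (u = v)) (fun u => A u || decide (u = v)) =
        between g.one A A + 2 * ∑ u, if (A u && g.one u v) = true then 1 else 0 := by
    intro A v hv
    rw [between_insert hO hv, between_comm hO, between_insert hO hv, two_mul, add_assoc]
    congr 2
    refine Finset.sum_congr rfl fun u _ => ?_
    by_cases hu : u = v
    · subst hu; simp [hirr]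
    · simp [hu]
  have key : ∀ (l : List (Fin n)) (P : VSet n × VSet n), l.Nodup →
      (∀ v ∈ l, P.1 v = false ∧ P.2 v = false) → (∀ v, ¬ (P.1 v = true ∧ P.2 v = true)) →
      between g.one P.1 P.1 + between g.one P.2 P.2 ≤ 2 * between g.one P.1 P.2 →
      let Q := l.foldl (splitStep g.one L) P
      (∀ v, ¬ (Q.1 v = true ∧ Q.2 v = true)) ∧
        (∀ v, (Q.1 v || Q.2 v) = (P.1 v || P.2 v || (decide (v ∈ l) && L v))) ∧
        between g.one Q.1 Q.1 + between g.one Q.2 Q.2 ≤ 2 * between g.one Q.1 Q.2 := by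
    intro l
    induction l with
    | nil => intro P _ _ h1 h2; exact ⟨h1, by simp, h2⟩
    | cons v l ih =>
      intro P hnd hl hP hle
      obtain ⟨hv, hnd⟩ := List.nodup_cons.1 hnd
      obtain ⟨hv1, hv2⟩ := hl v List.mem_cons_self
      have hl' : ∀ u ∈ l, P.1 u = false ∧ P.2 u = false ∧ u ≠ v := fun u hu =>
        ⟨(hl u (List.mem_cons_of_mem _ hu)).1, (hl u (List.mem_cons_of_mem _ hu)).2, by
          rintro rfl; exact hv hu⟩
      simp only [List.foldl_cons]
      by_cases hLv : L v = true
      · by_cases hab : (∑ u, if (P.1 u && g.one u v) = true then 1 else 0) ≤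
          (∑ u, if (P.2 u && g.one u v) = true then 1 else 0)
        · rw [show splitStep g.one L P v = (fun u => P.1 u || decide (u = v), P.2) by
            simp only [splitStep, hLv, if_true, hab]]
          obtain ⟨h1, h2, h3⟩ := ih (fun u => P.1 u || decide (u = v), P.2) hnd
            (fun u hu => by simp [hl' u hu]) (by grind) (by
              dsimp only
              rw [hself _ _ hv1, between_insert hO hv1]; omega)
          exact ⟨h1, fun u => by rw [h2]; by_cases huv : u = v <;> simp_all [List.mem_cons], h3⟩
        · rw [show splitStep g.one L P v = (P.1, fun u => P.2 u || decide (u = v)) by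
            simp only [splitStep, hLv, if_true, hab, if_false]]
          obtain ⟨h1, h2, h3⟩ := ih (P.1, fun u => P.2 u || decide (u = v)) hnd
            (fun u hu => by simp [hl' u hu]) (by grind) (by
              dsimp only
              rw [hself _ _ hv2, between_comm hO P.1 fun u => P.2 u || decide (u = v),
                between_insert hO hv2, between_comm hO P.2 P.1]
              omega)
          exact ⟨h1, fun u => by rw [h2]; by_cases huv : u = v <;> simp_all [List.mem_cons], h3⟩
      · rw [show splitStep g.one L P v = P by simp only [splitStep, hLv]; rfl]
        obtain ⟨h1, h2, h3⟩ := ih P hnd (fun u hu => ⟨(hl' u hu).1, (hl' u hu).2.1⟩) hP hle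
        exact ⟨h1, fun u => by rw [h2]; by_cases huv : u = v <;> simp_all [List.mem_cons], h3⟩
  rw [splitLeaves_val]
  obtain ⟨h1, h2, h3⟩ := key (List.finRange n) (fun _ => false, fun _ => false)
    (List.nodup_finRange n) (by simp) (by simp) (by simp [between, entrySum])
  exact ⟨h1, fun v => by rw [h2]; simp, h3⟩

/-! ### Subtrees and their cuts -/

/-- `T` is a connected subgraph of `g`. -/
structure SubTree (g : BGraph n) (T : Tree n) : Prop where
  vert : ∀ v, T.vert v = true → g.vert v = true
  symm : Symm T.adj
  sub : ∀ u v, T.adj u v = true → g.adj u v = true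
  mem : ∀ u v, T.adj u v = true → T.vert u = true
  conn : Conn T.adj T.vert

lemma SpanTree.subTree {g : BGraph n} (hg : Good g) {T : Tree n} (hT : SpanTree g T) :
    SubTree g T :=
  ⟨fun v hv => by rw [← hT.vert]; exact hv, hT.symm, hT.sub,
    fun u v h => by rw [hT.vert]; exact hg.mem u v (hT.sub u v h),
    by rw [hT.vert]; exact hT.conn⟩

lemma eq_of_deg_le_one {M : Mat n} {v a b : Fin n} (h : deg M v ≤ 1) (ha : M v a = true)
    (hb : M v b = true) : a = b :=
  Finset.card_le_one.1 h a (by simpa using ha) b (by simpa using hb)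

/-- A walk entering a leaf must leave by the vertex it came from. The predicate keeps, for a deleted
leaf, a surviving neighbour already reached; `L` may be any set of vertices of degree at most one.
-/
lemma conn_remove_leaves {M : Mat n} (hM : Symm M) {X Y L : VSet n} (h : Conn M X)
    (hL : ∀ v, L v = true → deg M v ≤ 1) (hY : ∀ v, Y v = (X v && !L v))
    (hne : ∃ v, Y v = true) : Conn M Y := by
  refine ⟨hne, fun P ⟨r, hr, hPr⟩ hP v hv => ?_⟩
  have hYX : ∀ v, Y v = true ↔ X v = true ∧ L v = false := fun v => by rw [hY]; simp
  refine (h.2 (fun v => (Y v = true → P v) ∧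
    (L v = true → ∃ y, Y y = true ∧ P y ∧ M y v = true)) ⟨r, ((hYX r).1 hr).1, fun _ => hPr, ?_⟩
    ?_ v ((hYX v).1 hv).1).1 hv
  · intro hrL
    rw [((hYX r).1 hr).2] at hrL
    simp at hrL
  · rintro u w hu hw ⟨hPu, hPu'⟩ huw
    by_cases hLu : L u = true
    · obtain ⟨y, hy, hPy, hyu⟩ := hPu' hLu
      have : w = y := eq_of_deg_le_one (hL u hLu) huw (by rw [hM]; exact hyu)
      subst this
      refine ⟨fun _ => hPy, fun hLw => ?_⟩
      rw [((hYX w).1 hy).2] at hLw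
      simp at hLw
    · have hYu : Y u = true := (hYX u).2 ⟨hu, by simpa using hLu⟩
      exact ⟨fun hYw => hP u w hYu hYw (hPu hYu) huw, fun _ => ⟨u, hYu, hPu hYu, huw⟩⟩

/-- The number of `1`-edges at the leaves of `T`, counted at each leaf. -/
def thick (g : BGraph n) (T : Tree n) : ℕ := ∑ v, if leafSet T v = true then deg g.one v else 0

@[simp] lemma thickness_val (g : BGraph n) (T : Tree n) : (thickness g T).val = thick g T := by
  simp [thickness, thick]

/-- An edge between the two parts of the leaves is cut by both candidates, and an edge from a leaf
to a non-leaf by exactly one, whether or not the other end lies in `T`. The greedy inequality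
charges the edges inside the parts to those between them. -/
lemma treeCut_spec {g : BGraph n} (hg : Good g) {T : Tree n} (hT : SubTree g T) :
    (∀ v, (treeCut g T).val v = true → g.vert v = true) ∧ Conn g.adj (treeCut g T).val ∧
      thick g T ≤ 4 * cutN g.one (treeCut g T).val := by
  have hO := hg.one_symm
  obtain ⟨hdis, hcov, hsplit⟩ := splitLeaves_spec hg (leafSet T)
  set A := (splitLeaves g (leafSet T)).val.1 with hA
  set B := (splitLeaves g (leafSet T)).val.2 with hB
  let X₁ : VSet n := fun v => T.vert v && !A v
  let X₂ : VSet n := fun v => T.vert v && !B v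
  have hval : (treeCut g T).val = (chooseBest g [X₁, X₂]).val := by
    simp only [treeCut, bind_val, leaves_val, table_val, op_val]
    rfl
  have hAL : ∀ v, A v = true → leafSet T v = true := fun v hv => by rw [← hcov v, hv]; rfl
  have hBL : ∀ v, B v = true → leafSet T v = true := fun v hv => by
    rw [← hcov v, hv, Bool.or_true]
  have hLdeg : ∀ v, leafSet T v = true → T.vert v = true ∧ deg T.adj v ≤ 1 := fun v hv => by
    simpa [leafSet] using hv
  have hc₁ : (∃ v, X₁ v = true) → Conn g.adj X₁ := fun hne =>
    (conn_remove_leaves hT.symm hT.conn (fun v hv => (hLdeg v (hAL v hv)).2) (fun _ => rfl)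
      hne).mono fun u v _ _ => hT.sub u v
  have hc₂ : (∃ v, X₂ v = true) → Conn g.adj X₂ := fun hne =>
    (conn_remove_leaves hT.symm hT.conn (fun v hv => (hLdeg v (hBL v hv)).2) (fun _ => rfl)
      hne).mono fun u v _ _ => hT.sub u v
  have hne : (∃ v, X₁ v = true) ∨ ∃ v, X₂ v = true := by
    obtain ⟨v, hv⟩ := hT.conn.1
    by_cases hAv : A v = true
    · right
      have := hdis v
      exact ⟨v, by simp only [X₂]; grind⟩
    · left
      exact ⟨v, by simp only [X₁]; grind⟩
  have hex : ∃ X ∈ [X₁, X₂], Conn g.adj X := by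
    rcases hne with h | h
    · exact ⟨X₁, by simp, hc₁ h⟩
    · exact ⟨X₂, by simp, hc₂ h⟩
  obtain ⟨hmem, hconn, hbest⟩ := chooseBest_spec hg.symm hex
  rw [hval]
  have hempty : ∀ X : VSet n, ¬ (∃ v, X v = true) → cutN g.one X = 0 := by
    intro X hX
    rw [cutN_eq_entrySum]
    simp only [not_exists, Bool.not_eq_true] at hX
    simp [entrySum, hX]
  have hcut₁ : cutN g.one X₁ ≤ cutN g.one (chooseBest g [X₁, X₂]).val := by
    by_cases h : ∃ v, X₁ v = true
    · exact hbest X₁ (by simp) (hc₁ h)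
    · rw [hempty _ h]; exact Nat.zero_le _
  -- A candidate may be empty, when every vertex of `T` lies in one part; then it cuts nothing and
  -- the bound is trivial.
  have hcut₂ : cutN g.one X₂ ≤ cutN g.one (chooseBest g [X₁, X₂]).val := by
    by_cases h : ∃ v, X₂ v = true
    · exact hbest X₂ (by simp) (hc₂ h)
    · rw [hempty _ h]; exact Nat.zero_le _
  refine ⟨fun v hv => ?_, hconn, ?_⟩
  · simp only [List.mem_cons, List.not_mem_nil, or_false] at hmem
    refine hT.vert v ?_
    rcases hmem with h | h <;> rw [h] at hv <;> simp only [X₁, X₂, Bool.and_eq_true] at hv <;>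
      exact hv.1
  · have hAt : ∀ v, A v = true → T.vert v = true := fun v hv => (hLdeg v (hAL v hv)).1
    have hBt : ∀ v, B v = true → T.vert v = true := fun v hv => (hLdeg v (hBL v hv)).1
    let O₁ := entrySum g.one fun u v => ((A u || B u) && !(A v || B v)).toNat
    have hsw : entrySum g.one (fun u v => ((A v || B v) && !(A u || B u)).toNat) = O₁ :=
      entrySum_swap hO fun u v => ((A u || B u) && !(A v || B v)).toNat
    have h1 : thick g T ≤ between g.one A A + between g.one B B + between g.one A B +
        between g.one B A + O₁ := by
      have : thick g T = entrySum g.one fun u _ => (leafSet T u).toNat := by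
        rw [entrySum_row]
        refine Finset.sum_congr rfl fun v _ => ?_
        cases leafSet T v <;> simp
      rw [this]
      simp only [between, O₁, ← entrySum_add]
      refine entrySum_mono fun u v _ => ?_
      rw [← hcov u]
      cases A u <;> cases B u <;> cases A v <;> cases B v <;> decide
    have h2 : 2 * between g.one A B + 2 * between g.one B A + 2 * O₁ ≤
        2 * cutN g.one X₁ + 2 * cutN g.one X₂ := by
      rw [two_mul_cutN hO, two_mul_cutN hO, two_mul O₁]
      nth_rewrite 2 [← hsw]
      simp only [two_mul, between, O₁, ← entrySum_add]
      refine entrySum_mono fun u v _ => ?_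
      have a1 := hAt u
      have a2 := hAt v
      have b1 := hBt u
      have b2 := hBt v
      have d1 := hdis u
      have d2 := hdis v
      simp only [X₁, X₂]
      revert a1 a2 b1 b2 d1 d2
      cases A u <;> cases B u <;> cases A v <;> cases B v <;> cases T.vert u <;>
        cases T.vert v <;> decide
    have h3 := between_comm hO A B
    omega

end Basic

end CMC

namespace CMC

open Timed

section Basic

variable {n : ℕ}

/-! ### Lifting trees along a shrunk path -/

/-- The tree computed by `liftTree`. -/
def lifted (p : Quad n) (T : Tree n) : Tree n where
  vert := fun v => T.vert v || (T.adj p.v₁ p.v₃ && decide (v = p.v₂))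
  adj := fun u v => if T.adj p.v₁ p.v₃ then
      (T.adj u v && !samePair u v p.v₁ p.v₃) || samePair u v p.v₁ p.v₂ || samePair u v p.v₂ p.v₃
    else T.adj u v

lemma lifted_of_not {p : Quad n} {T : Tree n} (h : T.adj p.v₁ p.v₃ = false) :
    lifted p T = T := by
  simp [lifted, h]

section Lift

variable {g : BGraph n} {p : Quad n} {T : Tree n}

lemma Good.shrunk (hg : Good g) (hp : Thin g p) : Good (shrunk g p) := by
  have h01 := hp.ne₀₁ hg
  have h12 := hp.ne₁₂ hg
  have h23 := hp.ne₂₃ hg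
  have h02 := hp.ne₀₂
  have h13 := hp.ne₁₃
  have h03 := hp.ne₀₃
  have hv : ∀ u v, g.adj u v = true → g.vert u = true ∧ g.vert v = true := fun u v h =>
    ⟨hg.mem u v h, hg.mem v u (by rw [hg.symm]; exact h)⟩
  refine ⟨shrunk_symm hg, fun v => ?_, fun u v h => ?_, fun u v h => ?_, shrunk_one_symm hg, ?_⟩
  · rw [← Bool.not_eq_true, shrunk_adj_iff, hg.irrefl]
    grind
  · rw [shrunk_adj_iff] at h
    have h1 := hv _ _ hp.adj₁₂
    have h2 := hv _ _ hp.adj₂₃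
    simp only [CMC.shrunk, Bool.and_eq_true, decide_eq_true_eq]
    rcases h with ⟨h, hu, -⟩ | ⟨rfl, rfl⟩ | ⟨rfl, rfl⟩
    · exact ⟨(hv _ _ h).1, hu⟩
    · exact ⟨h1.1, h12⟩
    · exact ⟨h2.2, h23.symm⟩
  · rw [shrunk_adj_iff]
    simp only [CMC.shrunk] at h
    split_ifs at h with h1 h2
    · rw [samePair_iff] at h1
      rcases h1 with ⟨rfl, rfl⟩ | ⟨rfl, rfl⟩
      · exact Or.inl ⟨hp.adj₀₁, h02, h12⟩
      · exact Or.inl ⟨by rw [hg.symm]; exact hp.adj₀₁, h12, h02⟩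
    · rw [samePair_iff] at h2
      exact Or.inr h2
    · simp only [Bool.and_eq_true, decide_eq_true_eq] at h
      exact Or.inl ⟨hg.one_adj _ _ h.1.1, h.1.2, h.2⟩
  · have h1 : pat p g.vert true true = g.vert := by
      funext v
      simp only [pat]
      have := (hv _ _ hp.adj₁₂)
      split_ifs with h h'
      · rw [h, this.1]
      · rw [h', this.2]
      · rfl
    have h2 : pat p g.vert true false = (CMC.shrunk g p).vert := by
      funext v
      simp only [pat, CMC.shrunk]
      have := (hv _ _ hp.adj₁₂)
      split_ifs with h h'
      · rw [h, this.1]; simp [h12]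
      · simp [h']
      · simp [h']
    -- The full vertex set contains both ends of the path, so this is the subdivision clause of
    -- `conn_pat`.
    have := (conn_pat hg hp g.vert).2.2.2.2.2.2.2.1 (hv _ _ hp.adj₀₁).1 (hv _ _ hp.adj₂₃).2
    rw [← h2]
    refine this.2 ?_
    beta_reduce
    rw [h1]
    exact hg.conn

/-- Subdividing `v₁v₃` keeps the degrees of `v₁` and `v₃` and gives `v₂` degree two, so no leaf
appears or vanishes. If the tree avoids that edge it is unchanged and misses `v₂`, which is why only
`SubTree` is claimed. -/
lemma SubTree.lifted (hg : Good g) (hp : Thin g p) (hT : SubTree (shrunk g p) T) :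
    SubTree g (lifted p T) ∧ leafSet (lifted p T) = leafSet T := by
  have h12 := hp.ne₁₂ hg
  have h23 := hp.ne₂₃ hg
  have h13 := hp.ne₁₃
  have hvert : ∀ v, T.vert v = true → g.vert v = true ∧ v ≠ p.v₂ := fun v hv => by
    simpa [shrunk] using hT.vert v hv
  have hmem : ∀ u v, T.adj u v = true → T.vert u = true ∧ T.vert v = true := fun u v h =>
    ⟨hT.mem u v h, hT.mem v u (by rw [hT.symm]; exact h)⟩
  have hgv : ∀ u v, g.adj u v = true → g.vert u = true ∧ g.vert v = true := fun u v h =>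
    ⟨hg.mem u v h, hg.mem v u (by rw [hg.symm]; exact h)⟩
  have hadj : ∀ u v, T.adj u v = true → samePair u v p.v₁ p.v₃ = false → g.adj u v = true := by
    intro u v h hs
    have := hT.sub u v h
    rw [shrunk_adj_iff, ← samePair_iff, hs] at this
    simpa using this.resolve_right (by simp) |>.1
  cases h : T.adj p.v₁ p.v₃ with
  | false =>
    rw [lifted_of_not h]
    refine ⟨⟨fun v hv => (hvert v hv).1, hT.symm, fun u v huv => hadj u v huv ?_, hT.mem,
      hT.conn⟩, rfl⟩
    rw [← Bool.not_eq_true, samePair_iff]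
    rintro (⟨rfl, rfl⟩ | ⟨rfl, rfl⟩)
    · simp [h] at huv
    · rw [hT.symm] at huv; simp [h] at huv
  | true =>
    have hL : ∀ u v, (CMC.lifted p T).adj u v = true ↔
        (T.adj u v = true ∧ samePair u v p.v₁ p.v₃ = false) ∨ samePair u v p.v₁ p.v₂ = true ∨
          samePair u v p.v₂ p.v₃ = true := fun u v => by
      simp [CMC.lifted, h, or_assoc]
    have hLv : ∀ v, (CMC.lifted p T).vert v = true ↔ T.vert v = true ∨ v = p.v₂ := fun v => by
      simp [CMC.lifted, h]
    have hv1 := (hmem _ _ h).1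
    have hv3 := (hmem _ _ h).2
    have hLsymm : Symm (CMC.lifted p T).adj := by
      intro u v
      rw [Bool.eq_iff_iff, hL, hL, hT.symm, samePair_comm u v, samePair_comm u v,
        samePair_comm u v]
    have e1 : (CMC.lifted p T).adj p.v₁ p.v₂ = true := by
      rw [hL, samePair_iff, samePair_iff]; tauto
    have e2 : (CMC.lifted p T).adj p.v₂ p.v₃ = true := by
      rw [hL, samePair_iff, samePair_iff]; tauto
    refine ⟨⟨fun v hv => ?_, hLsymm, fun u v huv => ?_, fun u v huv => ?_, ?_⟩, ?_⟩
    · rcases (hLv v).1 hv with hv | rfl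
      · exact (hvert v hv).1
      · exact (hgv _ _ hp.adj₁₂).2
    · rcases (hL u v).1 huv with ⟨huv, hs⟩ | hs | hs
      · exact hadj u v huv hs
      · rcases samePair_iff.1 hs with ⟨rfl, rfl⟩ | ⟨rfl, rfl⟩
        · exact hp.adj₁₂
        · rw [hg.symm]; exact hp.adj₁₂
      · rcases samePair_iff.1 hs with ⟨rfl, rfl⟩ | ⟨rfl, rfl⟩
        · exact hp.adj₂₃
        · rw [hg.symm]; exact hp.adj₂₃
    · rw [hLv]
      rcases (hL u v).1 huv with ⟨huv, hs⟩ | hs | hs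
      · exact Or.inl (hmem u v huv).1
      · rcases samePair_iff.1 hs with ⟨rfl, rfl⟩ | ⟨rfl, rfl⟩
        · exact Or.inl hv1
        · exact Or.inr rfl
      · rcases samePair_iff.1 hs with ⟨rfl, rfl⟩ | ⟨rfl, rfl⟩
        · exact Or.inr rfl
        · exact Or.inl hv3
    · have l1 := (hLv p.v₁).2 (Or.inl hv1)
      have l2 := (hLv p.v₂).2 (Or.inr rfl)
      have l3 := (hLv p.v₃).2 (Or.inl hv3)
      refine conn_of_root hLsymm l1 fun P hP1 hP v hv => ?_
      have hP2 : P p.v₂ := hP _ _ l1 l2 hP1 e1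
      have hP3 : P p.v₃ := hP _ _ l2 l3 hP2 e2
      rcases (hLv v).1 hv with hv | rfl
      · refine hT.conn.2 P ⟨p.v₁, hv1, hP1⟩ (fun u w hu hw hPu huw => ?_) v hv
        by_cases hs : samePair u w p.v₁ p.v₃ = true
        · rcases samePair_iff.1 hs with ⟨rfl, rfl⟩ | ⟨rfl, rfl⟩ <;> assumption
        · exact hP u w ((hLv u).2 (Or.inl hu)) ((hLv w).2 (Or.inl hw)) hPu
            ((hL u w).2 (Or.inl ⟨huw, by simpa using hs⟩))
      · exact hP2
    · have hnv2 : T.vert p.v₂ = false := by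
        by_contra hv
        exact (hvert p.v₂ (by simpa using hv)).2 rfl
      have hnadj : ∀ u, T.adj p.v₂ u = false := fun u => by
        by_contra hv
        have := (hmem p.v₂ u (by simpa using hv)).1
        simp [hnv2] at this
      have hnadj' : ∀ u, T.adj u p.v₂ = false := fun u => by rw [hT.symm]; exact hnadj u
      have hE : eraseEdge (eraseEdge (CMC.lifted p T).adj p.v₁ p.v₂) p.v₂ p.v₃ =
          eraseEdge T.adj p.v₁ p.v₃ := by
        funext u v
        rw [Bool.eq_iff_iff]
        simp only [eraseEdge, Bool.and_eq_true, hL, Bool.not_eq_true', ← Bool.not_eq_true,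
          samePair_iff]
        grind
      have e2' : eraseEdge (CMC.lifted p T).adj p.v₁ p.v₂ p.v₂ p.v₃ = true := by
        have : samePair p.v₂ p.v₃ p.v₁ p.v₂ = false := by
          rw [← Bool.not_eq_true, samePair_iff]; grind
        simp [eraseEdge, e2, this]
      have hdeg : ∀ v, v ≠ p.v₂ → deg (CMC.lifted p T).adj v = deg T.adj v := by
        intro v hv
        have d1 := deg_eraseEdge hLsymm e1 h12 v
        have d2 := deg_eraseEdge (hLsymm.eraseEdge _ _) e2' h23 v
        have d3 := deg_eraseEdge hT.symm h h13 v
        rw [hE] at d2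
        by_cases hv1 : v = p.v₁ <;> by_cases hv3 : v = p.v₃ <;> simp_all
      have hdeg2 : 2 ≤ deg (CMC.lifted p T).adj p.v₂ := by
        have d1 := deg_eraseEdge hLsymm e1 h12 p.v₂
        have d2 := deg_eraseEdge (hLsymm.eraseEdge _ _) e2' h23 p.v₂
        simp at d1 d2
        omega
      funext v
      rw [Bool.eq_iff_iff]
      simp only [leafSet, Bool.and_eq_true, decide_eq_true_eq, hLv]
      by_cases hv : v = p.v₂
      · subst hv
        simp only [hnv2]
        constructor
        · rintro ⟨-, h⟩; omega
        · rintro ⟨h, -⟩; simp at h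
      · simp [hv, hdeg v hv]

end Lift

/-! ### The trees of the peeling -/

/-- The graph computed by `deleteSet`. -/
def deleted (g : BGraph n) (L : VSet n) : BGraph n where
  vert := fun v => g.vert v && !L v
  adj := fun u v => g.adj u v && !L u && !L v
  one := fun u v => g.one u v && !L u && !L v

lemma Good.deleted {g : BGraph n} (hg : Good g) {T : Tree n} (hT : SpanTree g T)
    (hne : ∃ v, (deleted g (leafSet T)).vert v = true) : Good (deleted g (leafSet T)) := by
  refine ⟨fun u v => ?_, fun v => ?_, fun u v h => ?_, fun u v h => ?_, fun u v => ?_, ?_⟩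
  · simp only [CMC.deleted]; rw [hg.symm u v, Bool.and_right_comm]
  · simp [CMC.deleted, hg.irrefl]
  · simp only [CMC.deleted, Bool.and_eq_true] at h ⊢
    exact ⟨hg.mem u v h.1.1, h.1.2⟩
  · simp only [CMC.deleted, Bool.and_eq_true] at h ⊢
    exact ⟨⟨hg.one_adj u v h.1.1, h.1.2⟩, h.2⟩
  · simp only [CMC.deleted]; rw [hg.one_symm u v, Bool.and_right_comm]
  · refine (conn_remove_leaves (L := leafSet T) hT.symm hT.conn (fun v hv => ?_) (fun _ => rfl)
      hne).mono fun u v hu hv huv => ?_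
    · simp only [leafSet, Bool.and_eq_true, decide_eq_true_eq] at hv
      exact hv.2
    · simp only [CMC.deleted, Bool.and_eq_true] at hu hv ⊢
      exact ⟨⟨hT.sub u v huv, hu.2⟩, hv.2⟩

/-- `v` is a leaf of none of the trees. -/
def uncovered (Ts : List (Tree n)) : VSet n := fun v => Ts.all fun T => !leafSet T v

lemma peel_val_of_empty {g : BGraph n} (h : ¬ ∃ v, g.vert v = true) (k : ℕ) :
    (peel k g).val = [] := by
  cases k with
  | zero => rfl
  | succ k =>
    simp only [peel, bind_val, anyT_val, op_val, decide_eq_true_eq, h, if_false]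

lemma peel_val_thin {g : BGraph n} (hne : ∃ v, g.vert v = true) {p : Quad n}
    (h : (findThinPath g).val = some p) (k : ℕ) :
    (peel (k + 1) g).val = (peel k (shrunk g p)).val.map (lifted p) := by
  simp only [peel, bind_val, anyT_val, op_val, decide_eq_true_eq, hne, if_true, h, mapT_val]
  rfl

lemma peel_val_leafy {g : BGraph n} (hne : ∃ v, g.vert v = true)
    (h : (findThinPath g).val = none) (k : ℕ) :
    (peel (k + 1) g).val = (leafyTree g).val ::
      (peel k (deleted g (leafSet (leafyTree g).val))).val := by
  simp only [peel, bind_val, anyT_val, op_val, decide_eq_true_eq, hne, if_true, h, leaves_val]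
  rfl

lemma card_deleted {g : BGraph n} {T : Tree n} (hT : SpanTree g T) :
    card g.vert = card (deleted g (leafSet T)).vert + card (leafSet T) := by
  unfold card
  rw [← Finset.card_union_of_disjoint]
  · congr 1
    ext v
    have : leafSet T v = true → g.vert v = true := by
      simp only [leafSet, Bool.and_eq_true, hT.vert]
      exact fun h => h.1
    simp only [deleted, Finset.mem_filter, Finset.mem_univ, true_and, Finset.mem_union,
      Bool.and_eq_true, Bool.not_eq_true']
    grind
  · rw [Finset.disjoint_filter]
    intro v _ h1 h2
    simp [deleted, h2] at h1

/-- Rounds that produce a tree keep at most 51/52 of the vertices; the extra factor 52/51 pays for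
the final tree. The last inequality counts adjacencies between vertices that are never leaves. Each
shrinking adds one such vertex, of degree two at that moment, hence at most four ordered pairs. -/
lemma peel_spec (k : ℕ) {g : BGraph n} (hg : Good g) (hk : card g.vert ≤ k) :
    let Ts := (peel k g).val
    (∀ T ∈ Ts, SubTree g T) ∧ (52 / 51 : ℝ) ^ Ts.length ≤ 52 / 51 * card g.vert ∧
      entrySum g.adj (fun u v => (uncovered Ts u && uncovered Ts v).toNat) ≤
        4 * card fun v => g.vert v && uncovered Ts v := by
  induction k generalizing g with
  | zero =>
    have := card_pos_iff.2 hg.conn.1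
    omega
  | succ k ih =>
    have hne := hg.conn.1
    intro Ts
    rcases ho : (findThinPath g).val with _ | p
    · have hthin := findThinPath_eq_none ho
      obtain ⟨hT, hopt⟩ := spanTree_leafyTree hg
      set T := (leafyTree g).val with hTdef
      set g' := deleted g (leafSet T) with hg'
      have hTs : Ts = T :: (peel k g').val := peel_val_leafy hne ho k
      have hleaf := card_le_leafSet hg hthin hT hopt
      have hcard := card_deleted hT
      have hpos := card_pos_iff.2 hne
      rw [← hg'] at hcard
      have hunc : ∀ v, uncovered Ts v = (!leafSet T v && uncovered (peel k g').val v) :=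
        fun v => by rw [hTs]; rfl
      have hEle : entrySum g.adj (fun u v => (uncovered Ts u && uncovered Ts v).toNat) ≤
          entrySum g'.adj fun u v =>
            (uncovered (peel k g').val u && uncovered (peel k g').val v).toNat := by
        refine (entrySum_mono_mat (O' := g'.adj) fun u v h0 huv => ?_).trans
          (entrySum_mono fun u v _ => ?_)
        · rw [hunc, hunc] at h0
          simp only [hg', deleted, huv]
          revert h0
          cases leafSet T u <;> cases leafSet T v <;> simp
        · rw [hunc, hunc]
          cases leafSet T u <;> cases leafSet T v <;> simp
      by_cases hne' : ∃ v, g'.vert v = true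
      · obtain ⟨i1, i2, i3⟩ := ih (hg.deleted hT hne') (by rw [← hg']; omega)
        rw [← hg'] at i1 i2 i3
        refine ⟨?_, ?_, ?_⟩
        · rw [hTs]
          intro T' hT'
          rcases List.mem_cons.1 hT' with rfl | hT'
          · exact hT.subTree hg
          · have := i1 T' hT'
            refine ⟨fun v hv => ?_, this.symm, fun u v huv => ?_, this.mem, this.conn⟩
            · have := this.vert v hv
              simp only [hg', deleted, Bool.and_eq_true] at this
              exact this.1
            · have := this.sub u v huv
              simp only [hg', deleted, Bool.and_eq_true] at this
              exact this.1.1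
        · rw [hTs, List.length_cons, pow_succ']
          have : (52 * card g'.vert : ℝ) ≤ 51 * card g.vert := by
            exact_mod_cast (by omega : 52 * card g'.vert ≤ 51 * card g.vert)
          refine mul_le_mul_of_nonneg_left (i2.trans ?_) (by norm_num)
          linarith
        · refine hEle.trans (i3.trans (Nat.mul_le_mul_left 4 ?_))
          refine Finset.card_le_card fun v => ?_
          simp only [Finset.mem_filter, Finset.mem_univ, true_and, hunc]
          simp only [hg', deleted]
          grind
      · have hTs' : (peel k g').val = [] := peel_val_of_empty hne' k
        refine ⟨?_, ?_, ?_⟩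
        · rw [hTs, hTs']
          intro T' hT'
          rw [List.mem_singleton.1 hT']
          exact hT.subTree hg
        · rw [hTs, hTs']
          have : (1 : ℝ) ≤ card g.vert := by exact_mod_cast hpos
          simp only [List.length_cons, List.length_nil, zero_add, pow_one]
          linarith
        · refine hEle.trans (le_trans ?_ (Nat.zero_le _))
          refine le_of_eq (Finset.sum_eq_zero fun u _ => Finset.sum_eq_zero fun v _ => ?_)
          rw [if_neg]
          intro huv
          refine hne' ⟨u, ?_⟩
          simp only [hg', deleted, Bool.and_eq_true] at huv ⊢
          exact ⟨hg.mem u v huv.1.1, huv.1.2⟩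
    · have hp := findThinPath_eq_some ho
      have hv2 : g.vert p.v₂ = true := hg.mem _ _ hp.adj₂₃
      have hcard : card g.vert = card (shrunk g p).vert + 1 := card_remove hv2 fun _ => rfl
      obtain ⟨i1, i2, i3⟩ := ih (hg.shrunk hp) (by omega)
      have hTs : Ts = (peel k (shrunk g p)).val.map (lifted p) := peel_val_thin hne ho k
      set Ts' := (peel k (shrunk g p)).val with hTs'
      have hunc : uncovered Ts = uncovered Ts' := by
        funext v
        rw [Bool.eq_iff_iff]
        simp only [uncovered, hTs, List.all_map, List.all_eq_true, Function.comp]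
        refine forall₂_congr fun T hT => ?_
        rw [((i1 T hT).lifted hg hp).2]
      have hv2u : uncovered Ts' p.v₂ = true := by
        simp only [uncovered, List.all_eq_true, Bool.not_eq_true']
        intro T hT
        by_contra h
        simp only [Bool.not_eq_false, leafSet, Bool.and_eq_true] at h
        have := (i1 T hT).vert _ h.1
        simp [shrunk] at this
      refine ⟨?_, ?_, ?_⟩
      · rw [hTs]
        intro T hT
        obtain ⟨T', hT', rfl⟩ := List.mem_map.1 hT
        exact ((i1 T' hT').lifted hg hp).1
      · rw [hTs, List.length_map, hcard]
        push_cast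
        linarith
      · rw [hunc]
        have hc : (card fun v => g.vert v && uncovered Ts' v) =
            (card fun v => (shrunk g p).vert v && uncovered Ts' v) + 1 :=
          card_remove (z := p.v₂) (by simp [hv2, hv2u]) fun v => by
            simp only [shrunk]; rw [Bool.and_right_comm]
        rw [hc, mul_add]
        -- The pairs are split into those avoiding `v₂`, which survive in the shrunk graph, and the
        -- two in its row and two in its column. The constant 4 per uncovered vertex pays for the
        -- latter.
        let f : Fin n → Fin n → ℕ := fun u v => (uncovered Ts' u && uncovered Ts' v).toNat
        have h1 : entrySum g.adj f ≤ entrySum g.adj (fun u v =>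
            ((f u v * (decide (u ≠ p.v₂) && decide (v ≠ p.v₂)).toNat) +
              (decide (u = p.v₂)).toNat) + (decide (v = p.v₂)).toNat) := by
          refine entrySum_mono fun u v _ => ?_
          have : f u v ≤ 1 := by simp only [f]; exact Bool.toNat_le _
          by_cases hu : u = p.v₂ <;> by_cases hv : v = p.v₂ <;> simp [hu, hv] <;> grind
        have h2 : entrySum g.adj (fun u _ => (decide (u = p.v₂)).toNat) = 2 := by
          rw [entrySum_row, Finset.sum_eq_single p.v₂]
          · simp [hp.deg₂]
          · intro u _ hu; simp [hu]
          · simp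
        have h3 : entrySum g.adj (fun _ v => (decide (v = p.v₂)).toNat) = 2 := by
          rw [entrySum_swap hg.symm fun u _ => (decide (u = p.v₂)).toNat]; exact h2
        rw [entrySum_add, entrySum_add, h2, h3] at h1
        have h4 : entrySum g.adj
            (fun u v => f u v * (decide (u ≠ p.v₂) && decide (v ≠ p.v₂)).toNat) ≤
            entrySum (shrunk g p).adj f := by
          refine (entrySum_mono_mat (O' := (shrunk g p).adj) fun u v h0 huv => ?_).trans
            (entrySum_mono fun u v _ => ?_)
          · rw [shrunk_adj_iff]
            left
            by_cases hu : u = p.v₂ <;> by_cases hv : v = p.v₂ <;> simp_all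
          · exact (Nat.mul_le_mul_left _ (Bool.toNat_le _)).trans (mul_one _).le
        change entrySum g.adj f ≤ _
        have i3' : entrySum (shrunk g p).adj f ≤ _ := i3
        omega

end Basic

end CMC

namespace CMC

open Timed

section Basic

variable {n : ℕ}

/-! ### Reduced graphs -/

/-- The number of `1`-edges, as computed by the algorithm. -/
def numOnes (O : Mat n) : ℕ := ∑ u, ∑ v, if (decide (u < v) && O u v) = true then 1 else 0

lemma two_mul_numOnes {g : BGraph n} (hg : Good g) :
    2 * numOnes g.one = entrySum g.one fun _ _ => 1 := by
  have h1 : numOnes g.one = entrySum g.one fun u v => (decide (u < v)).toNat := by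
    refine Finset.sum_congr rfl fun u _ => Finset.sum_congr rfl fun v _ => ?_
    beta_reduce
    cases g.one u v <;> simp [Bool.toNat]
  rw [two_mul, h1]
  nth_rewrite 2 [← entrySum_swap hg.one_symm]
  rw [← entrySum_add]
  refine le_antisymm (entrySum_mono fun u v huv => ?_) (entrySum_mono fun u v huv => ?_) <;>
  · have hne := hg.ne (hg.one_adj u v huv)
    rcases lt_or_gt_of_ne hne with h | h <;> simp [h, not_lt.2 h.le]

lemma cutN_le_numOnes {g : BGraph n} (hg : Good g) (X : VSet n) :
    cutN g.one X ≤ numOnes g.one := by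
  have h1 := two_mul_numOnes hg
  have h2 := two_mul_cutN hg.one_symm X
  have h3 : entrySum g.one (fun u v => (X u != X v).toNat) ≤ entrySum g.one fun _ _ => 1 :=
    entrySum_mono fun u v _ => Bool.toNat_le _
  omega

/-- Every covered vertex is a leaf of at least one tree and contributes its `1`-edges to the
thickness there. -/
lemma sum_thick_ge (g : BGraph n) (Ts : List (Tree n)) :
    (∑ v, (!uncovered Ts v).toNat * deg g.one v) ≤ (Ts.map (thick g)).sum := by
  induction Ts with
  | nil => simp [uncovered]
  | cons T Ts ih =>
    rw [List.map_cons, List.sum_cons]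
    refine le_trans ?_ (Nat.add_le_add_left ih _)
    rw [thick, ← Finset.sum_add_distrib]
    refine Finset.sum_le_sum fun v _ => ?_
    rw [show uncovered (T :: Ts) v = (!leafSet T v && uncovered Ts v) from rfl]
    cases leafSet T v <;> cases uncovered Ts v <;> simp

/-- A `1`-edge with a covered end is counted in some thickness. The edges with both ends uncovered
give at most `4N` ordered pairs, that is, `2N` edges. -/
lemma numOnes_le {g : BGraph n} (hg : Good g) {k : ℕ} (hk : card g.vert ≤ k) :
    numOnes g.one ≤ 2 * card g.vert + ((peel k g).val.map (thick g)).sum := by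
  obtain ⟨-, -, h⟩ := peel_spec k hg hk
  set Ts := (peel k g).val
  have h1 : entrySum g.one (fun u v => (uncovered Ts u && uncovered Ts v).toNat) ≤
      4 * card g.vert := by
    refine (entrySum_mono_mat fun u v _ => hg.one_adj u v).trans (h.trans ?_)
    refine Nat.mul_le_mul_left 4 (Finset.card_le_card fun v => ?_)
    simp only [Finset.mem_filter, Finset.mem_univ, true_and, Bool.and_eq_true]
    exact fun h => h.1
  have h2 : entrySum g.one (fun _ _ => 1) ≤ entrySum g.one (fun u v =>
      ((uncovered Ts u && uncovered Ts v).toNat + (!uncovered Ts u).toNat) +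
        (!uncovered Ts v).toNat) := by
    refine entrySum_mono fun u v _ => ?_
    cases uncovered Ts u <;> cases uncovered Ts v <;> decide
  rw [entrySum_add, entrySum_add,
    entrySum_swap hg.one_symm fun u _ => (!uncovered Ts u).toNat,
    entrySum_row _ fun u => (!uncovered Ts u).toNat] at h2
  have h3 := sum_thick_ge g Ts
  have h4 := two_mul_numOnes hg
  omega

lemma length_peel_le {g : BGraph n} (hg : Good g) {k : ℕ} (hk : card g.vert ≤ k) :
    ((peel k g).val.length : ℝ) ≤ 1 + 52 * Real.log (card g.vert) := by
  obtain ⟨-, h, -⟩ := peel_spec k hg hk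
  have hpos : (0 : ℝ) < card g.vert := by exact_mod_cast card_pos_iff.2 hg.conn.1
  have hlog := Real.log_le_log (by positivity) h
  rw [Real.log_pow, Real.log_mul (by norm_num) hpos.ne'] at hlog
  -- From `log x ≤ x - 1` at `x = 51/52`. This turns the geometric bound of `peel_spec` into a bound
  -- linear in `log N`.
  have hb : (1 / 52 : ℝ) ≤ Real.log (52 / 51) := by
    have := Real.log_le_sub_one_of_pos (x := 51 / 52) (by norm_num)
    rw [show (51 / 52 : ℝ) = (52 / 51)⁻¹ by norm_num, Real.log_inv] at this
    linarith
  set L := Real.log (52 / 51) with hL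
  have hlogN : 0 ≤ Real.log (card g.vert) := Real.log_nonneg (by
    exact_mod_cast card_pos_iff.2 hg.conn.1)
  by_contra hcon
  push Not at hcon
  nlinarith

lemma foldl_max_spec {α β : Type*} [LinearOrder β] (f : α → β) (F : α → α → α)
    (hF : ∀ a b, (f a < f b ∧ F a b = b) ∨ (f b ≤ f a ∧ F a b = a)) (l : List α) (a : α) :
    l.foldl F a ∈ a :: l ∧ ∀ b ∈ a :: l, f b ≤ f (l.foldl F a) := by
  induction l generalizing a with
  | nil => simp
  | cons b l ih =>
    rw [List.foldl_cons]
    rcases hF a b with ⟨hlt, he⟩ | ⟨hle, he⟩ <;> rw [he]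
    · obtain ⟨h1, h2⟩ := ih b
      have := h2 b List.mem_cons_self
      refine ⟨List.mem_cons_of_mem _ h1, fun c hc => ?_⟩
      rcases List.mem_cons.1 hc with rfl | hc
      · exact hlt.le.trans this
      · exact h2 c hc
    · obtain ⟨h1, h2⟩ := ih a
      have := h2 a List.mem_cons_self
      refine ⟨?_, fun c hc => ?_⟩
      · rcases List.mem_cons.1 h1 with h | h
        · rw [h]; exact List.mem_cons_self
        · exact List.mem_cons_of_mem _ (List.mem_cons_of_mem _ h)
      · rcases List.mem_cons.1 hc with rfl | hc
        · exact this
        · rcases List.mem_cons.1 hc with rfl | hc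
          · exact hle.trans this
          · exact h2 c (List.mem_cons_of_mem _ hc)

/-- The thickest tree. -/
def thickest (g : BGraph n) (T : Tree n) (Ts : List (Tree n)) : Tree n :=
  Ts.foldl (fun B T => if thick g B < thick g T then T else B) T

lemma thickest_spec (g : BGraph n) (T : Tree n) (Ts : List (Tree n)) :
    thickest g T Ts ∈ T :: Ts ∧ ∀ T' ∈ T :: Ts, thick g T' ≤ thick g (thickest g T Ts) :=
  foldl_max_spec (thick g) _ (fun B T => by split_ifs <;> simp_all) Ts T

lemma thickSolve_val (g : BGraph n) : (thickSolve g).val =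
    if numOnes g.one ≤ 4 * card g.vert * Nat.log 2 (card g.vert) then
      (treeCut g (leafyTree g).val).val
    else (treeCut g (thickest g (leafyTree g).val (peel n g).val)).val := by
  have hN : (∑ v, if g.vert v = true then 1 else 0 : ℕ) = card g.vert := by simp [card]
  simp only [thickSolve, bind_val]
  rw [apply_ite Timed.val]
  simp only [bind_val, foldT_val, thickness_val, op_val, sumT_val, logT, hN]
  rfl

lemma card_le_univ (X : VSet n) : card X ≤ n := (Finset.card_le_univ _).trans (by simp)

/-- The comparison is with all `1`-edges, so no optimal set enters. With few `1`-edges the number of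
leaves of the first tree suffices; with many, an average over the peeled trees does. -/
lemma thickSolve_spec {g : BGraph n} (hg : Good g) (hthin : ∀ p, ¬ Thin g p)
    (hone : ∀ v, g.vert v = true → 1 ≤ deg g.one v) :
    (∀ v, (thickSolve g).val v = true → g.vert v = true) ∧ Conn g.adj (thickSolve g).val ∧
      (numOnes g.one : ℝ) ≤ 1664 * (1 + Real.log n) * cutN g.one (thickSolve g).val := by
  obtain ⟨hT, hopt⟩ := spanTree_leafyTree hg
  have hsub := hT.subTree hg
  have hleaf := card_le_leafSet hg hthin hT hopt
  set T := (leafyTree g).val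
  set N := card g.vert with hN
  have hN2 : 2 ≤ N := by
    obtain ⟨v, hv⟩ := hg.conn.1
    obtain ⟨u, hu⟩ := Finset.card_pos.1 (hone v hv)
    simp only [Finset.mem_filter, Finset.mem_univ, true_and] at hu
    have huv := hg.one_adj v u hu
    refine le_trans (Finset.card_pair (hg.ne huv)).ge (Finset.card_le_card ?_)
    have hu' : g.vert u = true := hg.mem u v (by rw [hg.symm]; exact huv)
    intro w
    simp only [Finset.mem_insert, Finset.mem_singleton, Finset.mem_filter, Finset.mem_univ,
      true_and]
    rintro (rfl | rfl) <;> assumption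
  have hNn : N ≤ n := card_le_univ _
  have hlogN : Real.log N ≤ Real.log n :=
    Real.log_le_log (by positivity) (by exact_mod_cast hNn)
  have hlogN0 : 0 ≤ Real.log N := Real.log_nonneg (by exact_mod_cast (by omega : 1 ≤ N))
  rw [thickSolve_val]
  split_ifs with hη
  · obtain ⟨h1, h2, h3⟩ := treeCut_spec hg hsub
    refine ⟨h1, h2, ?_⟩
    have hthick : card (leafSet T) ≤ thick g T := by
      unfold card thick
      rw [Finset.card_filter]
      refine Finset.sum_le_sum fun v _ => ?_
      split_ifs with hv
      · exact hone v (hsub.vert v (by simp only [leafSet, Bool.and_eq_true] at hv; exact hv.1))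
      · exact le_rfl
    set κ := cutN g.one (treeCut g T).val
    -- `208 = 52 · 4`: vertices to leaves, each leaf having a `1`-edge, then thickness to cut. With
    -- `log₂ N ≤ 2 log N` and the threshold factor 4 this gives `1664 = 4 · 208 · 2`.
    have hNκ : N ≤ 208 * κ := by omega
    have hlog2 : (Nat.log 2 N : ℝ) ≤ 2 * Real.log N := by
      have h := Nat.pow_log_le_self 2 (by omega : N ≠ 0)
      have h' : ((2 : ℝ) ^ Nat.log 2 N) ≤ N := by exact_mod_cast h
      have := Real.log_le_log (by positivity) h'
      rw [Real.log_pow] at this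
      have l2 := Real.log_two_gt_d9
      have : (0 : ℝ) ≤ Nat.log 2 N := by positivity
      nlinarith
    have hη' : (numOnes g.one : ℝ) ≤ 4 * N * Nat.log 2 N := by exact_mod_cast hη
    have hNκ' : (N : ℝ) ≤ 208 * κ := by exact_mod_cast hNκ
    calc (numOnes g.one : ℝ) ≤ 4 * N * Nat.log 2 N := hη'
      _ ≤ 4 * (208 * κ) * (2 * Real.log N) := by gcongr
      _ = 1664 * Real.log N * κ := by ring
      _ ≤ 1664 * (1 + Real.log n) * κ := by gcongr; linarith
  · push Not at hη
    obtain ⟨hp, -, -⟩ := peel_spec n hg hNn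
    have hlen := length_peel_le hg hNn
    have hnum := numOnes_le hg hNn
    set Ts := (peel n g).val
    obtain ⟨hmem, hmax⟩ := thickest_spec g T Ts
    have hsub' : SubTree g (thickest g T Ts) := by
      rcases List.mem_cons.1 hmem with h | h
      · rw [h]; exact hsub
      · exact hp _ h
    obtain ⟨h1, h2, h3⟩ := treeCut_spec hg hsub'
    refine ⟨h1, h2, ?_⟩
    set κ := cutN g.one (treeCut g (thickest g T Ts)).val
    have hsum : (Ts.map (thick g)).sum ≤ Ts.length * (4 * κ) := by
      have := List.sum_le_card_nsmul (Ts.map (thick g)) (4 * κ) (by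
        intro x hx
        obtain ⟨T', hT', rfl⟩ := List.mem_map.1 hx
        exact (hmax T' (List.mem_cons_of_mem _ hT')).trans h3)
      simpa using this
    -- Since `N ≥ 2`, the threshold is at least `4N`, so the `2N` edges missed by all leaf sets are
    -- fewer than half of the `1`-edges.
    have hlog1 : 1 ≤ Nat.log 2 N := Nat.log_pos (by norm_num) hN2
    have h4N : 4 * N < numOnes g.one :=
      lt_of_le_of_lt (Nat.le_mul_of_pos_right _ hlog1) hη
    have hfin : numOnes g.one ≤ 8 * (Ts.length * κ) := by
      have : Ts.length * (4 * κ) = 4 * (Ts.length * κ) := by ring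
      omega
    calc (numOnes g.one : ℝ) ≤ 8 * (Ts.length * κ) := by exact_mod_cast hfin
      _ ≤ 8 * ((1 + 52 * Real.log N) * κ) := by gcongr
      _ = (8 + 416 * Real.log N) * κ := by ring
      _ ≤ 1664 * (1 + Real.log n) * κ := by gcongr; linarith

/-! ### The algorithm for `{0,1}`-weights -/

lemma bcmc_val_elim {g : BGraph n} {z : Fin n} (h : (findZeroVertex g).val = some z) (k : ℕ) :
    (bcmc (k + 1) g).val =
      if (isConn g.adj (bcmc k (elim g z)).val).val = true then (bcmc k (elim g z)).val
      else fun u => (bcmc k (elim g z)).val u || decide (u = z) := by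
  simp only [bcmc, bind_val, h]
  rw [apply_ite Timed.val]
  rfl

lemma bcmc_val_shrink {g : BGraph n} {p : Quad n} (h : (findZeroVertex g).val = none)
    (h' : (findThinPath g).val = some p) (k : ℕ) :
    (bcmc (k + 1) g).val = (recover g p (bcmc k (shrunk g p)).val).val := by
  simp only [bcmc, bind_val, h, h']
  rfl

lemma bcmc_val_thick {g : BGraph n} (h : (findZeroVertex g).val = none)
    (h' : (findThinPath g).val = none) (k : ℕ) :
    (bcmc (k + 1) g).val = (thickSolve g).val := by
  simp only [bcmc, bind_val, h, h']

lemma findZeroVertex_eq_some {g : BGraph n} {z : Fin n} (h : (findZeroVertex g).val = some z) :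
    g.vert z = true ∧ deg g.one z = 0 := by
  obtain ⟨v, hv⟩ := exists_of_firstT_val_eq_some h
  simp only [bind_val, degree_val, op_val, Option.ite_none_right_eq_some, Bool.and_eq_true,
    decide_eq_true_eq, Option.some.injEq] at hv
  obtain ⟨hv, rfl⟩ := hv
  exact hv

lemma findZeroVertex_eq_none {g : BGraph n} (h : (findZeroVertex g).val = none) (v : Fin n)
    (hv : g.vert v = true) : 1 ≤ deg g.one v := by
  have := firstT_val_eq_none.1 h v
  simp only [bind_val, degree_val, op_val, hv, Bool.true_and, decide_eq_true_eq,
    ite_eq_right_iff, reduceCtorEq, imp_false] at this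
  omega

lemma recover_spec {g : BGraph n} (hg : Good g) {p : Quad n} (hp : Thin g p) {S : VSet n}
    (hS : Conn (shrunk g p).adj S) (hS2 : S p.v₂ = false) :
    (∃ x₁ x₂, (recover g p S).val = pat p S x₁ x₂) ∧ Conn g.adj (recover g p S).val ∧
      cutN (shrunk g p).one S ≤ cutN g.one (recover g p S).val := by
  have h12 := hp.ne₁₂ hg
  have hpat : ∀ x₁ x₂, pat p S x₁ x₂ ∈
      [pat p S false false, pat p S true false, pat p S false true, pat p S true true] := by
    intro x₁ x₂
    cases x₁ <;> cases x₂ <;> simp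
  have hv : (recover g p S).val = (chooseBest g
      [pat p S false false, pat p S true false, pat p S false true, pat p S true true]).val := by
    simp only [recover, bind_val, table_val, op_val]
    congr 2
    congr 1
    · funext v; simp only [pat]; split_ifs <;> simp_all
    congr 1
    · funext v; simp only [pat]; split_ifs <;> simp_all
    congr 1
    · funext v; simp only [pat]; split_ifs <;> simp_all
    congr 1
    · funext v; simp only [pat]; split_ifs <;> simp_all
  -- `v₂` is not a vertex of the shrunk graph, so `S` is itself a pattern with the value `false`
  -- there.
  have hSp : pat p S (S p.v₁) false = S := by
    funext v
    simp only [pat]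
    split_ifs with h h'
    · rw [h]
    · rw [h', hS2]
    · rfl
  rw [← hSp] at hS
  obtain ⟨x₁, x₂, hc, hcut⟩ := exists_pat_of_shrunk hg hp S _ hS
  rw [hSp] at hcut
  obtain ⟨hm, hconn, hbest⟩ := chooseBest_spec hg.symm ⟨_, hpat x₁ x₂, hc⟩
  rw [hv]
  refine ⟨?_, hconn, hcut.trans (hbest _ (hpat x₁ x₂) hc)⟩
  simp only [List.mem_cons, List.not_mem_nil, or_false] at hm
  rcases hm with h | h | h | h <;> exact ⟨_, _, h⟩

/-- Both reductions transfer solutions in both directions without loss, so the factor of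
`thickSolve_spec` passes unchanged through the induction. It is stated with the fixed `n` rather
than the current number of vertices. -/
theorem bcmc_spec (k : ℕ) {g : BGraph n} (hg : Good g) (hk : card g.vert = k) :
    let S := (bcmc k g).val
    (∀ v, S v = true → g.vert v = true) ∧ Conn g.adj S ∧
      ∀ X : VSet n, (∀ v, X v = true → g.vert v = true) → Conn g.adj X →
        (cutN g.one X : ℝ) ≤ 1664 * (1 + Real.log n) * cutN g.one S := by
  have hC : 0 ≤ 1664 * (1 + Real.log n) := by
    have : 0 ≤ Real.log n := Real.log_natCast_nonneg n
    positivity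
  induction k generalizing g with
  | zero =>
    have := card_pos_iff.2 hg.conn.1
    omega
  | succ k ih =>
    intro S
    rcases hz : (findZeroVertex g).val with _ | z
    · rcases ho : (findThinPath g).val with _ | p
      · have hS : S = (thickSolve g).val := bcmc_val_thick hz ho k
        obtain ⟨h1, h2, h3⟩ := thickSolve_spec hg (findThinPath_eq_none ho)
          (findZeroVertex_eq_none hz)
        rw [hS]
        refine ⟨h1, h2, fun X _ _ => le_trans ?_ h3⟩
        exact_mod_cast cutN_le_numOnes hg X
      · have hp := findThinPath_eq_some ho
        have hS : S = (recover g p (bcmc k (shrunk g p)).val).val := bcmc_val_shrink hz ho k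
        have hv2 : g.vert p.v₂ = true := hg.mem _ _ hp.adj₂₃
        have hv1 : g.vert p.v₁ = true := hg.mem _ _ hp.adj₁₂
        have hcard : card g.vert = card (shrunk g p).vert + 1 := card_remove hv2 fun _ => rfl
        obtain ⟨i1, i2, i3⟩ := ih (hg.shrunk hp) (by omega)
        set S' := (bcmc k (shrunk g p)).val
        have hS2 : S' p.v₂ = false := by
          by_contra h
          have := i1 p.v₂ (by simpa using h)
          simp [shrunk] at this
        obtain ⟨⟨x₁, x₂, h1⟩, h2, h3⟩ := recover_spec hg hp i2 hS2
        have h12 := hp.ne₁₂ hg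
        have hvert : ∀ (Y : VSet n) y₁ y₂, (∀ v, v ≠ p.v₁ → v ≠ p.v₂ → Y v = true → g.vert v = true) →
            ∀ v, pat p Y y₁ y₂ v = true → g.vert v = true := by
          intro Y y₁ y₂ hY v
          simp only [pat]
          split_ifs with h h'
          · rw [h]; exact fun _ => hv1
          · rw [h']; exact fun _ => hv2
          · exact hY v h h'
        rw [hS]
        refine ⟨?_, h2, fun X hX hXc => ?_⟩
        · rw [h1]
          refine hvert S' x₁ x₂ fun v _ _ hv => ?_
          have := i1 v hv
          simp only [shrunk, Bool.and_eq_true] at this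
          exact this.1
        · have hXp : pat p X (X p.v₁) (X p.v₂) = X := by
            funext v
            simp only [pat]
            split_ifs with h h'
            · rw [h]
            · rw [h']
            · rfl
          rw [← hXp] at hXc
          obtain ⟨y, hy, hcut⟩ := exists_shrunk_of_pat hg hp X _ _ hXc
          rw [hXp] at hcut
          have := i3 _ (fun v hv => by
            have h := hvert X y false (fun v _ _ => hX v) v hv
            simp only [shrunk, Bool.and_eq_true, decide_eq_true_eq]
            refine ⟨h, ?_⟩
            rintro rfl
            simp [pat, h12.symm] at hv) hy
          calc (cutN g.one X : ℝ) ≤ cutN (shrunk g p).one (pat p X y false) := by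
                exact_mod_cast hcut
            _ ≤ 1664 * (1 + Real.log n) * cutN (shrunk g p).one S' := this
            _ ≤ 1664 * (1 + Real.log n) * cutN g.one (recover g p S').val := by
                gcongr
    · obtain ⟨hzv, hz0⟩ := findZeroVertex_eq_some hz
      obtain ⟨hone, hzone⟩ := elim_one hg hz0
      have hS := bcmc_val_elim hz k
      change S = _ at hS
      have hcard : card g.vert = card (elim g z).vert + 1 := card_remove hzv fun _ => rfl
      have hcut : ∀ X Y : VSet n, (∀ v, v ≠ z → X v = Y v) → cutN g.one X = cutN g.one Y :=
        fun X Y hXY => cutN_congr fun u v huv =>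
          ⟨hXY u (hzone u v huv).1, hXY v (hzone u v huv).2⟩
      set S' := (bcmc k (elim g z)).val with hS'
      have hSS' : ∀ v, v ≠ z → S v = S' v := by
        intro v hv
        rw [hS]
        split_ifs
        · rfl
        · simp [hv]
      by_cases hne : ∃ v, (elim g z).vert v = true
      · obtain ⟨i1, i2, i3⟩ := ih (hg.elim hne) (by omega)
        have hSv : ∀ v, S' v = true → g.vert v = true := fun v hv => by
          have := i1 v hv
          simp only [elim, Bool.and_eq_true] at this
          exact this.1
        refine ⟨fun v hv => ?_, ?_, fun X hX hXc => ?_⟩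
        · by_cases hvz : v = z
          · exact hvz ▸ hzv
          · exact hSv v (by rw [← hSS' v hvz]; exact hv)
        · rw [hS]
          split_ifs with hc
          · exact (isConn_val hg.symm _).1 hc
          · exact conn_of_conn_elim hg i2 fun h => hc ((isConn_val hg.symm _).2 h)
        · rw [hcut S S' hSS']
          let Y : VSet n := fun v => X v && decide (v ≠ z)
          rw [hcut X Y fun v hv => by simp [Y, hv]]
          by_cases hY : ∃ v, Y v = true
          · have := i3 Y (fun v hv => by
              simp only [Y, Bool.and_eq_true] at hv
              simp only [elim, Bool.and_eq_true]
              exact ⟨hX v hv.1, hv.2⟩) (conn_elim hg (fun _ => rfl) hY hXc)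
            rw [hone] at this
            exact this
          · have h0 : cutN g.one Y = 0 := by
              simp only [not_exists, Bool.not_eq_true] at hY
              simp [cutN, hY]
            rw [h0]
            push_cast
            positivity
      · have hk0 : k = 0 := by
          have := mt card_pos_iff.1 hne
          omega
        subst hk0
        have hS'0 : S' = fun _ => false := rfl
        have hSz : ∀ v, S v = true ↔ v = z := by
          intro v
          rw [hS, if_neg]
          · simp [hS'0]
          · rw [isConn_val hg.symm, hS'0]
            exact not_conn_empty _
        have hall : ∀ v, g.vert v = true → v = z := by
          intro v hv
          by_contra hvz
          exact hne ⟨v, by simp [elim, hv, hvz]⟩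
        refine ⟨fun v hv => by rw [(hSz v).1 hv]; exact hzv, conn_singleton hSz,
          fun X hX _ => ?_⟩
        rw [hcut X (fun _ => false) fun v hv => by
          by_contra h
          exact hv (hall v (hX v (by simpa using h)))]
        have h0 : cutN g.one (fun _ => false) = 0 := by simp [cutN]
        rw [h0]
        push_cast
        positivity

end Basic

end CMC

namespace CMC

open Timed

section Weighted

variable {n : ℕ}

/-! ### Weighted cuts -/

/-- The total weight of the entries of `adj` from `X` to its complement. -/
noncomputable def cutW (adj : Mat n) (wt : Fin n → Fin n → ℝ) (X : VSet n) : ℝ :=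
  ∑ u, ∑ v, if (X u && !X v && adj u v) = true then wt u v else 0

@[simp] lemma cutSum_val (adj : Mat n) (wt : Fin n → Fin n → ℝ) (X : VSet n) :
    (cutSum adj wt X).val = cutW adj wt X := rfl

lemma cutW_nonneg {adj : Mat n} {wt : Fin n → Fin n → ℝ}
    (hwt : ∀ u v, adj u v = true → 0 ≤ wt u v) (X : VSet n) : 0 ≤ cutW adj wt X := by
  refine Finset.sum_nonneg fun u _ => Finset.sum_nonneg fun v _ => ?_
  split_ifs with h
  · simp only [Bool.and_eq_true] at h
    exact hwt u v h.2
  · exact le_rfl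

/-- Each cut edge has exactly one orientation from `S` to its complement, which gives a bijection
from ordered pairs to edges. -/
lemma cutWeight_eq_cutW (G : SimpleGraph (Fin n)) (w : Sym2 (Fin n) → ℝ) (S : Set (Fin n))
    {adj : Mat n} {X : VSet n} (hadj : ∀ u v, adj u v = true ↔ G.Adj u v)
    (hX : ∀ v, X v = true ↔ v ∈ S) :
    cutWeight G w S = cutW adj (fun u v => w s(u, v)) X := by
  classical
  unfold cutW cutWeight
  rw [← Finset.sum_product', ← Finset.sum_filter]
  symm
  refine Finset.sum_nbij (fun q => s(q.1, q.2)) ?_ ?_ ?_ fun _ _ => rfl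
  · rintro ⟨u, v⟩ h
    simp only [Finset.mem_filter, Bool.and_eq_true, hX, Bool.not_eq_true',
      ← Bool.not_eq_true, hadj] at h
    rw [Set.mem_toFinset]
    exact ⟨h.2.2, u, h.2.1.1, v, h.2.1.2, rfl⟩
  · rintro ⟨u, v⟩ h ⟨u', v'⟩ h' heq
    simp only [Finset.coe_filter, Set.mem_ofPred_eq, Bool.and_eq_true, hX, Bool.not_eq_true',
      ← Bool.not_eq_true, hadj] at h h'
    rcases Sym2.eq_iff.1 heq with ⟨h1, h2⟩ | ⟨h1, h2⟩
    · exact Prod.ext h1 h2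
    · simp only at h1 h2
      exact absurd (h1 ▸ h.2.1.1) h'.2.1.2
  · intro e he
    rw [Finset.mem_coe, Set.mem_toFinset] at he
    obtain ⟨he, u, hu, v, hv, rfl⟩ := he
    refine ⟨(u, v), ?_, rfl⟩
    simp only [Finset.coe_filter, Set.mem_ofPred_eq, Bool.and_eq_true, hX, Bool.not_eq_true',
      ← Bool.not_eq_true, hadj]
    exact ⟨by simp, ⟨hu, hv⟩, he⟩

lemma maxT_spec (f : Fin n → Timed ℝ) :
    (∀ i, (f i).val ≤ (maxT f).val) ∧ 0 ≤ (maxT f).val ∧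
      ((maxT f).val = 0 ∨ ∃ i, (maxT f).val = (f i).val) := by
  have : ∀ l : List (Fin n), (∀ i ∈ l, (f i).val ≤ l.foldr (fun i a => max (f i).val a) 0) ∧
      0 ≤ l.foldr (fun i a => max (f i).val a) 0 ∧
      (l.foldr (fun i a => max (f i).val a) 0 = 0 ∨
        ∃ i, l.foldr (fun i a => max (f i).val a) 0 = (f i).val) := by
    intro l
    induction l with
    | nil => simp
    | cons i l ih =>
      obtain ⟨h1, h2, h3⟩ := ih
      simp only [List.foldr_cons]
      refine ⟨fun j hj => ?_, le_max_of_le_right h2, ?_⟩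
      · rcases List.mem_cons.1 hj with rfl | hj
        · exact le_max_left _ _
        · exact (h1 j hj).trans (le_max_right _ _)
      · rcases max_choice (f i).val (l.foldr (fun i a => max (f i).val a) 0) with h | h
        · exact Or.inr ⟨i, h⟩
        · rw [h]; exact h3
  obtain ⟨h1, h2, h3⟩ := this (List.finRange n)
  exact ⟨fun i => h1 i (List.mem_finRange i), h2, h3⟩

/-! ### Weight classes -/

open Classical in
/-- The graph in which the edges with weight in `[lo, lo (1 + ε))` are the `1`-edges. -/
noncomputable def classGraph (ε : ℝ) (adj : Mat n) (wt : Fin n → Fin n → ℝ) (lo : ℝ) : BGraph n where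
  vert := fun _ => true
  adj := adj
  one := fun u v => adj u v && decide (lo ≤ wt u v) && decide (wt u v < lo * (1 + ε))

/-- The standing assumptions on a weighted graph. -/
structure GoodWeighted (adj : Mat n) (wt : Fin n → Fin n → ℝ) : Prop where
  symm : Symm adj
  irrefl : ∀ v, adj v v = false
  conn : Conn adj fun _ => true
  wt_symm : ∀ u v, wt u v = wt v u
  wt_nonneg : ∀ u v, adj u v = true → 0 ≤ wt u v

variable {adj : Mat n} {wt : Fin n → Fin n → ℝ}

lemma GoodWeighted.classGraph (h : GoodWeighted adj wt) (ε lo : ℝ) :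
    Good (classGraph ε adj wt lo) := by
  refine ⟨h.symm, h.irrefl, fun _ _ _ => rfl, fun u v huv => ?_, fun u v => ?_, h.conn⟩
  · simp only [CMC.classGraph, Bool.and_eq_true] at huv
    exact huv.1.1
  · simp only [CMC.classGraph]
    rw [h.symm u v, h.wt_symm u v]

lemma GoodWeighted.classSolve_spec (h : GoodWeighted adj wt) (ε w₀ : ℝ) (i : ℕ) :
    Conn adj (classSolve ε adj wt w₀ i).val ∧ ∀ X, Conn adj X →
      (cutN (CMC.classGraph ε adj wt (w₀ * (1 + ε) ^ i)).one X : ℝ) ≤ 1664 * (1 + Real.log n) *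
        cutN (CMC.classGraph ε adj wt (w₀ * (1 + ε) ^ i)).one (classSolve ε adj wt w₀ i).val := by
  obtain ⟨-, h2, h3⟩ := bcmc_spec n (h.classGraph ε (w₀ * (1 + ε) ^ i)) (by
    simp [card, CMC.classGraph])
  exact ⟨h2, fun X hX => h3 X (fun _ _ => rfl) hX⟩

lemma cutN_classGraph_le {ε lo : ℝ} (hwt : ∀ u v, adj u v = true → 0 ≤ wt u v) (X : VSet n) :
    lo * cutN (classGraph ε adj wt lo).one X ≤ cutW adj wt X := by
  unfold cutN cutW
  push_cast
  rw [Finset.mul_sum]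
  refine Finset.sum_le_sum fun u _ => ?_
  rw [Finset.mul_sum]
  refine Finset.sum_le_sum fun v _ => ?_
  by_cases h1 : (X u && !X v && (classGraph ε adj wt lo).one u v) = true
  · rw [if_pos h1]
    simp only [classGraph, Bool.and_eq_true, decide_eq_true_eq] at h1
    rw [if_pos (by simp only [Bool.and_eq_true]; exact ⟨h1.1, h1.2.1.1⟩), mul_one]
    exact h1.2.1.2
  · rw [if_neg h1, mul_zero]
    split_ifs with h2
    · simp only [Bool.and_eq_true] at h2
      exact hwt u v h2.2
    · exact le_rfl

/-- The weight of the heaviest edge, as computed by the algorithm. -/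
noncomputable def maxWeight (adj : Mat n) (wt : Fin n → Fin n → ℝ) : ℝ :=
  (maxT fun u => maxT fun v => op (if adj u v then wt u v else 0)).val

lemma le_maxWeight {u v : Fin n} (h : adj u v = true) : wt u v ≤ maxWeight adj wt := by
  have h1 := (maxT_spec fun u => maxT fun v => op (if adj u v then wt u v else 0)).1 u
  have h2 := (maxT_spec fun v => op (if adj u v then wt u v else 0)).1 v
  simp only [op_val, h, if_true] at h2
  exact h2.trans h1

lemma maxWeight_nonneg : 0 ≤ maxWeight adj wt :=
  (maxT_spec fun u => maxT fun v => op (if adj u v then wt u v else 0)).2.1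

lemma exists_maxWeight (h : 0 < maxWeight adj wt) :
    ∃ u v, adj u v = true ∧ wt u v = maxWeight adj wt := by
  rcases (maxT_spec fun u => maxT fun v => op (if adj u v then wt u v else 0)).2.2
    with h1 | ⟨u, hu⟩
  · exact absurd h1 h.ne'
  · rcases (maxT_spec fun v => op (if adj u v then wt u v else 0)).2.2 with h2 | ⟨v, hv⟩
    · exact absurd (hu.trans h2) h.ne'
    · have hval : maxWeight adj wt = if adj u v then wt u v else 0 := hu.trans hv
      by_cases huv : adj u v = true
      · exact ⟨u, v, huv, by rw [hval, if_pos huv]⟩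
      · rw [if_neg huv] at hval
        exact absurd hval h.ne'

/-- The algorithm's `w₀`. -/
noncomputable def baseWeight (ε : ℝ) (adj : Mat n) (wt : Fin n → Fin n → ℝ) : ℝ :=
  ε * maxWeight adj wt / numOnes adj

/-- The index of the last weight class. -/
noncomputable def numClasses (ε : ℝ) (adj : Mat n) : ℕ := ⌊Real.logb (1 + ε) (numOnes adj / ε)⌋₊

lemma wcmc_spec (ε : ℝ) (adj : Mat n) (wt : Fin n → Fin n → ℝ) :
    (∃ i, (wcmc ε adj wt).val = (classSolve ε adj wt (baseWeight ε adj wt) i).val) ∧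
      ∀ i ≤ numClasses ε adj, cutW adj wt (classSolve ε adj wt (baseWeight ε adj wt) i).val ≤
        cutW adj wt (wcmc ε adj wt).val := by
  classical
  have hval : (wcmc ε adj wt).val =
      ((List.range (numClasses ε adj)).map fun j =>
        (classSolve ε adj wt (baseWeight ε adj wt) (j + 1)).val).foldl
        (fun B S => if cutW adj wt B < cutW adj wt S then S else B)
        (classSolve ε adj wt (baseWeight ε adj wt) 0).val := by
    simp only [wcmc, bind_val, foldT_val, mapT_val, op_val, cutSum_val]
    rfl
  rw [hval]
  obtain ⟨h1, h2⟩ := foldl_max_spec (cutW adj wt)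
    (fun B S => if cutW adj wt B < cutW adj wt S then S else B)
    (fun B S => by split_ifs <;> simp_all)
    ((List.range (numClasses ε adj)).map fun j =>
        (classSolve ε adj wt (baseWeight ε adj wt) (j + 1)).val)
    (classSolve ε adj wt (baseWeight ε adj wt) 0).val
  constructor
  · rcases List.mem_cons.1 h1 with h | h
    · exact ⟨0, h⟩
    · obtain ⟨j, -, hj⟩ := List.mem_map.1 h
      exact ⟨j + 1, hj.symm⟩
  · intro i hi
    refine h2 _ ?_
    cases i with
    | zero => exact List.mem_cons_self
    | succ j =>
      exact List.mem_cons_of_mem _ (List.mem_map.2 ⟨j, List.mem_range.2 hi, rfl⟩)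

/-- Every edge that is not too light belongs to a weight class. -/
lemma exists_class {ε : ℝ} (hε : 0 < ε) (hm : 0 < numOnes adj) (hmax : 0 < maxWeight adj wt)
    {u v : Fin n} (huv : adj u v = true) (hw : baseWeight ε adj wt ≤ wt u v) :
    ∃ i ≤ numClasses ε adj,
      (classGraph ε adj wt (baseWeight ε adj wt * (1 + ε) ^ i)).one u v = true := by
  have hm' : (0 : ℝ) < numOnes adj := by exact_mod_cast hm
  have hb : 0 < baseWeight ε adj wt := by unfold baseWeight; positivity
  obtain ⟨i, hi1, hi2⟩ := exists_nat_pow_near ((one_le_div hb).2 hw) (by linarith : 1 < 1 + ε)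
  rw [le_div_iff₀ hb] at hi1
  rw [div_lt_iff₀ hb] at hi2
  refine ⟨i, ?_, ?_⟩
  -- `w₀ (1 + ε) ^ i` is at most the weight of the edge, hence at most `w_max`; dividing by `w₀ = ε
  -- w_max / m` gives `(1 + ε) ^ i ≤ m / ε`.
  · refine Nat.le_floor ?_
    rw [Real.le_logb_iff_rpow_le (by linarith) (by positivity), Real.rpow_natCast,
      le_div_iff₀ hε]
    have h1 := hi1.trans (le_maxWeight huv)
    unfold baseWeight at h1
    rw [mul_div_assoc', div_le_iff₀ hm'] at h1
    nlinarith
  · simp only [classGraph, huv, Bool.true_and, Bool.and_eq_true, decide_eq_true_eq]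
    refine ⟨by linarith, ?_⟩
    rw [pow_succ] at hi2
    linarith

/-- A cut edge in class `i` weighs less than `w₀ (1 + ε) ^ (i + 1)`. An edge in no class weighs less
than `w₀`, and there are at most `m` of these, with `m w₀ = ε w_max`. -/
lemma GoodWeighted.cutW_le_classes (h : GoodWeighted adj wt) {ε : ℝ} (hε : 0 < ε)
    (hm : 0 < numOnes adj) (hmax : 0 < maxWeight adj wt) (X : VSet n) :
    cutW adj wt X ≤ (∑ i ∈ Finset.range (numClasses ε adj + 1),
      baseWeight ε adj wt * (1 + ε) ^ i * (1 + ε) *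
        cutN (CMC.classGraph ε adj wt (baseWeight ε adj wt * (1 + ε) ^ i)).one X) +
      ε * maxWeight adj wt := by
  have hm' : (0 : ℝ) < numOnes adj := by exact_mod_cast hm
  have hb : 0 < baseWeight ε adj wt := by unfold baseWeight; positivity
  set b := baseWeight ε adj wt with hbdef
  have hgood : Good (⟨fun _ => true, adj, adj⟩ : BGraph n) :=
    ⟨h.symm, h.irrefl, fun _ _ _ => rfl, fun _ _ => id, h.symm, h.conn⟩
  have hcut : (cutN adj X : ℝ) ≤ numOnes adj := by exact_mod_cast cutN_le_numOnes hgood X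
  have h1 : cutW adj wt X ≤ (∑ i ∈ Finset.range (numClasses ε adj + 1),
      b * (1 + ε) ^ i * (1 + ε) * cutN (CMC.classGraph ε adj wt (b * (1 + ε) ^ i)).one X) +
      b * cutN adj X := by
    unfold cutW cutN
    push_cast
    simp only [Finset.mul_sum]
    rw [Finset.sum_comm (s := Finset.range (numClasses ε adj + 1)), ← Finset.sum_add_distrib]
    refine Finset.sum_le_sum fun u _ => ?_
    rw [Finset.sum_comm (s := Finset.range (numClasses ε adj + 1)), ← Finset.sum_add_distrib]
    refine Finset.sum_le_sum fun v _ => ?_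
    have hterm : ∀ i, 0 ≤ b * (1 + ε) ^ i * (1 + ε) *
        (if (X u && !X v && (CMC.classGraph ε adj wt (b * (1 + ε) ^ i)).one u v) = true
          then (1 : ℝ) else 0) := fun i => by
      split_ifs <;> positivity
    by_cases huv : (X u && !X v && adj u v) = true
    · simp only [if_pos huv, mul_one]
      have huv' : adj u v = true := by simp only [Bool.and_eq_true] at huv; exact huv.2
      by_cases hw : b ≤ wt u v
      · obtain ⟨i, hi, hone⟩ := exists_class hε hm hmax huv' hw
        rw [← hbdef] at hone
        have hle := Finset.single_le_sum (fun i _ => hterm i)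
          (Finset.mem_range.2 (Nat.lt_succ_of_le hi))
        have hpos : (X u && !X v && (CMC.classGraph ε adj wt (b * (1 + ε) ^ i)).one u v) = true := by
          simp only [Bool.and_eq_true] at huv ⊢
          exact ⟨huv.1, hone⟩
        rw [if_pos hpos, mul_one] at hle
        simp only [CMC.classGraph, Bool.and_eq_true, decide_eq_true_eq] at hone
        linarith [hone.2]
      · push Not at hw
        have := Finset.sum_nonneg fun i (_ : i ∈ Finset.range (numClasses ε adj + 1)) => hterm i
        linarith
    · simp only [if_neg huv, mul_zero, add_zero]
      exact Finset.sum_nonneg fun i _ => hterm i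
  have h2 : b * cutN adj X ≤ ε * maxWeight adj wt := by
    calc b * cutN adj X ≤ b * numOnes adj := by gcongr
      _ = ε * maxWeight adj wt := by rw [hbdef, baseWeight]; field_simp
  linarith

lemma numOnes_le_sq (adj : Mat n) : numOnes adj ≤ n ^ 2 := by
  unfold numOnes
  calc (∑ u, ∑ v, if (decide (u < v) && adj u v) = true then 1 else 0 : ℕ)
      ≤ ∑ _u : Fin n, ∑ _v : Fin n, 1 := by
        refine Finset.sum_le_sum fun u _ => Finset.sum_le_sum fun v _ => ?_
        split_ifs <;> simp
    _ = n ^ 2 := by simp [sq]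

lemma numClasses_le {ε : ℝ} (hε : 0 < ε) (hε₁ : ε ≤ 1) (hm : 0 < numOnes adj) :
    (numClasses ε adj : ℝ) ≤ (2 + Real.log (1 / ε)) / Real.log (1 + ε) * (1 + Real.log n) := by
  have hm' : (1 : ℝ) ≤ numOnes adj := by exact_mod_cast hm
  have hL : 0 < Real.log (1 + ε) := Real.log_pos (by linarith)
  have hE : 0 ≤ Real.log (1 / ε) := Real.log_nonneg (by rw [le_div_iff₀ hε]; linarith)
  have hn : 0 ≤ Real.log n := Real.log_natCast_nonneg n
  have hx : 0 ≤ Real.logb (1 + ε) (numOnes adj / ε) :=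
    Real.logb_nonneg (by linarith) (by rw [le_div_iff₀ hε]; linarith)
  refine (Nat.floor_le hx).trans ?_
  rw [Real.logb, div_mul_eq_mul_div]
  refine div_le_div_of_nonneg_right ?_ hL.le
  rw [div_eq_mul_one_div, Real.log_mul (by linarith) (by positivity)]
  have h1 : Real.log (numOnes adj) ≤ 2 * Real.log n := by
    have h2 : (numOnes adj : ℝ) ≤ (n : ℝ) ^ 2 := by exact_mod_cast numOnes_le_sq adj
    have h3 := Real.log_le_log (by linarith) h2
    rw [Real.log_pow] at h3
    exact_mod_cast h3
  nlinarith

/-- The factor lost in passing to weight classes. -/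
noncomputable def lossFactor (ε : ℝ) : ℝ :=
  3328 * ((2 + Real.log (1 / ε)) / Real.log (1 + ε) + 2)

/-- With `β` the output weight, every class contributes O(`β` log n) to the cut of any connected
`X`, there are O(log n) classes, and the light edges are absorbed through a bound on `w_max`. -/
theorem GoodWeighted.wcmc_spec (h : GoodWeighted adj wt) {ε : ℝ} (hε : 0 < ε) (hε₁ : ε ≤ 1) :
    Conn adj (wcmc ε adj wt).val ∧ ∀ X, Conn adj X →
      cutW adj wt X ≤ lossFactor ε * (1 + Real.log n) ^ 2 * cutW adj wt (wcmc ε adj wt).val := by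
  obtain ⟨⟨j, hj⟩, hbest⟩ := CMC.wcmc_spec ε adj wt
  refine ⟨by rw [hj]; exact (h.classSolve_spec ε _ j).1, fun X hX => ?_⟩
  set β := cutW adj wt (wcmc ε adj wt).val with hβ
  have hβ0 : 0 ≤ β := cutW_nonneg h.wt_nonneg _
  have hL : 0 < Real.log (1 + ε) := Real.log_pos (by linarith)
  have hE : 0 ≤ Real.log (1 / ε) := Real.log_nonneg (by rw [le_div_iff₀ hε]; linarith)
  have hn : 0 ≤ Real.log n := Real.log_natCast_nonneg n
  have hF : 0 ≤ lossFactor ε := by unfold lossFactor; positivity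
  -- If `w_max = 0`, then every cut has weight zero.
  rcases maxWeight_nonneg.eq_or_lt with hmax | hmax
  · have : cutW adj wt X ≤ 0 := by
      refine Finset.sum_nonpos fun u _ => Finset.sum_nonpos fun v _ => ?_
      split_ifs with huv
      · simp only [Bool.and_eq_true] at huv
        exact (le_maxWeight huv.2).trans hmax.symm.le
      · exact le_rfl
    exact this.trans (by positivity)
  · obtain ⟨u, v, huv, hw⟩ := exists_maxWeight hmax
    have hgood : Good (⟨fun _ => true, adj, adj⟩ : BGraph n) :=
      ⟨h.symm, h.irrefl, fun _ _ _ => rfl, fun _ _ => id, h.symm, h.conn⟩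
    have hne : u ≠ v := hgood.ne huv
    let U : VSet n := fun x => decide (x = u)
    have hU : Conn adj U := conn_singleton (r := u) fun x => by simp [U]
    have hcutpos : ∀ O : Mat n, O u v = true → 1 ≤ cutN O U := by
      intro O hO
      unfold cutN
      refine le_trans ?_ (Finset.single_le_sum (fun _ _ => Nat.zero_le _) (Finset.mem_univ u))
      refine le_trans ?_ (Finset.single_le_sum (fun _ _ => Nat.zero_le _) (Finset.mem_univ v))
      simp [U, hne.symm, hO]
    have hm : 0 < numOnes adj := (hcutpos adj huv).trans (cutN_le_numOnes hgood U)
    have hm' : (1 : ℝ) ≤ numOnes adj := by exact_mod_cast hm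
    have hb : 0 < baseWeight ε adj wt := by unfold baseWeight; positivity
    set b := baseWeight ε adj wt with hbdef
    set C := 1664 * (1 + Real.log n) with hC
    have hC0 : 0 ≤ C := by positivity
    have hclass : ∀ i ≤ numClasses ε adj, ∀ Y, Conn adj Y →
        b * (1 + ε) ^ i * (1 + ε) *
          cutN (CMC.classGraph ε adj wt (b * (1 + ε) ^ i)).one Y ≤ (1 + ε) * C * β := by
      intro i hi Y hY
      have h1 := (h.classSolve_spec ε b i).2 Y hY
      have h2 := (cutN_classGraph_le (ε := ε) (lo := b * (1 + ε) ^ i) h.wt_nonneg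
        (classSolve ε adj wt b i).val).trans (hbest i hi)
      calc b * (1 + ε) ^ i * (1 + ε) *
            cutN (CMC.classGraph ε adj wt (b * (1 + ε) ^ i)).one Y
          ≤ b * (1 + ε) ^ i * (1 + ε) * (C *
            cutN (CMC.classGraph ε adj wt (b * (1 + ε) ^ i)).one (classSolve ε adj wt b i).val) := by
            gcongr
        _ = (1 + ε) * C * (b * (1 + ε) ^ i *
            cutN (CMC.classGraph ε adj wt (b * (1 + ε) ^ i)).one (classSolve ε adj wt b i).val) := by
            ring
        _ ≤ (1 + ε) * C * β := by gcongr
    -- A heaviest edge `uv` belongs to some class because `ε ≤ 1 ≤ m`, and the connected set `{u}`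
    -- cuts it, so the class bound applies to its weight.
    have hwmax : maxWeight adj wt ≤ (1 + ε) * C * β := by
      have hbw : b ≤ wt u v := by
        rw [hw, hbdef, baseWeight, div_le_iff₀ (by linarith)]
        nlinarith
      obtain ⟨i, hi, hone⟩ := exists_class hε hm hmax huv hbw
      refine le_trans ?_ (hclass i hi U hU)
      have h1 : (1 : ℝ) ≤ cutN (CMC.classGraph ε adj wt (b * (1 + ε) ^ i)).one U := by
        exact_mod_cast hcutpos _ hone
      have h2 : wt u v ≤ b * (1 + ε) ^ i * (1 + ε) := by
        simp only [CMC.classGraph, Bool.and_eq_true, decide_eq_true_eq] at hone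
        exact hone.2.le
      rw [← hw]
      exact h2.trans (le_mul_of_one_le_right (by positivity) h1)
    have hmain := h.cutW_le_classes hε hm hmax X
    have hsum := Finset.sum_le_card_nsmul (Finset.range (numClasses ε adj + 1)) _ _ fun i hi =>
      hclass i (Nat.le_of_lt_succ (Finset.mem_range.1 hi)) X hX
    rw [Finset.card_range, nsmul_eq_mul] at hsum
    push_cast at hsum
    have hK := numClasses_le hε hε₁ hm
    set Q := (2 + Real.log (1 / ε)) / Real.log (1 + ε) with hQ
    set K := (numClasses ε adj : ℝ) with hKdef
    have hCβ : 0 ≤ C * β := by positivity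
    have hK2 : K + 2 ≤ (Q + 2) * (1 + Real.log n) := by nlinarith
    -- `K + 1` classes and the light edges give the factor `K + 1 + ε ≤ K + 2`; the other factor `1
    -- + ε ≤ 2` turns 1664 into the 3328 of `lossFactor`.
    calc cutW adj wt X ≤ (K + 1) * ((1 + ε) * C * β) + ε * ((1 + ε) * C * β) := by
          refine hmain.trans (add_le_add hsum ?_)
          gcongr
      _ = (K + 1 + ε) * (1 + ε) * (C * β) := by ring
      _ ≤ (K + 1 + 1) * (1 + 1) * (C * β) := by gcongr
      _ = (K + 2) * (2 * (C * β)) := by ring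
      _ ≤ (Q + 2) * (1 + Real.log n) * (2 * (C * β)) := by gcongr
      _ = lossFactor ε * (1 + Real.log n) ^ 2 * β := by
          rw [lossFactor, ← hQ, hC]; ring

end Weighted

end CMC

namespace CMC

open Timed

/-! ### Running times -/

namespace Timed

open Polynomial

variable {n : ℕ} {α β : Type} {p q r : ℕ[X]}

lemma op_le (a : α) : (op a).time ≤ (1 : ℕ[X]).eval n := by simp [op]

lemma bind_le {x : Timed α} {f : α → Timed β} (hx : x.time ≤ p.eval n)
    (hf : (f x.val).time ≤ q.eval n) : (x >>= f).time ≤ (p + q).eval n := by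
  rw [eval_add]
  exact Nat.add_le_add hx hf

/-- The sum of the two bounds replaces their maximum, which need not be a polynomial. All these
rules have syntactic conclusions, so that a time bound left as `_` is assembled by unification along
the program. -/
lemma ite_le {c : Prop} [Decidable c] {x y : Timed α} (hx : x.time ≤ p.eval n)
    (hy : y.time ≤ q.eval n) : (if c then x else y).time ≤ (p + q).eval n := by
  rw [eval_add]
  split_ifs <;> omega

lemma loopTime_le {f : Fin n → Timed α} (hf : ∀ i, (f i).time ≤ p.eval n) :
    loopTime f ≤ (X * (p + 1)).eval n := by
  simp only [eval_mul, eval_X, eval_add, eval_one]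
  calc loopTime f ≤ ∑ _i : Fin n, (p.eval n + 1) :=
        Finset.sum_le_sum fun i _ => Nat.add_le_add_right (hf i) 1
    _ = n * (p.eval n + 1) := by simp

lemma table_le {f : Fin n → Timed α} (hf : ∀ i, (f i).time ≤ p.eval n) :
    (table f).time ≤ (X * (p + 1)).eval n := loopTime_le hf

lemma table₂_le {f : Fin n → Fin n → Timed α} (hf : ∀ i j, (f i j).time ≤ p.eval n) :
    (table₂ f).time ≤ (X * (X * (p + 1) + 1)).eval n := loopTime_le fun i => loopTime_le (hf i)

lemma anyT_le {f : Fin n → Timed Bool} (hf : ∀ i, (f i).time ≤ p.eval n) :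
    (anyT f).time ≤ (X * (p + 1)).eval n := loopTime_le hf

lemma allT_le {f : Fin n → Timed Bool} (hf : ∀ i, (f i).time ≤ p.eval n) :
    (allT f).time ≤ (X * (p + 1)).eval n := loopTime_le hf

lemma sumT_le [AddCommMonoid α] {f : Fin n → Timed α} (hf : ∀ i, (f i).time ≤ p.eval n) :
    (sumT f).time ≤ (X * (p + 1)).eval n := loopTime_le hf

lemma maxT_le {f : Fin n → Timed ℝ} (hf : ∀ i, (f i).time ≤ p.eval n) :
    (maxT f).time ≤ (X * (p + 1)).eval n := loopTime_le hf

lemma firstT_le {f : Fin n → Timed (Option α)} (hf : ∀ i, (f i).time ≤ p.eval n) :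
    (firstT f).time ≤ (X * (p + 1)).eval n := loopTime_le hf

lemma foldT_le {f : β → α → Timed β} {b : β} {l : List α} (hl : l.length ≤ r.eval n)
    (hf : ∀ b, ∀ a ∈ l, (f b a).time ≤ p.eval n) :
    (foldT f b l).time ≤ (r * (p + 1)).eval n := by
  rw [eval_mul, eval_add, eval_one]
  refine le_trans ?_ (Nat.mul_le_mul_right _ hl)
  clear hl
  induction l generalizing b with
  | nil => simp [foldT, pure]
  | cons a l ih =>
    have h1 : (foldT f b (a :: l)).time = (f b a).time + ((foldT f (f b a).val l).time + 1) := rfl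
    have h2 := hf b a List.mem_cons_self
    have h3 := ih (b := (f b a).val) fun b c hc => hf b c (List.mem_cons_of_mem _ hc)
    rw [h1, List.length_cons, add_one_mul]
    omega

lemma mapT_le {f : α → Timed β} {l : List α} (hl : l.length ≤ r.eval n)
    (hf : ∀ a ∈ l, (f a).time ≤ p.eval n) : (mapT f l).time ≤ (r * (p + 1)).eval n := by
  rw [eval_mul, eval_add, eval_one]
  refine le_trans ?_ (Nat.mul_le_mul_right _ hl)
  clear hl
  induction l with
  | nil => simp [mapT, pure]
  | cons a l ih =>
    have h1 : (mapT f (a :: l)).time = (f a).time + ((mapT f l).time + 1) := rfl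
    have h2 := hf a List.mem_cons_self
    have h3 := ih fun c hc => hf c (List.mem_cons_of_mem _ hc)
    rw [h1, List.length_cons, add_one_mul]
    omega

lemma repeatT_le {f : α → Timed α} {k : ℕ} {a : α} (hk : k ≤ r.eval n)
    (hf : ∀ a, (f a).time ≤ p.eval n) : (repeatT f k a).time ≤ (r * (p + 1)).eval n := by
  rw [eval_mul, eval_add, eval_one]
  refine le_trans ?_ (Nat.mul_le_mul_right _ hk)
  clear hk
  induction k generalizing a with
  | zero => simp [repeatT, pure]
  | succ k ih =>
    have h1 : (repeatT f (k + 1) a).time = (f a).time + ((repeatT f k (f a).val).time + 1) := rfl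
    have h2 := hf a
    have h3 := ih (a := (f a).val)
    rw [h1, add_one_mul]
    omega

lemma bind_option_le {x : Timed (Option α)} {f : Option α → Timed β} (hx : x.time ≤ p.eval n)
    (h₀ : (f none).time ≤ q.eval n) (h₁ : ∀ a, (f (some a)).time ≤ r.eval n) :
    (x >>= f).time ≤ (p + (q + r)).eval n := by
  refine bind_le hx ?_
  rw [eval_add]
  cases x.val with
  | none => exact h₀.trans (Nat.le_add_right _ _)
  | some a => exact (h₁ a).trans (Nat.le_add_left _ _)

lemma le_X (n : ℕ) : n ≤ (X : ℕ[X]).eval n := by simp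

lemma length_finRange_le (n : ℕ) : (List.finRange n).length ≤ (X : ℕ[X]).eval n := by simp

end Timed

/-! ### Polynomial time for the combinatorial procedures -/

section Basic

open Polynomial

lemma emptySet_time : ∃ p : ℕ[X], ∀ n : ℕ, (emptySet : Timed (VSet n)).time ≤ p.eval n :=
  ⟨_, fun _ => table_le fun _ => op_le _⟩

lemma reach_time : ∃ p : ℕ[X], ∀ (n : ℕ) (M : Mat n) (Y : VSet n) (r : Fin n),
    (reach M Y r).time ≤ p.eval n :=
  ⟨_, fun n _ _ _ => bind_le (table_le fun _ => op_le _) <| repeatT_le (le_X n) fun _ =>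
    table_le fun _ => bind_le (anyT_le fun _ => op_le _) (op_le _)⟩

lemma isConn_time : ∃ p : ℕ[X], ∀ (n : ℕ) (M : Mat n) (Y : VSet n),
    (isConn M Y).time ≤ p.eval n := by
  obtain ⟨p, hp⟩ := reach_time
  exact ⟨_, fun n _ _ => bind_option_le (firstT_le fun _ => op_le _) (op_le _) fun _ =>
    bind_le (hp n _ _ _) (allT_le fun _ => op_le _)⟩

lemma degree_time : ∃ p : ℕ[X], ∀ (n : ℕ) (M : Mat n) (v : Fin n),
    (degree M v).time ≤ p.eval n :=
  ⟨_, fun _ _ _ => sumT_le fun _ => op_le _⟩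

lemma cutOnes_time : ∃ p : ℕ[X], ∀ (n : ℕ) (g : BGraph n) (Y : VSet n),
    (cutOnes g Y).time ≤ p.eval n :=
  ⟨_, fun _ _ _ => sumT_le fun _ => sumT_le fun _ => op_le _⟩

lemma chooseBest_time (k : ℕ) : ∃ p : ℕ[X], ∀ (n : ℕ) (g : BGraph n) (Ys : List (VSet n)),
    Ys.length = k → (chooseBest g Ys).time ≤ p.eval n := by
  obtain ⟨p, hp⟩ := isConn_time
  obtain ⟨q, hq⟩ := cutOnes_time
  obtain ⟨r, hr⟩ := emptySet_time
  exact ⟨_, fun n g Ys hYs => bind_le (hr n) <|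
    foldT_le (r := C k) (by simp [hYs]) fun _ _ _ => bind_le (hp n _ _) <|
      bind_le (hp n _ _) <| bind_le (hq n _ _) <| bind_le (hq n _ _) (op_le _)⟩

lemma findZeroVertex_time : ∃ p : ℕ[X], ∀ (n : ℕ) (g : BGraph n),
    (findZeroVertex g).time ≤ p.eval n := by
  obtain ⟨p, hp⟩ := degree_time
  exact ⟨_, fun n g => firstT_le fun _ => bind_le (hp n _ _) (op_le _)⟩

lemma eliminate_time : ∃ p : ℕ[X], ∀ (n : ℕ) (g : BGraph n) (z : Fin n),
    (eliminate g z).time ≤ p.eval n :=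
  ⟨_, fun _ _ _ => bind_le (table_le fun _ => op_le _) <| bind_le (table₂_le fun _ _ => op_le _) <|
    bind_le (table₂_le fun _ _ => op_le _) (op_le _)⟩

lemma findThinPath_time : ∃ p : ℕ[X], ∀ (n : ℕ) (g : BGraph n),
    (findThinPath g).time ≤ p.eval n := by
  obtain ⟨p, hp⟩ := degree_time
  exact ⟨_, fun n g => bind_le (table_le fun _ => hp n _ _) <| firstT_le fun _ => firstT_le fun _ =>
    firstT_le fun _ => firstT_le fun _ => op_le _⟩

lemma shrink_time : ∃ p : ℕ[X], ∀ (n : ℕ) (g : BGraph n) (z : Quad n),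
    (shrink g z).time ≤ p.eval n :=
  ⟨_, fun _ _ _ => bind_le (op_le _) <| bind_le (table_le fun _ => op_le _) <|
    bind_le (table₂_le fun _ _ => op_le _) <| bind_le (table₂_le fun _ _ => op_le _) (op_le _)⟩

lemma recover_time : ∃ p : ℕ[X], ∀ (n : ℕ) (g : BGraph n) (z : Quad n) (S : VSet n),
    (recover g z S).time ≤ p.eval n := by
  obtain ⟨p, hp⟩ := chooseBest_time 4
  exact ⟨_, fun n _ _ _ => bind_le (table_le fun _ => op_le _) <|
    bind_le (table_le fun _ => op_le _) <| bind_le (table_le fun _ => op_le _) <|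
      bind_le (table_le fun _ => op_le _) (hp n _ _ rfl)⟩

lemma liftTree_time : ∃ p : ℕ[X], ∀ (n : ℕ) (z : Quad n) (T : Tree n),
    (liftTree z T).time ≤ p.eval n :=
  ⟨_, fun _ _ _ => bind_le (table_le fun _ => op_le _) <|
    bind_le (table₂_le fun _ _ => op_le _) (op_le _)⟩

lemma spanningTree_time : ∃ p : ℕ[X], ∀ (n : ℕ) (g : BGraph n),
    (spanningTree g).time ≤ p.eval n := by
  obtain ⟨p, hp⟩ := isConn_time
  exact ⟨_, fun n g => bind_le (table₂_le fun _ _ => op_le _) <|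
    bind_le (foldT_le (length_finRange_le n) fun _ _ _ => foldT_le (length_finRange_le n)
      fun _ _ _ => ite_le (bind_le (table₂_le fun _ _ => op_le _) <|
        bind_le (hp n _ _) (op_le _)) (op_le _)) (op_le _)⟩

lemma countDeg2_time : ∃ p : ℕ[X], ∀ (n : ℕ) (M : Mat n), (countDeg2 M).time ≤ p.eval n := by
  obtain ⟨p, hp⟩ := degree_time
  exact ⟨_, fun n _ => sumT_le fun _ => bind_le (hp n _ _) (op_le _)⟩

lemma improve_time : ∃ p : ℕ[X], ∀ (n : ℕ) (g : BGraph n) (T : Tree n),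
    (improve g T).time ≤ p.eval n := by
  obtain ⟨p, hp⟩ := isConn_time
  obtain ⟨q, hq⟩ := countDeg2_time
  exact ⟨_, fun n g T => bind_le (hq n _) <| bind_option_le (firstT_le fun _ => firstT_le fun _ =>
    firstT_le fun _ => firstT_le fun _ => ite_le (bind_le (table₂_le fun _ _ => op_le _) <|
      bind_le (hp n _ _) <| bind_le (hq n _) (op_le _)) (op_le _)) (op_le _) fun _ =>
        op_le _⟩

lemma leafyTree_time : ∃ p : ℕ[X], ∀ (n : ℕ) (g : BGraph n), (leafyTree g).time ≤ p.eval n := by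
  obtain ⟨p, hp⟩ := spanningTree_time
  obtain ⟨q, hq⟩ := improve_time
  exact ⟨_, fun n g => bind_le (hp n g) <| repeatT_le (le_X n) (hq n g)⟩

lemma leaves_time : ∃ p : ℕ[X], ∀ (n : ℕ) (T : Tree n), (leaves T).time ≤ p.eval n := by
  obtain ⟨p, hp⟩ := degree_time
  exact ⟨_, fun n _ => table_le fun _ => bind_le (hp n _ _) (op_le _)⟩

lemma deleteSet_time : ∃ p : ℕ[X], ∀ (n : ℕ) (g : BGraph n) (L : VSet n),
    (deleteSet g L).time ≤ p.eval n :=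
  ⟨_, fun _ _ _ => bind_le (table_le fun _ => op_le _) <| bind_le (table₂_le fun _ _ => op_le _) <|
    bind_le (table₂_le fun _ _ => op_le _) (op_le _)⟩

lemma length_peel_val_le {n : ℕ} (k : ℕ) (g : BGraph n) : (peel k g).val.length ≤ k := by
  induction k generalizing g with
  | zero => rfl
  | succ k ih =>
    by_cases hne : ∃ v, g.vert v = true
    · rcases ho : (findThinPath g).val with _ | z
      · rw [peel_val_leafy hne ho, List.length_cons]
        exact Nat.succ_le_succ (ih _)
      · rw [peel_val_thin hne ho, List.length_map]
        exact (ih _).trans (Nat.le_succ k)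
    · rw [peel_val_of_empty hne]
      exact Nat.zero_le _

/-- One round costs a fixed polynomial, apart from the recursion. The restriction `k ≤ n` bounds the
number of trees to be lifted after a shrinking. -/
lemma peel_time : ∃ p : ℕ[X], ∀ (n : ℕ) (g : BGraph n), (peel n g).time ≤ p.eval n := by
  obtain ⟨a, ha⟩ := findThinPath_time
  obtain ⟨b, hb⟩ := shrink_time
  obtain ⟨c, hc⟩ := liftTree_time
  obtain ⟨d, hd⟩ := leafyTree_time
  obtain ⟨e, he⟩ := leaves_time
  obtain ⟨f, hf⟩ := deleteSet_time
  have hne : ∃ r : ℕ[X], ∀ (n : ℕ) (g : BGraph n), (anyT fun v => op (g.vert v)).time ≤ r.eval n :=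
    ⟨_, fun _ _ => anyT_le fun _ => op_le _⟩
  obtain ⟨r, hr⟩ := hne
  suffices h : ∀ (n k : ℕ) (g : BGraph n), k ≤ n →
      (peel k g).time ≤ k * (r + a + b + X * (c + 1) + d + e + f + 1).eval n from
    ⟨X * (r + a + b + X * (c + 1) + d + e + f + 1), fun n g => by
      rw [eval_mul, eval_X]; exact h n n g le_rfl⟩
  intro n k
  induction k with
  | zero => intro g _; exact Nat.zero_le _
  | succ k ih =>
    intro g hk
    rw [add_one_mul]
    have h1 : (peel (k + 1) g).time = (anyT fun v => op (g.vert v)).time +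
      (if (anyT fun v => op (g.vert v)).val then do
        let o ← findThinPath g
        match o with
        | some p => do
          let g' ← shrink g p
          let Ts ← peel k g'
          mapT (liftTree p) Ts
        | none => do
          let T ← leafyTree g
          let L ← leaves T
          let g' ← deleteSet g L
          let Ts ← peel k g'
          op (T :: Ts)
      else op []).time := rfl
    have hr' := hr n g
    have ha' := ha n g
    simp only [eval_add, eval_one] at ih ⊢
    rw [h1]
    split_ifs
    · rcases ho : (findThinPath g).val with _ | z
      · have h2 := ih (deleteSet g (leaves (leafyTree g).val).val).val (by omega)
        have hd' := hd n g
        have he' := he n (leafyTree g).val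
        have hf' := hf n g (leaves (leafyTree g).val).val
        change _ + ((findThinPath g).time + (match (findThinPath g).val with
          | some p => _
          | none => _ : Timed (List (Tree n))).time) ≤ _
        rw [ho]
        change _ + (_ + ((leafyTree g).time + ((leaves (leafyTree g).val).time +
          ((deleteSet g (leaves (leafyTree g).val).val).time +
            ((peel k (deleteSet g (leaves (leafyTree g).val).val).val).time + 1))))) ≤ _
        omega
      · have h2 := ih (shrink g z).val (by omega)
        have hb' := hb n g z
        have hc' : (mapT (liftTree z) (peel k (shrink g z).val).val).time ≤
            (X * (c + 1) : ℕ[X]).eval n :=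
          mapT_le (((length_peel_val_le k _).trans (by omega)).trans (le_X n)) fun T _ => hc n z T
        change _ + ((findThinPath g).time + (match (findThinPath g).val with
          | some p => _
          | none => _ : Timed (List (Tree n))).time) ≤ _
        rw [ho]
        change _ + (_ + ((shrink g z).time + ((peel k (shrink g z).val).time +
          (mapT (liftTree z) (peel k (shrink g z).val).val).time))) ≤ _
        omega
    · change _ + 1 ≤ _
      omega

end Basic

end CMC

namespace CMC

open Timed

section Basic

open Polynomial

lemma splitLeaves_time : ∃ p : ℕ[X], ∀ (n : ℕ) (g : BGraph n) (L : VSet n),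
    (splitLeaves g L).time ≤ p.eval n := by
  obtain ⟨p, hp⟩ := emptySet_time
  exact ⟨_, fun n g L => bind_le (hp n) <| bind_le (hp n) <| foldT_le (length_finRange_le n)
    fun _ _ _ => ite_le (bind_le (sumT_le fun _ => op_le _) <| bind_le (sumT_le fun _ => op_le _) <|
      ite_le (bind_le (table_le fun _ => op_le _) (op_le _))
        (bind_le (table_le fun _ => op_le _) (op_le _))) (op_le _)⟩

lemma treeCut_time : ∃ p : ℕ[X], ∀ (n : ℕ) (g : BGraph n) (T : Tree n),
    (treeCut g T).time ≤ p.eval n := by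
  obtain ⟨p, hp⟩ := leaves_time
  obtain ⟨q, hq⟩ := splitLeaves_time
  obtain ⟨r, hr⟩ := chooseBest_time 2
  exact ⟨_, fun n g T => bind_le (hp n T) <| bind_le (hq n g _) <|
    bind_le (table_le fun _ => op_le _) <| bind_le (table_le fun _ => op_le _) (hr n g _ rfl)⟩

lemma thickness_time : ∃ p : ℕ[X], ∀ (n : ℕ) (g : BGraph n) (T : Tree n),
    (thickness g T).time ≤ p.eval n := by
  obtain ⟨p, hp⟩ := leaves_time
  obtain ⟨q, hq⟩ := degree_time
  exact ⟨_, fun n g T => bind_le (hp n T) <| sumT_le fun _ => bind_le (hq n _ _) (op_le _)⟩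

lemma thickSolve_time : ∃ p : ℕ[X], ∀ (n : ℕ) (g : BGraph n),
    (thickSolve g).time ≤ p.eval n := by
  obtain ⟨p, hp⟩ := leafyTree_time
  obtain ⟨q, hq⟩ := treeCut_time
  obtain ⟨r, hr⟩ := peel_time
  obtain ⟨s, hs⟩ := thickness_time
  have hlog : ∀ (n : ℕ) (g : BGraph n),
      (logT (sumT fun v => op (if g.vert v then 1 else 0 : ℕ)).val).time ≤
        (X + 1 : ℕ[X]).eval n := by
    intro n g
    have h1 : (sumT fun v => op (if g.vert v then 1 else 0 : ℕ)).val = card g.vert := by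
      simp [card]
    rw [h1]
    simp only [logT, eval_add, eval_X, eval_one]
    exact Nat.add_le_add_right ((Nat.log_le_self 2 _).trans (card_le_univ _)) 1
  exact ⟨_, fun n g => bind_le (sumT_le fun _ => op_le _) <|
    bind_le (sumT_le fun _ => sumT_le fun _ => op_le _) <| bind_le (hlog n g) <|
      bind_le (hp n g) <| ite_le (hq n g _) <| bind_le (hr n g) <|
        bind_le (foldT_le ((length_peel_val_le n g).trans (le_X n)) fun _ _ _ =>
          bind_le (hs n g _) <| bind_le (hs n g _) (op_le _)) (hq n g _)⟩

/-- Each reduction adds one polynomial amount on the way down and up, and `thickSolve` is run at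
most once. The summand `i` pays for the empty set returned when no reductions are left. -/
lemma bcmc_time : ∃ p : ℕ[X], ∀ (n : ℕ) (g : BGraph n), (bcmc n g).time ≤ p.eval n := by
  obtain ⟨a, ha⟩ := findZeroVertex_time
  obtain ⟨b, hb⟩ := findThinPath_time
  obtain ⟨c, hc⟩ := thickSolve_time
  obtain ⟨d, hd⟩ := shrink_time
  obtain ⟨e, he⟩ := recover_time
  obtain ⟨f, hf⟩ := eliminate_time
  obtain ⟨h, hh⟩ := isConn_time
  obtain ⟨i, hi⟩ := emptySet_time
  have hfin : ∃ r : ℕ[X], ∀ (n : ℕ) (b : Bool) (S : VSet n) (v : Fin n),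
      (if b then op S else table fun u => op (S u || decide (u = v))).time ≤ r.eval n :=
    ⟨_, fun _ _ _ _ => ite_le (op_le _) (table_le fun _ => op_le _)⟩
  obtain ⟨r, hr⟩ := hfin
  suffices H : ∀ (n k : ℕ) (g : BGraph n),
      (bcmc k g).time ≤ k * (a + b + c + d + e + f + h + r).eval n + i.eval n from
    ⟨X * (a + b + c + d + e + f + h + r) + i, fun n g => by
      rw [eval_add, eval_mul, eval_X]; exact H n n g⟩
  intro n k
  induction k with
  | zero =>
    intro g
    rw [zero_mul, zero_add]
    exact hi n
  | succ k ih =>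
    intro g
    rw [add_one_mul]
    have ha' := ha n g
    have hb' := hb n g
    have hc' := hc n g
    simp only [eval_add] at ih ⊢
    change (findZeroVertex g).time + (match (findZeroVertex g).val with
      | some v => _
      | none => _ : Timed (VSet n)).time ≤ _
    rcases (findZeroVertex g).val with _ | z
    · change _ + ((findThinPath g).time + (match (findThinPath g).val with
        | some p => _
        | none => _ : Timed (VSet n)).time) ≤ _
      rcases (findThinPath g).val with _ | q
      · change _ + (_ + (thickSolve g).time) ≤ _
        omega
      · have h1 := ih (shrink g q).val
        have h2 := hd n g q
        have h3 := he n g q (bcmc k (shrink g q).val).val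
        change _ + (_ + ((shrink g q).time + ((bcmc k (shrink g q).val).time +
          (recover g q (bcmc k (shrink g q).val).val).time))) ≤ _
        omega
    · set g' := (eliminate g z).val
      have h1 := ih g'
      have h2 := hf n g z
      have h3 := hh n g.adj (bcmc k g').val
      have h4 := hr n (isConn g.adj (bcmc k g').val).val (bcmc k g').val z
      change _ + ((eliminate g z).time + ((bcmc k g').time +
        ((isConn g.adj (bcmc k g').val).time + (if (isConn g.adj (bcmc k g').val).val
          then op (bcmc k g').val
          else table fun u => op ((bcmc k g').val u || decide (u = z))).time))) ≤ _
      omega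

end Basic

/-! ### Polynomial time for the weighted algorithm -/

section Weighted

open Polynomial

lemma classSolve_time (r : ℕ[X]) : ∃ p : ℕ[X], ∀ (n : ℕ) (ε : ℝ) (adj : Mat n)
    (wt : Fin n → Fin n → ℝ) (w₀ : ℝ) (i : ℕ), i ≤ r.eval n →
      (classSolve ε adj wt w₀ i).time ≤ p.eval n := by
  obtain ⟨p, hp⟩ := bcmc_time
  have hpow : ∀ (n : ℕ) (x : ℝ) (i : ℕ), i ≤ r.eval n → (powT x i).time ≤ (r + 1).eval n := by
    intro n x i hi
    simp only [powT, eval_add, eval_one]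
    omega
  exact ⟨_, fun n ε adj wt w₀ i hi => bind_le (hpow n _ i hi) <| bind_le (op_le _) <|
    bind_le (op_le _) <| bind_le (table_le fun _ => op_le _) <|
      bind_le (table₂_le fun _ _ => op_le _) (hp n _)⟩

lemma cutSum_time : ∃ p : ℕ[X], ∀ (n : ℕ) (adj : Mat n) (wt : Fin n → Fin n → ℝ) (Y : VSet n),
    (cutSum adj wt Y).time ≤ p.eval n :=
  ⟨_, fun _ _ _ _ => sumT_le fun _ => sumT_le fun _ => op_le _⟩

/-- The crude bound `log x ≤ x` suffices here and yields a polynomial in `n` whose coefficient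
depends only on `ε`. -/
lemma numClasses_le_eval {ε : ℝ} (hε : 0 < ε) : ∃ r : ℕ[X], ∀ (n : ℕ) (adj : Mat n),
    numClasses ε adj ≤ r.eval n := by
  have hL : 0 < Real.log (1 + ε) := Real.log_pos (by linarith)
  refine ⟨C ⌈1 / (ε * Real.log (1 + ε))⌉₊ * X ^ 2, fun n adj => ?_⟩
  simp only [eval_mul, eval_C, eval_pow, eval_X]
  refine Nat.floor_le_of_le ?_
  have h1 := Nat.le_ceil (1 / (ε * Real.log (1 + ε)))
  have h2 : (numOnes adj : ℝ) ≤ (n : ℝ) ^ 2 := by exact_mod_cast numOnes_le_sq adj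
  push_cast
  calc Real.logb (1 + ε) (numOnes adj / ε)
      ≤ (numOnes adj / ε) / Real.log (1 + ε) :=
        div_le_div_of_nonneg_right (Real.log_le_self (by positivity)) hL.le
    _ = 1 / (ε * Real.log (1 + ε)) * numOnes adj := by field_simp
    _ ≤ ⌈1 / (ε * Real.log (1 + ε))⌉₊ * (n : ℝ) ^ 2 := by gcongr

lemma wcmc_time {ε : ℝ} (hε : 0 < ε) : ∃ p : ℕ[X], ∀ (n : ℕ) (adj : Mat n)
    (wt : Fin n → Fin n → ℝ), (wcmc ε adj wt).time ≤ p.eval n := by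
  obtain ⟨r, hr⟩ := numClasses_le_eval hε
  obtain ⟨p, hp⟩ := classSolve_time r
  obtain ⟨q, hq⟩ := cutSum_time
  have hfloor : ∀ (n : ℕ) (adj : Mat n), (floorLogT (1 + ε) (numOnes adj / ε)).time ≤
      (r + 1).eval n := by
    intro n adj
    have := hr n adj
    rw [eval_add, eval_one]
    exact Nat.add_le_add_right this 1
  exact ⟨_, fun n adj wt => bind_le (sumT_le fun _ => sumT_le fun _ => op_le _) <|
    bind_le (maxT_le fun _ => maxT_le fun _ => op_le _) <| bind_le (op_le _) <|
      bind_le (hfloor n adj) <| bind_le (hp n ε adj wt _ 0 (Nat.zero_le _)) <|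
        bind_le (mapT_le (r := r) (by rw [List.length_range]; exact hr n adj) fun j hj =>
          hp n ε adj wt _ (j + 1) ((Nat.succ_le_of_lt (List.mem_range.1 hj)).trans (hr n adj))) <|
        foldT_le (r := r) (by rw [mapT_val, List.length_map, List.length_range]; exact hr n adj)
          fun _ _ _ => bind_le (hq n adj wt _) <| bind_le (hq n adj wt _) (op_le _)⟩

end Weighted

end CMC

/-! ### The approximation guarantee and the running time combined -/

theorem mainTheorem2 (ε : ℝ) (hε₀ : 0 < ε) (hε₁ : ε ≤ 1) :
    ∃ c : ℝ, 0 < c ∧ ∃ p : Polynomial ℕ,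
      ∀ (n : ℕ) (G : SimpleGraph (Fin n)) (w : Sym2 (Fin n) → ℝ),
        G.Connected → (∀ e ∈ G.edgeSet, 0 ≤ w e) →
          (G.induce (CMC.output (CMC.runWCMC ε G w))).Connected ∧
          (∀ T : Set (Fin n), (G.induce T).Connected →
            c / Real.log n ^ 2 * CMC.cutWeight G w T ≤
              CMC.cutWeight G w (CMC.output (CMC.runWCMC ε G w))) ∧
          (CMC.runWCMC ε G w).time ≤ p.eval n := by
  classical
  obtain ⟨p, hp⟩ := CMC.wcmc_time hε₀
  have hF : 0 < CMC.lossFactor ε := by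
    have hL : 0 < Real.log (1 + ε) := Real.log_pos (by linarith)
    have hE : 0 ≤ Real.log (1 / ε) := Real.log_nonneg (by rw [le_div_iff₀ hε₀]; linarith)
    unfold CMC.lossFactor
    positivity
  -- The 9 converts `(1 + log n)²` into `log² n`: for `n ≥ 2` one has `log n ≥ 1/2`, hence `1 + log
  -- n ≤ 3 log n`.
  refine ⟨1 / (9 * CMC.lossFactor ε), by positivity, p, fun n G w hG hw => ?_⟩
  have hadj : ∀ u v, decide (G.Adj u v) = true ↔ G.Adj u v := fun u v => decide_eq_true_iff
  have hgood : CMC.GoodWeighted (fun u v => decide (G.Adj u v)) fun u v => w s(u, v) := by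
    refine ⟨fun u v => by simp [G.adj_comm], fun v => by simp, ?_,
      fun u v => by rw [Sym2.eq_swap], fun u v huv => hw _ ((hadj u v).1 huv)⟩
    refine (CMC.conn_iff_induce_connected (S := Set.univ) hadj (by simp)).2 ?_
    exact (SimpleGraph.induceUnivIso G).connected_iff.2 hG
  obtain ⟨hconn, happrox⟩ := hgood.wcmc_spec hε₀ hε₁
  refine ⟨(CMC.conn_iff_induce_connected hadj fun _ => Iff.rfl).1 hconn, fun T hT => ?_,
    hp n _ _⟩
  have h1 := happrox (fun v => decide (v ∈ T))
    ((CMC.conn_iff_induce_connected hadj (by simp)).2 hT)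
  rw [← CMC.cutWeight_eq_cutW G w T hadj (by simp)] at h1
  have hval : CMC.cutWeight G w (CMC.output (CMC.runWCMC ε G w)) =
      CMC.cutW (fun u v => decide (G.Adj u v)) (fun u v => w s(u, v))
        (CMC.wcmc ε (fun u v => decide (G.Adj u v)) fun u v => w s(u, v)).val :=
    CMC.cutWeight_eq_cutW G w _ hadj fun _ => Iff.rfl
  rw [hval]
  set β := CMC.cutW (fun u v => decide (G.Adj u v)) (fun u v => w s(u, v))
    (CMC.wcmc ε (fun u v => decide (G.Adj u v)) fun u v => w s(u, v)).val
  have hβ : 0 ≤ β := CMC.cutW_nonneg hgood.wt_nonneg _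
  -- For `n < 2` the logarithm is zero and so, by the convention for division by zero, is the
  -- left-hand side.
  rcases Nat.lt_or_ge n 2 with hn | hn
  · have : Real.log n = 0 := by
      rcases Nat.le_one_iff_eq_zero_or_eq_one.1 (Nat.le_of_lt_succ hn) with h | h <;> simp [h]
    simpa [this] using hβ
  · have hlog : 1 / 2 ≤ Real.log n := by
      have h2 : Real.log 2 ≤ Real.log n :=
        Real.log_le_log (by norm_num) (by exact_mod_cast hn)
      linarith [Real.log_two_gt_d9]
    have hsq : (1 + Real.log n) ^ 2 ≤ 9 * Real.log n ^ 2 := by nlinarith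
    have hpos : 0 < Real.log n ^ 2 := by positivity
    rw [div_div, div_mul_eq_mul_div, one_mul, div_le_iff₀ (by positivity)]
    calc CMC.cutWeight G w T ≤ CMC.lossFactor ε * (1 + Real.log n) ^ 2 * β := h1
      _ ≤ CMC.lossFactor ε * (9 * Real.log n ^ 2) * β := by gcongr
      _ = β * (9 * CMC.lossFactor ε * Real.log n ^ 2) := by ring
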